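/- Let $a>0$, $1<p\le 2$, and let $u_0\in C([0,a])$ with $u_0>0$ on $[0,a]$. Let $u$ be the maximal (nonnegative classical) solution, with maximal existence time $T_{\max}\in(0,+\infty]$, of $$u_t=u^p\,(u_{xx}+u-\bar u)\quad (0<t<T_{\max},\ 0<x<a),\qquad u_x(t,0)=u_x(t,a)=0\quad(0<t<T_{\max}),\qquad u(0,x)=u_0(x)\quad(0\le x\le a),$$ where $\bar u(t)=\frac1a\int_0^a u(t,x)\,dx$. Here classical means that $u\in C([0,T_{\max})\times[0,a])$ and $u_t,u_x,u_{xx}\in C((0,T_{\max})\times[0,a])$, and maximal means that $u$ cannot be extended to a solution on a longer time interval. Put $$E[u](t)=\int_0^a\left[u_x^2-(u-\bar u)^2\right]dx ,$$ with $E[u](0)=+\infty$ if $u_0\notin H^1((0,a))$. Then: (i) if there exists $t_0\in[0,T_{\max})$ such that $E[u](t_0)<0$, then $u$ blows up in finite time, i.e. $T_{\max}<+\infty$ and $u$ is unbounded on $[0,T_{\max})\times[0,a]$; (ii) if $E[u](t)\ge 0$ for all $0\le t<T_{\max}$, then $T_{\max}=+\infty$ and $u$ is bounded on $[0,+\infty)\times[0,a]$.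 -/

import Mathlib

open Set MeasureTheory

noncomputable section

namespace NonlocalFlow

/-- The spatial average `a⁻¹ ∫₀ᵃ φ dx` of a function on `[0, a]`. -/
def mean (a : ℝ) (φ : ℝ → ℝ) : ℝ :=
  a⁻¹ * ∫ x in (0 : ℝ)..a, φ x

/-- Membership of (the continuous representative) `φ` in the Sobolev space `H¹((0, a))`:
`φ` is absolutely continuous on `[0, a]` and its almost-everywhere derivative is in `L²((0, a))`.
Only the values of `φ` on `[0, a]` matter. -/
def MemH1 (a : ℝ) (φ : ℝ → ℝ) : Prop :=
  AbsolutelyContinuousOnInterval φ 0 a ∧ MemLp (deriv φ) 2 (volume.restrict (Ioo 0 a))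

open Classical in
/-- The energy `E[φ] = ∫₀ᵃ [φ_x² - (φ - φ̄)²] dx`. It is a real number when `φ ∈ H¹((0, a))`, and
`+∞` for a continuous `φ` outside `H¹((0, a))` (which can only happen for the initial datum). -/
def energy (a : ℝ) (φ : ℝ → ℝ) : EReal :=
  if MemH1 a φ then
    ((∫ x in (0 : ℝ)..a, ((deriv φ x) ^ 2 - (φ x - mean a φ) ^ 2) : ℝ) : EReal)
  else ⊤

/-- The set `[0, T) × [0, a]`, where `T ≤ +∞`. -/
def slab (a : ℝ) (T : EReal) : Set (ℝ × ℝ) :=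
  {z | 0 ≤ z.1 ∧ (z.1 : EReal) < T ∧ z.2 ∈ Icc 0 a}

/-- The set `(0, T) × [0, a]`, where `T ≤ +∞`. -/
def openSlab (a : ℝ) (T : EReal) : Set (ℝ × ℝ) :=
  {z | 0 < z.1 ∧ (z.1 : EReal) < T ∧ z.2 ∈ Icc 0 a}

/-- `u` (with `u t x` the value at time `t` and position `x`) is a nonnegative classical solution on
`[0, T) × [0, a]`, `0 < T ≤ +∞`, of
`u_t = u^p (u_xx + u - ū)` in `(0, T) × (0, a)`, `u_x = 0` at `x = 0` and `x = a`, `u(0, ·) = u₀`.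
Classical means `u ∈ C([0, T) × [0, a])` and `u_t, u_x, u_xx ∈ C((0, T) × [0, a])`; the spatial
derivatives at `x = 0` and `x = a` are one-sided. -/
structure IsSolution (p a : ℝ) (u₀ : ℝ → ℝ) (T : EReal) (u : ℝ → ℝ → ℝ) : Prop where
  time_pos : 0 < T
  continuousOn : ContinuousOn (fun z : ℝ × ℝ => u z.1 z.2) (slab a T)
  nonneg : ∀ t x : ℝ, (t, x) ∈ slab a T → 0 ≤ u t x
  initial : ∀ x ∈ Icc 0 a, u 0 x = u₀ x
  equation : ∃ ut ux uxx : ℝ → ℝ → ℝ,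
    ContinuousOn (fun z : ℝ × ℝ => ut z.1 z.2) (openSlab a T) ∧
    ContinuousOn (fun z : ℝ × ℝ => ux z.1 z.2) (openSlab a T) ∧
    ContinuousOn (fun z : ℝ × ℝ => uxx z.1 z.2) (openSlab a T) ∧
    (∀ t x : ℝ, (t, x) ∈ openSlab a T →
      HasDerivAt (fun s => u s x) (ut t x) t ∧
      HasDerivWithinAt (fun y => u t y) (ux t x) (Icc 0 a) x ∧
      HasDerivWithinAt (fun y => ux t y) (uxx t x) (Icc 0 a) x) ∧
    (∀ t x : ℝ, 0 < t → (t : EReal) < T → x ∈ Ioo 0 a →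
      ut t x = (u t x) ^ p * (uxx t x + u t x - mean a (u t))) ∧
    (∀ t : ℝ, 0 < t → (t : EReal) < T → ux t 0 = 0 ∧ ux t a = 0)

/-- `u` is a maximal solution and `T` is its maximal existence time `T_max`: `u` cannot be extended
to a solution on a strictly longer time interval. -/
structure IsMaximalSolution (p a : ℝ) (u₀ : ℝ → ℝ) (T : EReal) (u : ℝ → ℝ → ℝ) : Prop where
  isSolution : IsSolution p a u₀ T u
  maximal : ∀ (T' : EReal) (v : ℝ → ℝ → ℝ), IsSolution p a u₀ T' v →
    (∀ t x : ℝ, (t, x) ∈ slab a T → v t x = u t x) → T' ≤ T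

/-- `u` is bounded on `[0, T) × [0, a]`. -/
def IsBoundedOn (a : ℝ) (T : EReal) (u : ℝ → ℝ → ℝ) : Prop :=
  ∃ M : ℝ, ∀ t x : ℝ, (t, x) ∈ slab a T → |u t x| ≤ M

end NonlocalFlow

end

/-! Write F = u_xx + u - ū (`force`), so that u_t = u^p F, and W = ∫ u_t F = ∫ u^p F² ≥ 0. Since the
operator u ↦ F is symmetric under Neumann conditions, E = -∫ u F and E' = -2W: the energy decreases.
Multiplying the equation by u^(1-p) shows that ∫ Ψ(u) has derivative -E for every primitive Ψ of
s^(1-p); multiplying by u^(-p) and using ∫ F = 0 shows that ∫ u^(1-p) is conserved.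

Negative energy excludes a global solution. With y = ∫ u^(2-p), Cauchy-Schwarz gives E² ≤ y W
(`energyAt_sq_le`), and y' = -(2-p)E, E' = -2W give (y/(-E))' ≤ -p as long as E < 0. A positive
quantity cannot decrease at rate p forever (`energyAt_nonneg_of_global`). If the energy is known to
be negative only at t = 0, for a datum merely in H¹, `exists_energyAt_neg` finds a positive time
with negative energy, by a Bregman-type functional and the mean value theorem.

Nonnegative energy gives a bound. Then ∫ Ψ(u) does not increase. For p ≤ 2 a suitable Ψ dominates
the logarithm, so u can be very large only on a small set; the conserved integral bounds min u; and
E(t) ≤ E(t₁) bounds ∫ u_x² by ∫ u² plus a constant. Together these bound max u uniformly in time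
(`exists_bound_of_energy_le`).

Both halves then need the continuation principle: a bounded positive solution on a finite interval
extends (`exists_extension`). It is proved by space discretization. Grid flows restarted close to
the final time exist for a time depending only on the upper bound (`exists_gridFlow`). Discrete
energy estimates make their velocities Hölder continuous uniformly in the mesh
(`exists_vel_holder_bound`). A limit along an ultrafilter is a classical solution
(`exists_limit_flow`), and it coincides with the given solution as long as the latter lives, since
the scheme converges to any classical solution (`eventually_abs_sub_gridFlow_le`). Gluing the two
contradicts maximality. -/

noncomputable section

namespace NonlocalFlow

/-! ### Calculus on a uniform grid with reflecting ends -/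

/-- The right neighbour of a grid index, the last index being its own neighbour. -/
def up {n : ℕ} (i : Fin (n + 1)) : Fin (n + 1) := ⟨min (i + 1) n, by omega⟩

/-- The left neighbour of a grid index, the first index being its own neighbour. -/
def dn {n : ℕ} (i : Fin (n + 1)) : Fin (n + 1) := ⟨i - 1, by omega⟩

/-- The arithmetic mean of a grid function. -/
def avg {n : ℕ} (f : Fin (n + 1) → ℝ) : ℝ := (∑ i, f i) / (n + 1)

/-- The forward difference quotient. -/
def dif {n : ℕ} (h : ℝ) (f : Fin (n + 1) → ℝ) (i : Fin (n + 1)) : ℝ := (f (up i) - f i) / h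

/-- The discrete Neumann Laplacian. -/
def lap {n : ℕ} (h : ℝ) (f : Fin (n + 1) → ℝ) (i : Fin (n + 1)) : ℝ :=
  (f (up i) + f (dn i) - 2 * f i) / h ^ 2

/-- The discretization of `φ ↦ φ'' + φ - mean φ`. -/
def opA {n : ℕ} (h : ℝ) (f : Fin (n + 1) → ℝ) (i : Fin (n + 1)) : ℝ := lap h f i + f i - avg f

variable {n : ℕ}

lemma up_castSucc (i : Fin n) : up i.castSucc = i.succ := by
  apply Fin.ext
  simp only [up, Fin.val_castSucc, Fin.val_succ]
  omega

lemma up_last : up (Fin.last n) = Fin.last n := by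
  apply Fin.ext
  simp [up]

lemma dn_succ (i : Fin n) : dn i.succ = i.castSucc := by
  apply Fin.ext
  simp [dn]

lemma dn_zero : dn (0 : Fin (n + 1)) = 0 := by
  apply Fin.ext
  simp [dn]

/-- Both sums run over the edges between neighbours, indexed by the right or by the left endpoint.
The reflecting ends only add loops, on which `F` vanishes by `hF`. -/
lemma sum_dn_eq_sum_up (F : Fin (n + 1) → Fin (n + 1) → ℝ) (hF : ∀ i, F i i = 0) :
    ∑ i, F i (dn i) = ∑ i, F (up i) i := by
  rw [Fin.sum_univ_succ, Fin.sum_univ_castSucc (fun i => F (up i) i)]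
  simp [dn_zero, up_last, hF, dn_succ, up_castSucc]

lemma avg_add (f g : Fin (n + 1) → ℝ) : avg (fun i => f i + g i) = avg f + avg g := by
  simp [avg, Finset.sum_add_distrib, add_div]

lemma avg_sub (f g : Fin (n + 1) → ℝ) : avg (fun i => f i - g i) = avg f - avg g := by
  simp [avg, Finset.sum_sub_distrib, sub_div]

lemma avg_const_mul (c : ℝ) (f : Fin (n + 1) → ℝ) : avg (fun i => c * f i) = c * avg f := by
  simp [avg, ← Finset.mul_sum, mul_div_assoc]

lemma avg_mul_const (c : ℝ) (f : Fin (n + 1) → ℝ) : avg (fun i => f i * c) = avg f * c := by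
  simp only [mul_comm _ c, avg_const_mul]

lemma avg_const (c : ℝ) : avg (fun _ : Fin (n + 1) => c) = c := by
  simp only [avg, Finset.sum_const, Finset.card_univ, Fintype.card_fin, nsmul_eq_mul]
  push_cast
  field_simp

lemma avg_mono {f g : Fin (n + 1) → ℝ} (h : ∀ i, f i ≤ g i) : avg f ≤ avg g := by
  unfold avg
  gcongr with i
  exact h i

lemma avg_nonneg {f : Fin (n + 1) → ℝ} (h : ∀ i, 0 ≤ f i) : 0 ≤ avg f := by
  simpa [avg_const] using avg_mono (f := fun _ => 0) h

lemma avg_le_of_le {f : Fin (n + 1) → ℝ} {c : ℝ} (h : ∀ i, f i ≤ c) : avg f ≤ c := by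
  simpa [avg_const] using avg_mono (g := fun _ => c) h

lemma le_avg_of_le {f : Fin (n + 1) → ℝ} {c : ℝ} (h : ∀ i, c ≤ f i) : c ≤ avg f := by
  simpa [avg_const] using avg_mono (f := fun _ => c) h

lemma abs_avg_le {f : Fin (n + 1) → ℝ} {c : ℝ} (h : ∀ i, |f i| ≤ c) : |avg f| ≤ c :=
  abs_le.2 ⟨le_avg_of_le fun i => (abs_le.1 (h i)).1, avg_le_of_le fun i => (abs_le.1 (h i)).2⟩

lemma lap_sub (h : ℝ) (f g : Fin (n + 1) → ℝ) (i : Fin (n + 1)) :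
    lap h (fun i => f i - g i) i = lap h f i - lap h g i := by
  simp only [lap]; ring

/-- Summation by parts. -/
lemma avg_mul_lap (h : ℝ) (f g : Fin (n + 1) → ℝ) :
    avg (fun i => f i * lap h g i) = - avg (fun i => dif h f i * dif h g i) := by
  have key := sum_dn_eq_sum_up (fun i j : Fin (n + 1) => f i * (g i - g j)) (by simp)
  simp only [avg, ← neg_div, ← Finset.sum_neg_distrib]
  congr 1
  have h1 : ∀ i, f i * lap h g i = (f i * (g (up i) - g i) - f i * (g i - g (dn i))) * (1 / h ^ 2) := by
    intro i; simp only [lap]; ring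
  have h2 : ∀ i, -(dif h f i * dif h g i)
      = (f i * (g (up i) - g i) - f (up i) * (g (up i) - g i)) * (1 / h ^ 2) := by
    intro i; simp only [dif]; ring
  simp only [h1, h2, ← Finset.sum_mul, Finset.sum_sub_distrib, key]

/-- The bilinear form of `opA`. -/
lemma avg_mul_opA (h : ℝ) (f g : Fin (n + 1) → ℝ) :
    avg (fun i => f i * opA h g i) =
      - avg (fun i => dif h f i * dif h g i) + avg (fun i => f i * g i) - avg f * avg g := by
  rw [← avg_mul_lap, ← avg_mul_const, ← avg_add, ← avg_sub]
  congr 1; funext i; simp only [opA]; ring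

lemma avg_mul_opA_comm (h : ℝ) (f g : Fin (n + 1) → ℝ) :
    avg (fun i => f i * opA h g i) = avg (fun i => g i * opA h f i) := by
  rw [avg_mul_opA, avg_mul_opA]
  simp only [mul_comm]

/-- With `neg_avg_dif_sq_le`, this traps the quadratic form of `opA` between two expressions in the
Dirichlet sum and the square sum. The term dropped here is the squared mean; there it is the
variance. -/
lemma avg_mul_opA_self_le (h : ℝ) (f : Fin (n + 1) → ℝ) :
    avg (fun i => f i * opA h f i) ≤ - avg (fun i => dif h f i ^ 2) + avg (fun i => f i ^ 2) := by
  rw [avg_mul_opA]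
  simp only [← sq]
  nlinarith [sq_nonneg (avg f)]

lemma avg_sq_le (f : Fin (n + 1) → ℝ) : avg f ^ 2 ≤ avg (fun i => f i ^ 2) := by
  have h : 0 ≤ avg (fun i => (f i - avg f) ^ 2) := avg_nonneg fun i => sq_nonneg _
  have h2 : avg (fun i => (f i - avg f) ^ 2) = avg (fun i => f i ^ 2) - avg f ^ 2 := by
    have : (fun i => (f i - avg f) ^ 2)
        = fun i => (f i ^ 2 - (2 * avg f) * f i) + avg f ^ 2 := by funext i; ring
    rw [this, avg_add, avg_sub, avg_const_mul, avg_const]; ring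
  linarith

lemma neg_avg_dif_sq_le (h : ℝ) (f : Fin (n + 1) → ℝ) :
    - avg (fun i => dif h f i ^ 2) ≤ avg (fun i => f i * opA h f i) := by
  rw [avg_mul_opA]
  simp only [← sq]
  linarith [avg_sq_le f]

/-- Telescoping sum of the increments, by induction on the right endpoint. The bound on the
increments is needed only between `i` and `j`, which later permits local estimates. -/
lemma abs_sub_le_sum_Ico (f g : Fin (n + 1) → ℝ) {i j : Fin (n + 1)} (hij : i ≤ j)
    (hg : ∀ k, i ≤ k → k < j → |f (up k) - f k| ≤ g k) :
    |f j - f i| ≤ ∑ k ∈ Finset.Ico i j, g k := by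
  obtain ⟨j, hj⟩ := j
  induction j with
  | zero =>
    have : i = ⟨0, hj⟩ := le_antisymm hij (by simp)
    subst this; simp
  | succ j ih =>
    rcases eq_or_lt_of_le hij with h | h
    · subst h; simp
    · have hj' : j < n + 1 := by omega
      have hij' : i ≤ ⟨j, hj'⟩ := by
        simp only [Fin.lt_def, Fin.le_def] at h ⊢; omega
      have hlt : (⟨j, hj'⟩ : Fin (n + 1)) < ⟨j + 1, hj⟩ := by simp [Fin.lt_def]
      have h1 := ih hj' hij' (fun k h1 h2 => hg k h1 (h2.trans hlt))
      have h2 := hg ⟨j, hj'⟩ hij' hlt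
      have hup : up (⟨j, hj'⟩ : Fin (n + 1)) = ⟨j + 1, hj⟩ := by
        apply Fin.ext; simp only [up]; omega
      rw [hup] at h2
      have h3 : Finset.Ico i ⟨j + 1, hj⟩ = insert ⟨j, hj'⟩ (Finset.Ico i ⟨j, hj'⟩) := by
        ext k
        simp only [Finset.mem_Ico, Finset.mem_insert, Fin.lt_def, Fin.le_def, Fin.ext_iff] at *
        omega
      rw [h3, Finset.sum_insert (by simp)]
      calc |f ⟨j + 1, hj⟩ - f i| ≤ |f ⟨j + 1, hj⟩ - f ⟨j, hj'⟩| + |f ⟨j, hj'⟩ - f i| :=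
            abs_sub_le _ _ _
        _ ≤ _ := add_le_add h2 h1

lemma abs_sub_le_of_step (f : Fin (n + 1) → ℝ) {c : ℝ} {i j : Fin (n + 1)} (hij : i ≤ j)
    (hg : ∀ k, i ≤ k → k < j → |f (up k) - f k| ≤ c) :
    |f j - f i| ≤ ((j : ℝ) - i) * c := by
  refine (abs_sub_le_sum_Ico f (fun _ => c) hij hg).trans (le_of_eq ?_)
  rw [Finset.sum_const, Fin.card_Ico, nsmul_eq_mul, Nat.cast_sub hij]

/-- The discrete Morrey inequality. -/
lemma sq_sub_le_avg_dif_sq {a : ℝ} (ha : 0 < a) (f : Fin (n + 1) → ℝ) (i j : Fin (n + 1)) :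
    (f j - f i) ^ 2 ≤
      a * (a / (n + 1) * |(j : ℝ) - i|) * avg (fun k => dif (a / (n + 1)) f k ^ 2) := by
  have key : ∀ i j : Fin (n + 1), i ≤ j → (f j - f i) ^ 2 ≤
      a * (a / (n + 1) * |(j : ℝ) - i|) * avg (fun k => dif (a / (n + 1)) f k ^ 2) := by
    intro i j hij
    have hn : (0 : ℝ) < n + 1 := by positivity
    have h1 := abs_sub_le_sum_Ico f (fun k => |f (up k) - f k|) hij (fun k _ _ => le_rfl)
    have h2 := sq_sum_le_card_mul_sum_sq (s := Finset.Ico i j) (f := fun k => |f (up k) - f k|)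
    rw [Fin.card_Ico, Nat.cast_sub hij] at h2
    have hij' : (i : ℝ) ≤ j := by exact_mod_cast hij
    have h3 : ∑ k ∈ Finset.Ico i j, |f (up k) - f k| ^ 2 ≤ ∑ k, |f (up k) - f k| ^ 2 :=
      Finset.sum_le_sum_of_subset_of_nonneg (Finset.subset_univ _) (fun _ _ _ => by positivity)
    have h4 : a * (a / (n + 1) * |(j : ℝ) - i|) * avg (fun k => dif (a / (n + 1)) f k ^ 2)
        = ((j : ℝ) - i) * ∑ k, |f (up k) - f k| ^ 2 := by
      rw [abs_of_nonneg (by linarith : (0 : ℝ) ≤ (j : ℝ) - i)]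
      have : ∀ k, dif (a / (n + 1)) f k ^ 2 = (n + 1) ^ 2 / a ^ 2 * |f (up k) - f k| ^ 2 := by
        intro k; rw [sq_abs]; simp only [dif]; field_simp
      rw [show avg (fun k => dif (a / (n + 1)) f k ^ 2) =
        (n + 1) ^ 2 / a ^ 2 * avg (fun k => |f (up k) - f k| ^ 2) by
          rw [← avg_const_mul]; congr 1; funext k; exact this k]
      simp only [avg]
      field_simp
    rw [h4]
    calc (f j - f i) ^ 2 = |f j - f i| ^ 2 := (sq_abs _).symm
      _ ≤ (∑ k ∈ Finset.Ico i j, |f (up k) - f k|) ^ 2 := by gcongr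
      _ ≤ _ := h2
      _ ≤ _ := by gcongr
  rcases le_total i j with h | h
  · exact key i j h
  · have := key j i h
    rw [abs_sub_comm] at this
    nlinarith [this]

/-- The shift `up` repeats the last index, so that one square is counted twice; this costs the
factor 2. -/
lemma avg_sq_up_le (f : Fin (n + 1) → ℝ) :
    avg (fun i => f (up i) ^ 2) ≤ 2 * avg (fun i => f i ^ 2) := by
  unfold avg
  rw [← mul_div_assoc]
  gcongr
  rw [Fin.sum_univ_castSucc, up_last]
  simp only [up_castSucc]
  have h1 : ∑ i : Fin n, f i.succ ^ 2 ≤ ∑ i, f i ^ 2 := by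
    rw [Fin.sum_univ_succ]; nlinarith [sq_nonneg (f 0)]
  have h2 : f (Fin.last n) ^ 2 ≤ ∑ i, f i ^ 2 :=
    Finset.single_le_sum (f := fun i => f i ^ 2) (fun _ _ => sq_nonneg _) (Finset.mem_univ _)
  linarith

/-- A discrete Agmon inequality with a free parameter. -/
lemma sq_le_avg_sq_add {a : ℝ} (ha : 0 < a) (f : Fin (n + 1) → ℝ) {c : ℝ} (hc : 0 < c)
    (i : Fin (n + 1)) :
    f i ^ 2 ≤ avg (fun k => f k ^ 2) +
      a * (c * avg (fun k => dif (a / (n + 1)) f k ^ 2) + 2 / c * avg (fun k => f k ^ 2)) := by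
  have hn : (0 : ℝ) < n + 1 := by positivity
  set R := a * (c * avg (fun k => dif (a / (n + 1)) f k ^ 2) + 2 / c * avg (fun k => f k ^ 2))
    with hR
  -- `g k` bounds the increment of `f²` across one cell, by `f(up k)² - f(k)² = (f(up k) -
  -- f(k))(f(up k) + f(k))` and Young's inequality with weight `c`.
  set g : Fin (n + 1) → ℝ := fun k => a / (n + 1) *
    (c * dif (a / (n + 1)) f k ^ 2 + 1 / (2 * c) * (f (up k) ^ 2 + f k ^ 2)) with hgdef
  have hstep : ∀ k, |f (up k) ^ 2 - f k ^ 2| ≤ g k := by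
    intro k
    have h1 : f (up k) = f k + a / (n + 1) * dif (a / (n + 1)) f k := by
      simp only [dif]; field_simp; ring
    set d := dif (a / (n + 1)) f k
    have hh : 0 < a / ((n : ℝ) + 1) := by positivity
    have h2 : f (up k) ^ 2 - f k ^ 2 = a / (n + 1) * (d * (f (up k) + f k)) := by
      rw [h1]; ring
    rw [h2, abs_mul, abs_of_pos hh]
    refine mul_le_mul_of_nonneg_left ?_ hh.le
    have h3 : (f (up k) + f k) ^ 2 ≤ 2 * (f (up k) ^ 2 + f k ^ 2) := by
      nlinarith [sq_nonneg (f (up k) - f k)]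
    have h4 : |d * (f (up k) + f k)| ≤ c * d ^ 2 + 1 / (4 * c) * (f (up k) + f k) ^ 2 := by
      have e1 : 0 ≤ (2 * c * d - (f (up k) + f k)) ^ 2 / (4 * c) := by positivity
      have e2 : 0 ≤ (2 * c * d + (f (up k) + f k)) ^ 2 / (4 * c) := by positivity
      have e3 : (2 * c * d - (f (up k) + f k)) ^ 2 / (4 * c)
        = c * d ^ 2 + 1 / (4 * c) * (f (up k) + f k) ^ 2 - d * (f (up k) + f k) := by
        field_simp; ring
      have e4 : (2 * c * d + (f (up k) + f k)) ^ 2 / (4 * c)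
        = c * d ^ 2 + 1 / (4 * c) * (f (up k) + f k) ^ 2 + d * (f (up k) + f k) := by
        field_simp; ring
      rw [abs_le]; constructor <;> linarith
    have h5 : 1 / (4 * c) * (f (up k) + f k) ^ 2 ≤ 1 / (2 * c) * (f (up k) ^ 2 + f k ^ 2) := by
      calc 1 / (4 * c) * (f (up k) + f k) ^ 2
          ≤ 1 / (4 * c) * (2 * (f (up k) ^ 2 + f k ^ 2)) := by gcongr
        _ = _ := by field_simp; ring
    linarith
  have hg0 : ∀ k, 0 ≤ g k := fun k => (abs_nonneg _).trans (hstep k)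
  have hsum : ∑ k, g k ≤ R := by
    have h1 : ∑ k, g k = a * (c * avg (fun k => dif (a / (n + 1)) f k ^ 2) +
        1 / (2 * c) * (avg (fun k => f (up k) ^ 2) + avg (fun k => f k ^ 2))) := by
      rw [hgdef, ← Finset.mul_sum, ← avg_add, ← avg_const_mul, ← avg_const_mul, ← avg_add]
      simp only [avg]; ring
    rw [h1, hR]
    have h2 := avg_sq_up_le f
    have h3 : 0 ≤ avg (fun k => f k ^ 2) := avg_nonneg fun _ => sq_nonneg _
    refine mul_le_mul_of_nonneg_left (add_le_add le_rfl ?_) ha.le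
    calc 1 / (2 * c) * (avg (fun k => f (up k) ^ 2) + avg (fun k => f k ^ 2))
        ≤ 1 / (2 * c) * (4 * avg (fun k => f k ^ 2)) := by gcongr; linarith
      _ = _ := by field_simp; norm_num
  have hij : ∀ j, f i ^ 2 ≤ f j ^ 2 + R := by
    intro j
    have hs : ∀ s : Finset (Fin (n + 1)), ∑ k ∈ s, g k ≤ R := fun s =>
      (Finset.sum_le_sum_of_subset_of_nonneg (Finset.subset_univ _) (fun k _ _ => hg0 k)).trans hsum
    rcases le_total i j with h | h
    · have := abs_sub_le_sum_Ico (fun k => f k ^ 2) g h (fun k _ _ => hstep k)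
      have := (abs_le.1 (this.trans (hs _))).1
      linarith
    · have := abs_sub_le_sum_Ico (fun k => f k ^ 2) g h (fun k _ _ => hstep k)
      have := (abs_le.1 (this.trans (hs _))).2
      linarith
  -- Averaging over the reference point `j` replaces `f j ^ 2` by the mean square.
  have := le_avg_of_le (f := fun j => f j ^ 2 + R) (fun j => hij j)
  rwa [avg_add, avg_const] at this

/-! ### A first-touch principle -/

/-- A function that is positive at time `0`, and whose left derivative is positive wherever it
attains a vanishing minimum, stays positive. -/
lemma pos_of_firstTouch {X : Type*} [TopologicalSpace X] [CompactSpace X] {τ : ℝ}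
    {f : ℝ → X → ℝ}
    (hf : ContinuousOn (fun z : ℝ × X => f z.1 z.2) (Icc 0 τ ×ˢ univ))
    (h0 : ∀ x, 0 < f 0 x)
    (h : ∀ t ∈ Ioc 0 τ, ∀ x, f t x = 0 → (∀ y, 0 ≤ f t y) →
      ∃ d, 0 < d ∧ HasDerivWithinAt (fun s => f s x) d (Icc 0 τ) t)
    {t : ℝ} (ht : t ∈ Icc 0 τ) (x : X) : 0 < f t x := by
  by_contra! hneg
  set Z : Set (ℝ × X) := (Icc 0 τ ×ˢ univ) ∩ {z | f z.1 z.2 ∈ Iic 0} with hZ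
  have hK : IsCompact (Icc 0 τ ×ˢ (univ : Set X)) := isCompact_Icc.prod isCompact_univ
  have hZc : IsCompact Z := by
    obtain ⟨K, hKc, hKe⟩ := (continuousOn_iff_isClosed.1 hf) (Iic 0) isClosed_Iic
    have : Z = K ∩ (Icc 0 τ ×ˢ univ) := by
      rw [← hKe, hZ, inter_comm]; rfl
    rw [this]
    exact hK.inter_left hKc
  -- Compactness of the nonpositivity set `Z` yields an earliest time `t₁`; the function is positive
  -- before it, hence nonnegative at it, so the left difference quotients at `(t₁, x₁)` are
  -- nonpositive.
  obtain ⟨⟨t₁, x₁⟩, hmem, hmin⟩ := hZc.exists_isMinOn ⟨(t, x), ⟨⟨ht, mem_univ _⟩, hneg⟩⟩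
    (continuous_fst.continuousOn (s := Z))
  have ht₁ : t₁ ∈ Icc 0 τ := hmem.1.1
  have hle : f t₁ x₁ ≤ 0 := hmem.2
  have hbefore : ∀ s ∈ Ico 0 t₁, ∀ y, 0 < f s y := by
    intro s hs y
    by_contra! hc
    have : t₁ ≤ s := hmin (⟨⟨⟨hs.1, hs.2.le.trans ht₁.2⟩, mem_univ _⟩, hc⟩ : (s, y) ∈ Z)
    exact absurd hs.2 (not_lt.2 this)
  have hpos : 0 < t₁ := by
    rcases eq_or_lt_of_le ht₁.1 with h | h
    · rw [← h] at hle
      exact absurd (h0 x₁) (not_lt.2 hle)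
    · exact h
  have hcont : ∀ y, ContinuousWithinAt (fun s => f s y) (Ico 0 t₁) t₁ := by
    intro y
    have h1 : ContinuousOn (fun s => f s y) (Icc 0 τ) :=
      hf.comp (f := fun s => (s, y)) (by fun_prop) (fun s hs => ⟨hs, mem_univ _⟩)
    exact (h1 t₁ ht₁).mono (fun s hs => ⟨hs.1, hs.2.le.trans ht₁.2⟩)
  have hne : (nhdsWithin t₁ (Ico 0 t₁)).NeBot := by
    rw [← mem_closure_iff_nhdsWithin_neBot, closure_Ico hpos.ne]
    exact ⟨hpos.le, le_rfl⟩
  have hge : ∀ y, 0 ≤ f t₁ y := fun y =>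
    ge_of_tendsto (hcont y) (eventually_nhdsWithin_of_forall fun s hs => (hbefore s hs y).le)
  obtain ⟨d, hd, hderiv⟩ := h t₁ ⟨hpos, ht₁.2⟩ x₁ (le_antisymm hle (hge x₁)) hge
  have hderiv' : HasDerivWithinAt (fun s => f s x₁) d (Ico 0 t₁) t₁ :=
    hderiv.mono (fun s hs => ⟨hs.1, hs.2.le.trans ht₁.2⟩)
  rw [hasDerivWithinAt_iff_tendsto_slope' (by simp)] at hderiv'
  have : d ≤ 0 := le_of_tendsto hderiv' (eventually_nhdsWithin_of_forall fun s hs => by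
    rw [slope_def_field, le_antisymm hle (hge x₁)]
    exact div_nonpos_of_nonneg_of_nonpos (by linarith [hbefore s hs x₁]) (by linarith [hs.2]))
  linarith

end NonlocalFlow

namespace NonlocalFlow

/-! ### The semi-discrete flow -/

/-- The velocity of the semi-discrete flow. -/
def vel {n : ℕ} (p h : ℝ) (f : Fin (n + 1) → ℝ) (i : Fin (n + 1)) : ℝ := f i ^ p * opA h f i

/-- A solution of the semi-discrete flow on `[0, τ]` with values in `[m, M]`. -/
structure GridFlow (p a m M τ : ℝ) (n : ℕ) (u : ℝ → Fin (n + 1) → ℝ) : Prop where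
  hasDeriv : ∀ t ∈ Icc 0 τ, ∀ i,
    HasDerivWithinAt (fun s => u s i) (vel p (a / (n + 1)) (u t) i) (Icc 0 τ) t
  lower : ∀ t ∈ Icc 0 τ, ∀ i, m ≤ u t i
  upper : ∀ t ∈ Icc 0 τ, ∀ i, u t i ≤ M

/-- Truncation of a real number to `[m, M]`. -/
def clamp (m M s : ℝ) : ℝ := max m (min s M)

lemma clamp_mem {m M : ℝ} (h : m ≤ M) (s : ℝ) : clamp m M s ∈ Icc m M := by
  simp [clamp, h]

lemma clamp_mono (m M : ℝ) : Monotone (clamp m M) := fun s t h => by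
  unfold clamp; gcongr

lemma clamp_eq_self {m M s : ℝ} (h : s ∈ Icc m M) : clamp m M s = s := by
  simp [clamp, h.1, h.2]

lemma abs_clamp_sub_clamp_le (m M s t : ℝ) : |clamp m M s - clamp m M t| ≤ |s - t| := by
  have h1 := abs_max_sub_max_le_max m (min s M) m (min t M)
  have h2 := abs_min_sub_min_le_max s M t M
  simp only [sub_self, abs_zero, abs_nonneg, sup_of_le_right, sup_of_le_left] at h1 h2
  exact h1.trans h2

variable {n : ℕ}

lemma contDiff_opA (h : ℝ) (i : Fin (n + 1)) :
    ContDiff ℝ 1 (fun f : Fin (n + 1) → ℝ => opA h f i) := by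
  unfold opA lap avg
  fun_prop

lemma contDiffOn_vel (p h : ℝ) {m M : ℝ} (hm : 0 < m) :
    ContDiffOn ℝ 1 (fun (f : Fin (n + 1) → ℝ) i => vel p h f i) (univ.pi fun _ => Icc m M) := by
  rw [contDiffOn_pi]
  intro i
  refine ContDiffOn.mul ?_ (contDiff_opA h i).contDiffOn
  intro f hf
  have hfi : f i ≠ 0 := (hm.trans_le (hf i (mem_univ i)).1).ne'
  exact ((contDiff_apply ℝ ℝ i).contDiffAt.rpow_const_of_ne hfi).contDiffWithinAt

/-- Global solvability of the truncated semi-discrete flow. -/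
lemma exists_truncated_flow (p h : ℝ) {m M τ : ℝ} (hm : 0 < m) (hmM : m ≤ M) (hτ : 0 ≤ τ)
    (u₀ : Fin (n + 1) → ℝ) :
    ∃ u : ℝ → Fin (n + 1) → ℝ, u 0 = u₀ ∧ ∀ t ∈ Icc 0 τ, ∀ i,
      HasDerivWithinAt (fun s => u s i) (vel p h (fun j => clamp m M (u t j)) i) (Icc 0 τ) t := by
  set box : Set (Fin (n + 1) → ℝ) := univ.pi fun _ => Icc m M
  have hbox : IsCompact box := isCompact_univ_pi fun _ => isCompact_Icc
  have hconv : Convex ℝ box := convex_pi fun _ _ => convex_Icc _ _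
  have hC := contDiffOn_vel (n := n) p h (M := M) hm
  obtain ⟨K, hK⟩ := LocallyLipschitzOn.exists_lipschitzOnWith_of_compact hbox
    (hC.locallyLipschitzOn hconv)
  obtain ⟨L, hL⟩ := hbox.exists_bound_of_continuousOn hC.continuousOn
  have hcl : ∀ x : Fin (n + 1) → ℝ, (fun j => clamp m M (x j)) ∈ box :=
    fun x j _ => clamp_mem hmM _
  set F : (Fin (n + 1) → ℝ) → Fin (n + 1) → ℝ := fun x => vel p h (fun j => clamp m M (x j))
  have hcL : LipschitzWith 1 (fun (x : Fin (n + 1) → ℝ) j => clamp m M (x j)) := by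
    refine LipschitzWith.of_dist_le_mul fun x y => ?_
    rw [NNReal.coe_one, one_mul, dist_pi_le_iff dist_nonneg]
    intro j
    exact (abs_clamp_sub_clamp_le m M _ _).trans (dist_le_pi_dist x y j)
  have hF : LipschitzWith K F := by
    have := hK.comp (hcL.lipschitzOnWith (s := univ)) (fun x _ => hcl x)
    rw [mul_one, lipschitzOnWith_univ] at this
    exact this
  have hFL : ∀ x, ‖F x‖ ≤ L.toNNReal := fun x => (hL _ (hcl x)).trans (Real.le_coe_toNNReal L)
  -- The truncated field is Lipschitz and bounded by `L` on the whole space, so the ball of radius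
  -- `L τ` contains the orbit and Picard-Lindelöf reaches all of `[0, τ]` at once.
  have hPL : IsPicardLindelof (fun _ => F) (⟨0, le_rfl, hτ⟩ : Icc (0 : ℝ) τ) u₀
      (L.toNNReal * τ.toNNReal) 0 L.toNNReal K := by
    refine ⟨fun t _ => hF.lipschitzOnWith, fun x _ => continuousOn_const,
      fun t _ x _ => hFL x, ?_⟩
    simp [hτ]
  obtain ⟨u, hu0, hu⟩ := hPL.exists_eq_forall_mem_Icc_hasDerivWithinAt₀
  exact ⟨u, hu0, fun t ht i => hasDerivWithinAt_pi.1 (hu t ht) i⟩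

lemma lap_nonpos_of_isMax (h : ℝ) {f : Fin (n + 1) → ℝ} {i : Fin (n + 1)}
    (hi : ∀ j, f j ≤ f i) : lap h f i ≤ 0 :=
  div_nonpos_of_nonpos_of_nonneg (by linarith [hi (up i), hi (dn i)]) (sq_nonneg h)

lemma lap_nonneg_of_isMin (h : ℝ) {f : Fin (n + 1) → ℝ} {i : Fin (n + 1)}
    (hi : ∀ j, f i ≤ f j) : 0 ≤ lap h f i :=
  div_nonneg (by linarith [hi (up i), hi (dn i)]) (sq_nonneg h)

lemma continuousOn_uncurry_of_hasDeriv {s : Set ℝ} {u u' : ℝ → Fin (n + 1) → ℝ}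
    (hu : ∀ t ∈ s, ∀ i, HasDerivWithinAt (fun r => u r i) (u' t i) s t) :
    ContinuousOn (fun z : ℝ × Fin (n + 1) => u z.1 z.2) (s ×ˢ univ) := by
  rintro ⟨t, i⟩ ⟨ht, -⟩
  have h1 : ContinuousWithinAt (fun z : ℝ × Fin (n + 1) => u z.1 i) (s ×ˢ univ) (t, i) :=
    ContinuousWithinAt.comp (t := s) (g := fun r => u r i) (f := Prod.fst)
      (hu t ht i).continuousWithinAt continuous_fst.continuousWithinAt (fun z hz => hz.1)
  refine h1.congr_of_eventuallyEq ?_ rfl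
  have : ∀ᶠ z : ℝ × Fin (n + 1) in nhds (t, i), z.2 = i :=
    (continuous_snd.tendsto (t, i)) (IsOpen.mem_nhds (isOpen_discrete {i}) rfl)
  filter_upwards [nhdsWithin_le_nhds this] with z hz
  rw [hz]

/-- The semi-discrete flow exists on a time interval that only depends on an upper bound of
the initial datum, and stays bounded away from zero uniformly in the grid. -/
theorem exists_gridFlow {p M₀ m₀ : ℝ} (a : ℝ) (hp : 1 < p) (hm₀ : 0 < m₀) (hmM : m₀ < M₀) :
    ∃ m, 0 < m ∧ ∀ (n : ℕ) (u₀ : Fin (n + 1) → ℝ), (∀ i, m₀ < u₀ i) → (∀ i, u₀ i < M₀) →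
      ∃ u, GridFlow p a m (2 * M₀) (M₀ / (2 * (2 * M₀) ^ p * (2 * M₀))) n u ∧ u 0 = u₀ := by
  have hM₀ : 0 < M₀ := hm₀.trans hmM
  set M := 2 * M₀ with hM
  have hMpos : 0 < M := by positivity
  have hMp : 0 < M ^ p := by positivity
  -- The maximum grows at a rate at most `M ^ p * M`. The upper barrier `M₀ + K * M * t` is twice as
  -- steep, for strictness at a touching point, and reaches `2 * M₀ = M` exactly at time `τ`.
  set τ := M₀ / (2 * M ^ p * M) with hτdef
  have hτ : 0 < τ := by positivity
  set K := 2 * M ^ p with hKdef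
  have hK : 0 < K := by positivity
  -- Final value of the lower barrier `m₀ * exp (-K * t)`. With this choice the truncation to `[m,
  -- M]` is never active.
  set m := m₀ * Real.exp (-K * τ) with hmdef
  have hm : 0 < m := by positivity
  have hmm₀ : m ≤ m₀ := by
    have : Real.exp (-K * τ) ≤ 1 := Real.exp_le_one_iff.2 (by nlinarith)
    nlinarith
  have hmM' : m ≤ M := by linarith
  refine ⟨m, hm, fun n u₀ hl hr => ?_⟩
  obtain ⟨u, hu0, hu⟩ := exists_truncated_flow (n := n) p (a / (n + 1)) hm hmM' hτ.le u₀
  have hcont := continuousOn_uncurry_of_hasDeriv hu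
  set c : ℝ → Fin (n + 1) → ℝ := fun t j => clamp m M (u t j) with hc
  have hcm : ∀ t j, c t j ∈ Icc m M := fun t j => clamp_mem hmM' _
  have havg : ∀ t, 0 ≤ avg (c t) ∧ avg (c t) ≤ M := fun t =>
    ⟨avg_nonneg fun i => hm.le.trans (hcm t i).1, avg_le_of_le fun i => (hcm t i).2⟩
  have hupper : ∀ t ∈ Icc 0 τ, ∀ i, 0 < M₀ + K * M * t - u t i := by
    intro t ht i
    refine pos_of_firstTouch (f := fun t i => M₀ + K * M * t - u t i) (by fun_prop) ?_ ?_ ht i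
    · intro i; rw [hu0]; linarith [hr i]
    · intro t ht i h0 hy
      refine ⟨K * M - vel p (a / (n + 1)) (c t) i, ?_, ?_⟩
      · have hmax : ∀ j, c t j ≤ c t i := fun j => clamp_mono m M (by linarith [hy j])
        have hlap := lap_nonpos_of_isMax (a / (n + 1)) hmax
        have h1 : opA (a / (n + 1)) (c t) i ≤ M := by
          unfold opA; linarith [(hcm t i).2, (havg t).1]
        have h2 : 0 < c t i := hm.trans_le (hcm t i).1
        have h3 : c t i ^ p ≤ M ^ p := Real.rpow_le_rpow h2.le (hcm t i).2 (by linarith)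
        have h4 : vel p (a / (n + 1)) (c t) i ≤ M ^ p * M :=
          calc vel p (a / (n + 1)) (c t) i ≤ c t i ^ p * M := by unfold vel; gcongr
            _ ≤ _ := by gcongr
        have : 0 < M ^ p * M := by positivity
        rw [hKdef]; nlinarith
      · have h1 : HasDerivWithinAt (fun s : ℝ => M₀ + K * M * s) (K * M) (Icc 0 τ) t := by
          simpa using (((hasDerivAt_id t).const_mul (K * M)).const_add M₀).hasDerivWithinAt
        exact h1.sub (hu t (Ioc_subset_Icc_self ht) i)
  have hKMτ : K * M * τ = M₀ := by rw [hτdef, hKdef]; field_simp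
  have hupper' : ∀ t ∈ Icc 0 τ, ∀ i, u t i ≤ M := by
    intro t ht i
    have h1 := hupper t ht i
    have h2 : K * M * t ≤ K * M * τ := by gcongr; exact ht.2
    linarith
  have hlower : ∀ t ∈ Icc 0 τ, ∀ i, 0 < u t i - m₀ * Real.exp (-K * t) := by
    intro t ht i
    refine pos_of_firstTouch (f := fun t i => u t i - m₀ * Real.exp (-K * t)) (by fun_prop)
      ?_ ?_ ht i
    · intro i; rw [hu0]; simpa using hl i
    · intro t ht i h0 hy
      have ht' := Ioc_subset_Icc_self ht
      refine ⟨vel p (a / (n + 1)) (c t) i - m₀ * (Real.exp (-K * t) * -K), ?_, ?_⟩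
      -- Monotonicity of `clamp` carries the minimum of `u t` over to the truncated values, which
      -- are the ones seen by the Laplacian.
      · have hmin : ∀ j, c t i ≤ c t j := fun j => clamp_mono m M (by linarith [hy j])
        have hlap := lap_nonneg_of_isMin (a / (n + 1)) hmin
        have hui : m ≤ u t i := by
          have : Real.exp (-K * τ) ≤ Real.exp (-K * t) := Real.exp_le_exp.2 (by nlinarith [ht.2])
          have : m ≤ m₀ * Real.exp (-K * t) := by rw [hmdef]; gcongr
          linarith
        have hci : c t i = u t i := clamp_eq_self ⟨hui, hupper' t ht' i⟩
        have hupos : 0 < u t i := hm.trans_le hui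
        have h1 : -M ≤ opA (a / (n + 1)) (c t) i := by
          unfold opA; linarith [(hcm t i).1, (havg t).2]
        -- Since `p > 1`, one factor `u` can be split off: the velocity is at least `-M ^ p * u`,
        -- and the decay is at most exponential.
        have h2 : u t i ^ p = u t i ^ (p - 1) * u t i := by
          rw [← Real.rpow_add_one hupos.ne']; ring_nf
        have h3 : u t i ^ (p - 1) ≤ M ^ (p - 1) :=
          Real.rpow_le_rpow hupos.le (hupper' t ht' i) (by linarith)
        have h5 : M ^ (p - 1) * M = M ^ p := by
          rw [← Real.rpow_add_one hMpos.ne']; ring_nf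
        have h6 : -(M ^ p * u t i) ≤ vel p (a / (n + 1)) (c t) i :=
          calc -(M ^ p * u t i) = M ^ (p - 1) * u t i * -M := by rw [← h5]; ring
            _ ≤ u t i ^ p * -M := by
              rw [h2]
              have : u t i ^ (p - 1) * u t i ≤ M ^ (p - 1) * u t i := by gcongr
              nlinarith
            _ ≤ u t i ^ p * opA (a / (n + 1)) (c t) i := by gcongr
            _ = _ := by rw [vel, hci]
        have h7 : m₀ * Real.exp (-K * t) = u t i := by linarith
        have h8 : m₀ * (Real.exp (-K * t) * -K) = -(K * u t i) := by rw [← h7]; ring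
        have : 0 < M ^ p * u t i := by positivity
        rw [h8, hKdef]; linarith
      · have h1 : HasDerivWithinAt (fun s : ℝ => m₀ * Real.exp (-K * s))
            (m₀ * (Real.exp (-K * t) * -K)) (Icc 0 τ) t := by
          have := (((hasDerivAt_id t).const_mul (-K)).exp.const_mul m₀).hasDerivWithinAt
            (s := Icc 0 τ)
          simpa using this
        exact (hu t ht' i).sub h1
  have hlower' : ∀ t ∈ Icc 0 τ, ∀ i, m ≤ u t i := by
    intro t ht i
    have h1 := hlower t ht i
    have : Real.exp (-K * τ) ≤ Real.exp (-K * t) := Real.exp_le_exp.2 (by nlinarith [ht.2])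
    have : m ≤ m₀ * Real.exp (-K * t) := by rw [hmdef]; gcongr
    linarith
  refine ⟨u, ⟨fun t ht i => ?_, hlower', hupper'⟩, hu0⟩
  have : c t = u t := funext fun j => clamp_eq_self ⟨hlower' t ht j, hupper' t ht j⟩
  have h1 := hu t ht i
  rwa [show (fun j => clamp m M (u t j)) = u t from this] at h1

end NonlocalFlow

namespace NonlocalFlow

/-! ### Uniform energy estimates for the semi-discrete flow -/

variable {n : ℕ}

/-- The acceleration of the semi-discrete flow. -/
def acc (p h : ℝ) (f : Fin (n + 1) → ℝ) (i : Fin (n + 1)) : ℝ :=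
  f i ^ p * opA h (vel p h f) i + p * vel p h f i ^ 2 / f i

lemma hasDeriv_avg {f : ℝ → Fin (n + 1) → ℝ} {f' : Fin (n + 1) → ℝ} {s : Set ℝ} {t : ℝ}
    (hf : ∀ i, HasDerivWithinAt (fun r => f r i) (f' i) s t) :
    HasDerivWithinAt (fun r => avg (f r)) (avg f') s t := by
  unfold avg
  exact (HasDerivWithinAt.fun_sum fun i _ => hf i).div_const _

lemma hasDeriv_opA {h : ℝ} {f : ℝ → Fin (n + 1) → ℝ} {f' : Fin (n + 1) → ℝ} {s : Set ℝ} {t : ℝ}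
    (hf : ∀ i, HasDerivWithinAt (fun r => f r i) (f' i) s t) (i : Fin (n + 1)) :
    HasDerivWithinAt (fun r => opA h (f r) i) (opA h f' i) s t := by
  unfold opA lap
  exact (((((hf (up i)).add (hf (dn i))).sub ((hf i).const_mul 2)).div_const _).add (hf i)).sub
    (hasDeriv_avg hf)

lemma hasDeriv_avg_mul {f g : ℝ → Fin (n + 1) → ℝ} {f' g' : Fin (n + 1) → ℝ} {s : Set ℝ} {t : ℝ}
    (hf : ∀ i, HasDerivWithinAt (fun r => f r i) (f' i) s t)
    (hg : ∀ i, HasDerivWithinAt (fun r => g r i) (g' i) s t) :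
    HasDerivWithinAt (fun r => avg (fun i => f r i * g r i))
      (avg (fun i => f' i * g t i) + avg (fun i => f t i * g' i)) s t := by
  rw [← avg_add]
  exact hasDeriv_avg fun i => (hf i).mul (hg i)

/-- Product rule; the term `p f^(p-1) f' opA f` becomes `p vel² / f` because `vel = f^p opA f`. -/
lemma hasDeriv_vel {p h : ℝ} {f : ℝ → Fin (n + 1) → ℝ} {s : Set ℝ} {t : ℝ}
    (hf : ∀ i, HasDerivWithinAt (fun r => f r i) (vel p h (f t) i) s t) (i : Fin (n + 1))
    (hpos : 0 < f t i) :
    HasDerivWithinAt (fun r => vel p h (f r) i) (acc p h (f t) i) s t := by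
  have h1 := ((hf i).rpow_const (p := p) (Or.inl hpos.ne')).mul (hasDeriv_opA (h := h) hf i)
  refine h1.congr_deriv ?_
  have h2 : f t i ^ p = f t i ^ (p - 1) * f t i := by
    rw [← Real.rpow_add_one hpos.ne']; ring_nf
  unfold acc
  rw [add_comm]
  congr 1
  set v := vel p h (f t) i with hv
  have h3 : v = f t i ^ p * opA h (f t) i := rfl
  rw [eq_div_iff hpos.ne', sq]
  nth_rewrite 3 [h3]
  rw [h2]; ring

lemma le_of_hasDeriv_nonpos {F F' : ℝ → ℝ} {α β : ℝ}
    (hF : ∀ t ∈ Icc α β, HasDerivWithinAt F (F' t) (Icc α β) t)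
    (hF' : ∀ t ∈ Icc α β, F' t ≤ 0) {s t : ℝ} (hs : α ≤ s) (hst : s ≤ t) (ht : t ≤ β) :
    F t ≤ F s := by
  have : AntitoneOn F (Icc α β) := by
    refine antitoneOn_of_hasDerivWithinAt_nonpos (f' := F') (convex_Icc _ _)
      (fun t ht => (hF t ht).continuousWithinAt) ?_ ?_
    · intro x hx
      exact (hF x (interior_subset hx)).mono interior_subset
    · intro x hx
      exact hF' x (interior_subset hx)
  exact this ⟨hs, hst.trans ht⟩ ⟨hs.trans hst, ht⟩ hst

/-- The Agmon inequality with parameter 1: a bound of the maximum by the discrete `H¹` norm. -/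
lemma sq_le_of_dif {a : ℝ} (ha : 0 < a) (f : Fin (n + 1) → ℝ) (i : Fin (n + 1)) :
    f i ^ 2 ≤ (1 + 2 * a) * (avg (fun k => f k ^ 2) +
      avg (fun k => dif (a / (n + 1)) f k ^ 2)) := by
  have h1 := sq_le_avg_sq_add ha f one_pos i
  have h2 : 0 ≤ avg (fun k => dif (a / (n + 1)) f k ^ 2) := avg_nonneg fun _ => sq_nonneg _
  nlinarith [mul_nonneg ha.le h2]

section StateEstimates

variable {p a m M : ℝ} (hp : 0 < p) (ha : 0 < a) (hm : 0 < m) {f : Fin (n + 1) → ℝ}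
  (hl : ∀ i, m ≤ f i) (hr : ∀ i, f i ≤ M)

include hm hl in
lemma vel_mul_opA_nonneg (h : ℝ) (i : Fin (n + 1)) : 0 ≤ vel p h f i * opA h f i := by
  have : 0 < f i := hm.trans_le (hl i)
  have : vel p h f i * opA h f i = f i ^ p * opA h f i ^ 2 := by unfold vel; ring
  rw [this]; positivity

include hp hm hl hr in
lemma avg_vel_sq_le (h : ℝ) :
    avg (fun i => vel p h f i ^ 2) ≤ M ^ p * avg (fun i => vel p h f i * opA h f i) := by
  rw [← avg_const_mul]
  refine avg_mono fun i => ?_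
  have hpos : 0 < f i := hm.trans_le (hl i)
  have h1 : vel p h f i ^ 2 = f i ^ p * (vel p h f i * opA h f i) := by unfold vel; ring
  rw [h1]
  have := vel_mul_opA_nonneg (p := p) hm hl h i
  have h2 : f i ^ p ≤ M ^ p := Real.rpow_le_rpow hpos.le (hr i) hp.le
  gcongr

include hp ha hm hl hr in
-- The left side is the time derivative of the dissipation `y = avg (vel * opA f)`. It consists of
-- twice the quadratic form of `W = vel`, at most `-2D + 2Q`, and a cubic term in `W`. Young's
-- inequality and the Agmon bound for `max W²` estimate the cubic term by one `D` and a multiple of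
-- `(1 + Q)²`. One `-D` survives, and the growth is only quadratic in `y`.
lemma avg_acc_mul_opA_le :
    avg (fun i => acc p (a / (n + 1)) f i * opA (a / (n + 1)) f i) +
      avg (fun i => vel p (a / (n + 1)) f i * opA (a / (n + 1)) (vel p (a / (n + 1)) f) i) ≤
    - avg (fun i => dif (a / (n + 1)) (vel p (a / (n + 1)) f) i ^ 2) +
      (3 + (p / (m ^ p * m)) ^ 2 * (1 + 2 * a)) * (1 + M ^ p) ^ 2 *
        (1 + avg (fun i => vel p (a / (n + 1)) f i * opA (a / (n + 1)) f i)) ^ 2 := by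
  set h := a / ((n : ℝ) + 1)
  set W := vel p h f with hW
  set Q := avg (fun i => W i ^ 2) with hQ
  set D := avg (fun i => dif h W i ^ 2) with hD
  set y := avg (fun i => W i * opA h f i) with hy
  set κ := p / (m ^ p * m) with hκ
  have hQ0 : 0 ≤ Q := avg_nonneg fun _ => sq_nonneg _
  have hD0 : 0 ≤ D := avg_nonneg fun _ => sq_nonneg _
  have hmp : 0 < m ^ p := by positivity
  have hκ0 : 0 ≤ κ := by positivity
  have hQy : Q ≤ M ^ p * y := avg_vel_sq_le hp hm hl hr h
  have hy0 : 0 ≤ y := avg_nonneg fun i => vel_mul_opA_nonneg hm hl h i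
  have hMp : 0 ≤ M ^ p := by
    have : 0 < f 0 := hm.trans_le (hl 0)
    have : 0 < M := this.trans_le (hr 0)
    positivity
  have hsq : ∀ i, W i ^ 2 ≤ (1 + 2 * a) * (Q + D) := fun i => sq_le_of_dif ha W i
  have hcub : ∀ i, acc p h f i * opA h f i ≤ W i * opA h W i +
      W i ^ 2 * ((Q + D) / (1 + Q) + κ ^ 2 * ((1 + 2 * a) * (1 + Q) / 4)) := by
    intro i
    have hpos : 0 < f i := hm.trans_le (hl i)
    have hfp : 0 < f i ^ p := by positivity
    have hop : opA h f i = W i / f i ^ p := by rw [hW]; unfold vel; field_simp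
    have h1 : acc p h f i * opA h f i = W i * opA h W i + p * W i / (f i ^ p * f i) * W i ^ 2 := by
      have : acc p h f i = f i ^ p * opA h W i + p * W i ^ 2 / f i := rfl
      rw [this, hop]; field_simp
    rw [h1, mul_comm (W i ^ 2)]
    gcongr
    have h2 : p * W i / (f i ^ p * f i) ≤ κ * |W i| := by
      rw [hκ, mul_div_right_comm]
      refine (mul_le_mul_of_nonneg_left (le_abs_self (W i)) (by positivity)).trans ?_
      gcongr
      · exact hl i
      · exact hl i
    refine h2.trans ?_
    -- The Young parameter is chosen so that `W² / (4R) ≤ (Q + D) / (1 + Q)`: after multiplication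
    -- by `Q` the coefficient of `D` stays below 1.
    set R := (1 + 2 * a) * (1 + Q) / 4 with hR
    have hRpos : 0 < R := by positivity
    have h3 : κ * |W i| ≤ W i ^ 2 / (4 * R) + κ ^ 2 * R := by
      have e1 : 0 ≤ (|W i| - 2 * R * κ) ^ 2 / (4 * R) := by positivity
      have e2 : (|W i| - 2 * R * κ) ^ 2 / (4 * R)
          = |W i| ^ 2 / (4 * R) + κ ^ 2 * R - κ * |W i| := by field_simp; ring
      rw [sq_abs] at e2
      linarith
    refine h3.trans (add_le_add ?_ le_rfl)
    rw [div_le_div_iff₀ (by positivity) (by positivity), hR]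
    nlinarith [hsq i, mul_le_mul_of_nonneg_right (hsq i) (by positivity : 0 ≤ 1 + Q)]
  have h1 := avg_mono hcub
  rw [avg_add, avg_mul_const, ← hQ] at h1
  have h2 := avg_mul_opA_self_le h W
  rw [← hD, ← hQ] at h2
  have h3 : Q * ((Q + D) / (1 + Q) + κ ^ 2 * ((1 + 2 * a) * (1 + Q) / 4))
      ≤ Q + D + κ ^ 2 * (1 + 2 * a) * (1 + Q) ^ 2 := by
    have e1 : Q * ((Q + D) / (1 + Q)) ≤ Q + D := by
      rw [← mul_div_assoc, div_le_iff₀ (by positivity)]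
      nlinarith
    have e2 : Q * (κ ^ 2 * ((1 + 2 * a) * (1 + Q) / 4)) ≤ κ ^ 2 * (1 + 2 * a) * (1 + Q) ^ 2 := by
      have : 0 ≤ κ ^ 2 * (1 + 2 * a) * (1 + Q) := by positivity
      nlinarith
    rw [mul_add]; linarith
  have h4 : 1 + Q ≤ (1 + M ^ p) * (1 + y) := by nlinarith
  have h5 : (1 + Q) ^ 2 ≤ (1 + M ^ p) ^ 2 * (1 + y) ^ 2 := by
    rw [← mul_pow]; gcongr
  have h6 : 3 * Q ≤ 3 * (1 + Q) ^ 2 := by nlinarith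
  calc _ ≤ - D + (3 + κ ^ 2 * (1 + 2 * a)) * (1 + Q) ^ 2 := by linarith
    _ ≤ - D + (3 + κ ^ 2 * (1 + 2 * a)) * ((1 + M ^ p) ^ 2 * (1 + y) ^ 2) := by gcongr
    _ = _ := by ring

include hp ha hm hl hr in
-- Time derivative of the quadratic form `-avg (vel * opA vel)`. Put `b = acc` and `g = p vel² / f`;
-- then `opA vel = (b - g) / f^p`, and `-2b(b - g) ≤ g² - b²`. The good term `-b²` is kept for the
-- continuity in time, and `g²` is quartic in the velocity, hence controlled by the Agmon bound.
lemma neg_avg_acc_mul_opA_vel_le :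
    -2 * avg (fun i => acc p (a / (n + 1)) f i * opA (a / (n + 1)) (vel p (a / (n + 1)) f) i) ≤
    - (avg (fun i => acc p (a / (n + 1)) f i ^ 2) / M ^ p) +
      p ^ 2 / (m ^ p * m ^ 2) * (1 + 2 * a) * (avg (fun i => vel p (a / (n + 1)) f i ^ 2) *
        (avg (fun i => vel p (a / (n + 1)) f i ^ 2) +
          avg (fun i => dif (a / (n + 1)) (vel p (a / (n + 1)) f) i ^ 2))) := by
  set h := a / ((n : ℝ) + 1)
  set W := vel p h f with hW
  set Q := avg (fun i => W i ^ 2) with hQ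
  set D := avg (fun i => dif h W i ^ 2) with hD
  have hsq : ∀ i, W i ^ 2 ≤ (1 + 2 * a) * (Q + D) := fun i => sq_le_of_dif ha W i
  have key : ∀ i, -2 * (acc p h f i * opA h W i) ≤ -1 / M ^ p * acc p h f i ^ 2 +
      W i ^ 2 * (p ^ 2 / (m ^ p * m ^ 2) * ((1 + 2 * a) * (Q + D))) := by
    intro i
    have hpos : 0 < f i := hm.trans_le (hl i)
    have hM : 0 < M := hpos.trans_le (hr i)
    have hfp : 0 < f i ^ p := by positivity
    set b := acc p h f i with hb
    set g := p * W i ^ 2 / f i with hg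
    have hop : opA h W i = (b - g) / f i ^ p := by
      have : b = f i ^ p * opA h W i + g := rfl
      rw [this]; field_simp; ring
    have h1 : -2 * (b * opA h W i) ≤ (g ^ 2 - b ^ 2) / f i ^ p := by
      rw [hop, ← mul_div_assoc, ← mul_div_assoc]
      gcongr
      nlinarith [sq_nonneg (b - g)]
    have h2 : b ^ 2 / M ^ p ≤ b ^ 2 / f i ^ p := by
      gcongr; exact hr i
    have h3 : g ^ 2 / f i ^ p ≤ W i ^ 2 * (p ^ 2 / (m ^ p * m ^ 2) * ((1 + 2 * a) * (Q + D))) := by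
      have e1 : g ^ 2 / f i ^ p = W i ^ 2 * (p ^ 2 / (f i ^ p * f i ^ 2) * W i ^ 2) := by
        rw [hg]; field_simp
      rw [e1]
      gcongr
      · exact hl i
      · exact hl i
      · exact hsq i
    have h4 : -1 / M ^ p * b ^ 2 = - (b ^ 2 / M ^ p) := by ring
    rw [h4]
    rw [sub_div] at h1
    linarith
  have h1 := avg_mono key
  rw [avg_const_mul, avg_add, avg_const_mul, avg_mul_const, ← hQ] at h1
  refine h1.trans (le_of_eq ?_)
  ring

end StateEstimates

end NonlocalFlow

/-! ### Estimates along a grid flow, uniform in the mesh: dissipation, discrete `H¹` norm and Hölder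
continuity of the velocity. -/

namespace NonlocalFlow

variable {n : ℕ}

lemma dif_sub (h : ℝ) (f g : Fin (n + 1) → ℝ) (i : Fin (n + 1)) :
    dif h (fun i => f i - g i) i = dif h f i - dif h g i := by
  simp only [dif]; ring


section Flow

variable {p a m M τ : ℝ} {u : ℝ → Fin (n + 1) → ℝ}

lemma GridFlow.hasDeriv_vel (hu : GridFlow p a m M τ n u) (hm : 0 < m) {t : ℝ}
    (ht : t ∈ Icc 0 τ) (i : Fin (n + 1)) :
    HasDerivWithinAt (fun r => vel p (a / (n + 1)) (u r) i) (acc p (a / (n + 1)) (u t) i)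
      (Icc 0 τ) t :=
  NonlocalFlow.hasDeriv_vel (hu.hasDeriv t ht) i (hm.trans_le (hu.lower t ht i))

/-- The symmetry of `opA` doubles the term: up to sign, the discrete counterpart of E' = -2W. -/
lemma GridFlow.hasDeriv_energy (hu : GridFlow p a m M τ n u) {t : ℝ} (ht : t ∈ Icc 0 τ) :
    HasDerivWithinAt (fun r => avg (fun i => u r i * opA (a / (n + 1)) (u r) i))
      (2 * avg (fun i => vel p (a / (n + 1)) (u t) i * opA (a / (n + 1)) (u t) i))
      (Icc 0 τ) t := by
  refine (hasDeriv_avg_mul (hu.hasDeriv t ht) (hasDeriv_opA (hu.hasDeriv t ht))).congr_deriv ?_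
  rw [avg_mul_opA_comm _ (u t)]; ring

lemma GridFlow.hasDeriv_dissipation (hu : GridFlow p a m M τ n u) (hm : 0 < m) {t : ℝ}
    (ht : t ∈ Icc 0 τ) :
    HasDerivWithinAt
      (fun r => avg (fun i => vel p (a / (n + 1)) (u r) i * opA (a / (n + 1)) (u r) i))
      (avg (fun i => acc p (a / (n + 1)) (u t) i * opA (a / (n + 1)) (u t) i) +
        avg (fun i => vel p (a / (n + 1)) (u t) i *
          opA (a / (n + 1)) (vel p (a / (n + 1)) (u t)) i)) (Icc 0 τ) t :=
  hasDeriv_avg_mul (hu.hasDeriv_vel hm ht) (hasDeriv_opA (hu.hasDeriv t ht))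

lemma GridFlow.hasDeriv_velEnergy (hu : GridFlow p a m M τ n u) (hm : 0 < m) {t : ℝ}
    (ht : t ∈ Icc 0 τ) :
    HasDerivWithinAt
      (fun r => - avg (fun i => vel p (a / (n + 1)) (u r) i *
        opA (a / (n + 1)) (vel p (a / (n + 1)) (u r)) i))
      (-2 * avg (fun i => acc p (a / (n + 1)) (u t) i *
          opA (a / (n + 1)) (vel p (a / (n + 1)) (u t)) i)) (Icc 0 τ) t := by
  refine (hasDeriv_avg_mul (hu.hasDeriv_vel hm ht)
    (hasDeriv_opA (hu.hasDeriv_vel hm ht))).neg.congr_deriv ?_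
  rw [avg_mul_opA_comm _ (vel p (a / (n + 1)) (u t))]; ring

/-- Uniform bound of the dissipation. -/
lemma exists_dissipation_bound {B : ℝ} (hp : 0 < p) (ha : 0 < a) (hm : 0 < m) (hmM : m ≤ M)
    (hτ : 0 ≤ τ) (hB : 0 ≤ B) :
    ∃ Y, 0 ≤ Y ∧ ∀ (n : ℕ) (u : ℝ → Fin (n + 1) → ℝ), GridFlow p a m M τ n u →
      (∀ i, |lap (a / (n + 1)) (u 0) i| ≤ B) → ∀ t ∈ Icc 0 τ,
        avg (fun i => vel p (a / (n + 1)) (u t) i * opA (a / (n + 1)) (u t) i) ≤ Y := by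
  have hM : 0 < M := hm.trans_le hmM
  set C := (3 + (p / (m ^ p * m)) ^ 2 * (1 + 2 * a)) * (1 + M ^ p) ^ 2 with hC
  have hC0 : 0 ≤ C := by positivity
  set y₀ := M ^ p * (B + M) ^ 2 with hy₀
  have hy₀0 : 0 ≤ y₀ := by positivity
  -- The dissipation satisfies the Riccati inequality `y' ≤ C (1 + y)²`, which alone would permit
  -- blow-up. But `e' = 2y` with `e` bounded above, so `exp (-(C/2) e - C t)` is an integrating
  -- factor: it removes exactly `C (1 + y)` from the logarithmic derivative of `1 + y`.
  refine ⟨(1 + y₀) * Real.exp (C / 2 * (M ^ 2 + M * (B + M)) + C * τ), by positivity, ?_⟩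
  intro n u hu hlap t ht
  set h := a / ((n : ℝ) + 1)
  have h0 : (0 : ℝ) ∈ Icc 0 τ := ⟨le_rfl, hτ⟩
  set e : ℝ → ℝ := fun r => avg (fun i => u r i * opA h (u r) i) with he
  set y : ℝ → ℝ := fun r => avg (fun i => vel p h (u r) i * opA h (u r) i) with hy
  have hy0 : ∀ r ∈ Icc 0 τ, 0 ≤ y r := fun r hr =>
    avg_nonneg fun i => vel_mul_opA_nonneg hm (hu.lower r hr) h i
  have heup : ∀ r ∈ Icc 0 τ, e r ≤ M ^ 2 := by
    intro r hr
    refine (avg_mul_opA_self_le h (u r)).trans ?_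
    have h1 : 0 ≤ avg (fun i => dif h (u r) i ^ 2) := avg_nonneg fun _ => sq_nonneg _
    have h2 : avg (fun i => u r i ^ 2) ≤ M ^ 2 := avg_le_of_le fun i => by
      have := hu.lower r hr i
      have := hu.upper r hr i
      gcongr
      linarith
    linarith
  have hop0 : ∀ i, |opA h (u 0) i| ≤ B + M := by
    intro i
    have h1 := abs_le.1 (hlap i)
    have h2 : m ≤ avg (u 0) := le_avg_of_le fun i => hu.lower 0 h0 i
    have h3 : avg (u 0) ≤ M := avg_le_of_le fun i => hu.upper 0 h0 i
    have h4 := hu.lower 0 h0 i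
    have h5 := hu.upper 0 h0 i
    unfold opA
    rw [abs_le]; constructor <;> linarith
  have helow : -(M * (B + M)) ≤ e 0 := by
    refine le_avg_of_le fun i => ?_
    have h4 := hu.lower 0 h0 i
    have h5 := hu.upper 0 h0 i
    have h6 := (abs_le.1 (hop0 i)).1
    nlinarith
  have hyinit : y 0 ≤ y₀ := by
    refine avg_le_of_le fun i => ?_
    have hpos : 0 < u 0 i := hm.trans_le (hu.lower 0 h0 i)
    have h1 : vel p h (u 0) i * opA h (u 0) i = u 0 i ^ p * |opA h (u 0) i| ^ 2 := by
      rw [sq_abs]; unfold vel; ring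
    rw [h1, hy₀]
    gcongr
    · exact hu.upper 0 h0 i
    · exact hop0 i
  have hmono := le_of_hasDeriv_nonpos (α := 0) (β := τ)
    (F := fun r => (1 + y r) * Real.exp (-(C / 2) * e r - C * r))
    (F' := fun r => (avg (fun i => acc p h (u r) i * opA h (u r) i) +
        avg (fun i => vel p h (u r) i * opA h (vel p h (u r)) i)) *
          Real.exp (-(C / 2) * e r - C * r) +
        (1 + y r) * (Real.exp (-(C / 2) * e r - C * r) * (-(C / 2) * (2 * y r) - C)))
    (fun r hr => by
      have h1 := (hu.hasDeriv_dissipation hm hr).const_add 1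
      have h2 := (((hu.hasDeriv_energy hr).const_mul (-(C / 2))).sub
        ((hasDerivAt_id r).const_mul C).hasDerivWithinAt).exp
      simp only [mul_one] at h2
      exact h1.mul h2)
    (fun r hr => by
      have h1 := avg_acc_mul_opA_le hp ha hm (hu.lower r hr) (hu.upper r hr)
      have h2 : 0 ≤ avg (fun i => dif h (vel p h (u r)) i ^ 2) := avg_nonneg fun _ => sq_nonneg _
      have h3 : 0 < Real.exp (-(C / 2) * e r - C * r) := Real.exp_pos _
      have h4 : (avg (fun i => acc p h (u r) i * opA h (u r) i) +
        avg (fun i => vel p h (u r) i * opA h (vel p h (u r)) i)) ≤ C * (1 + y r) ^ 2 := by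
        linarith
      nlinarith [mul_le_mul_of_nonneg_right h4 h3.le])
    le_rfl ht.1 ht.2
  simp only [mul_zero, sub_zero] at hmono
  have hexp : 1 + y t ≤ (1 + y 0) * Real.exp (C / 2 * (e t - e 0) + C * t) := by
    have h1 : 0 < Real.exp (-(C / 2) * e t - C * t) := Real.exp_pos _
    rw [← mul_le_mul_iff_left₀ h1, mul_assoc (1 + y 0), ← Real.exp_add]
    refine hmono.trans (le_of_eq ?_)
    ring_nf
  have h7 : (1 + y 0) * Real.exp (C / 2 * (e t - e 0) + C * t) ≤
      (1 + y₀) * Real.exp (C / 2 * (M ^ 2 + M * (B + M)) + C * τ) := by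
    have := heup t ht
    have := ht.2
    gcongr
    linarith
  linarith

set_option maxHeartbeats 800000 in
/-- Uniform bound of the discrete `H¹` norm of the velocity, away from the initial time. -/
lemma exists_dif_vel_bound {B ε : ℝ} (hp : 0 < p) (ha : 0 < a) (hm : 0 < m) (hmM : m ≤ M)
    (hτ : 0 ≤ τ) (hB : 0 ≤ B) (hε : 0 < ε) :
    ∃ K, 0 ≤ K ∧ ∀ (n : ℕ) (u : ℝ → Fin (n + 1) → ℝ), GridFlow p a m M τ n u →
      (∀ i, |lap (a / (n + 1)) (u 0) i| ≤ B) → ∀ t ∈ Icc ε τ,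
        avg (fun i => vel p (a / (n + 1)) (u t) i ^ 2) ≤ K ∧
        avg (fun i => dif (a / (n + 1)) (vel p (a / (n + 1)) (u t)) i ^ 2) ≤ K := by
  obtain ⟨Y, hY0, hY⟩ := exists_dissipation_bound hp ha hm hmM hτ hB
  have hM : 0 < M := hm.trans_le hmM
  set C₂ := (3 + (p / (m ^ p * m)) ^ 2 * (1 + 2 * a)) * (1 + M ^ p) ^ 2 * (1 + Y) ^ 2 with hC₂
  set Q := M ^ p * Y with hQ
  have hQ0 : 0 ≤ Q := by positivity
  set C₃ := p ^ 2 / (m ^ p * m ^ 2) * (1 + 2 * a) * (Q * (1 + Q)) with hC₃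
  have hC₃0 : 0 ≤ C₃ := by positivity
  -- The term `-K₁ D` from the dissipation has to absorb `z ≤ D` and `r z' ≤ τ C₃ (1 + D)`; what is
  -- left over is the constant `K₂`.
  set K₁ := 1 + C₃ * τ with hK₁
  have hK₁0 : 0 ≤ K₁ := by positivity
  set K₂ := C₃ * τ + K₁ * C₂ with hK₂
  have hK₂0 : 0 ≤ K₂ := by positivity
  set K₃ := (K₁ * Y + K₂ * τ) / ε with hK₃
  have hK₃0 : 0 ≤ K₃ := by positivity
  refine ⟨K₃ + Q, by positivity, ?_⟩
  intro n u hu hlap t ht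
  have ht0 : t ∈ Icc 0 τ := ⟨hε.le.trans ht.1, ht.2⟩
  have h0 : (0 : ℝ) ∈ Icc 0 τ := ⟨le_rfl, hτ⟩
  have hYu := hY n u hu hlap
  set h := a / ((n : ℝ) + 1)
  set y : ℝ → ℝ := fun r => avg (fun i => vel p h (u r) i * opA h (u r) i) with hy
  set z : ℝ → ℝ := fun r => - avg (fun i => vel p h (u r) i * opA h (vel p h (u r)) i) with hz
  set D : ℝ → ℝ := fun r => avg (fun i => dif h (vel p h (u r)) i ^ 2) with hD
  have hy0 : ∀ r ∈ Icc 0 τ, 0 ≤ y r := fun r hr =>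
    avg_nonneg fun i => vel_mul_opA_nonneg hm (hu.lower r hr) h i
  have hD0 : ∀ r, 0 ≤ D r := fun r => avg_nonneg fun _ => sq_nonneg _
  have hQle : ∀ r ∈ Icc 0 τ, avg (fun i => vel p h (u r) i ^ 2) ≤ Q := fun r hr =>
    (avg_vel_sq_le hp hm (hu.lower r hr) (hu.upper r hr) h).trans (by
      rw [hQ]; gcongr; exact hYu r hr)
  -- Nothing is known about `z` at time 0, so it is weighted by the time `r`, which makes its
  -- initial value disappear. This is why the bound holds only from `ε` on and carries the factor `1
  -- / ε`.
  have hmono := le_of_hasDeriv_nonpos (α := 0) (β := τ)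
    (F := fun r => r * z r + K₁ * y r - K₂ * r)
    (F' := fun r => 1 * z r + r * (-2 * avg (fun i => acc p h (u r) i *
          opA h (vel p h (u r)) i)) + K₁ * (avg (fun i => acc p h (u r) i * opA h (u r) i) +
        avg (fun i => vel p h (u r) i * opA h (vel p h (u r)) i)) - K₂)
    (fun r hr => by
      have h1 := (hasDerivAt_id r).hasDerivWithinAt.mul (hu.hasDeriv_velEnergy hm hr)
      have h2 := (hu.hasDeriv_dissipation hm hr).const_mul K₁
      have h3 := ((hasDerivAt_id r).const_mul K₂).hasDerivWithinAt (s := Icc 0 τ)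
      exact ((h1.add h2).sub h3).congr_deriv (by simp only [id, mul_one]; rfl))
    (fun r hr => by
      have h1 := avg_acc_mul_opA_le hp ha hm (hu.lower r hr) (hu.upper r hr)
      have h2 := neg_avg_acc_mul_opA_vel_le hp ha hm (hu.lower r hr) (hu.upper r hr)
      have h3 := neg_avg_dif_sq_le h (vel p h (u r))
      have h4 : 0 ≤ avg (fun i => vel p h (u r) i ^ 2) := avg_nonneg fun _ => sq_nonneg _
      have h5 : 0 ≤ avg (fun i => acc p h (u r) i ^ 2) / M ^ p :=
        div_nonneg (avg_nonneg fun _ => sq_nonneg _) (by positivity)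
      have h6 : (avg (fun i => acc p h (u r) i * opA h (u r) i) +
        avg (fun i => vel p h (u r) i * opA h (vel p h (u r)) i)) ≤ - D r + C₂ := by
        have : (1 + y r) ^ 2 ≤ (1 + Y) ^ 2 := by
          have := hy0 r hr
          have := hYu r hr
          gcongr
        refine h1.trans (add_le_add le_rfl ?_)
        rw [hC₂]
        gcongr
      have h7 : -2 * avg (fun i => acc p h (u r) i * opA h (vel p h (u r)) i)
          ≤ C₃ * (1 + D r) := by
        have e1 : avg (fun i => vel p h (u r) i ^ 2) * (avg (fun i => vel p h (u r) i ^ 2) + D r)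
            ≤ Q * (1 + Q) * (1 + D r) := by
          calc _ ≤ Q * (Q + D r) := by
                have := hD0 r
                gcongr <;> exact hQle r hr
            _ ≤ Q * (Q + D r) + (Q + Q * (Q * D r)) :=
              le_add_of_nonneg_right (by have := hD0 r; positivity)
            _ = _ := by ring
        have e2 : p ^ 2 / (m ^ p * m ^ 2) * (1 + 2 * a) *
          (avg (fun i => vel p h (u r) i ^ 2) * (avg (fun i => vel p h (u r) i ^ 2) + D r))
            ≤ p ^ 2 / (m ^ p * m ^ 2) * (1 + 2 * a) * (Q * (1 + Q) * (1 + D r)) := by gcongr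
        have e3 : C₃ * (1 + D r) =
          p ^ 2 / (m ^ p * m ^ 2) * (1 + 2 * a) * (Q * (1 + Q) * (1 + D r)) := by
          rw [hC₃]; ring
        linarith
      have h8 : r * (-2 * avg (fun i => acc p h (u r) i * opA h (vel p h (u r)) i))
          ≤ τ * (C₃ * (1 + D r)) :=
        (mul_le_mul_of_nonneg_left h7 hr.1).trans
          (mul_le_mul_of_nonneg_right hr.2 (mul_nonneg hC₃0 (by linarith [hD0 r])))
      have h9 := mul_le_mul_of_nonneg_left h6 hK₁0
      have h10 : z r ≤ D r := by simp only [hz, hD]; linarith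
      rw [hK₂]
      rw [hK₁] at h9 ⊢
      linarith)
    le_rfl ht0.1 ht.2
  simp only [zero_mul, mul_zero, sub_zero, zero_add] at hmono
  have hzt : z t ≤ K₃ := by
    have h1 := hy0 t ht0
    have h2 := hYu 0 h0
    have h3 : t * z t ≤ K₁ * Y + K₂ * τ := by
      have e1 : K₂ * t ≤ K₂ * τ := by gcongr; exact ht.2
      have e2 : K₁ * y 0 ≤ K₁ * Y := by gcongr
      have e3 : 0 ≤ K₁ * y t := by positivity
      linarith
    rcases le_total (z t) 0 with h | h
    · exact h.trans hK₃0
    · rw [hK₃, le_div_iff₀ hε, mul_comm]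
      exact (mul_le_mul_of_nonneg_right ht.1 h).trans h3
  have hQt := hQle t ht0
  refine ⟨by linarith, ?_⟩
  have := avg_mul_opA_self_le h (vel p h (u t))
  have h3 : z t = - avg (fun i => vel p h (u t) i * opA h (vel p h (u t)) i) := rfl
  linarith

/-- Estimates the time integral of `avg acc²` through the bounded quantity `z`, and tests the
acceleration with the frozen difference `θ = vel (t) - vel (s)`, for which `avg θ²` is the time
integral of `avg (θ * acc)`. -/
lemma sq_avg_sub_le {B ε : ℝ} (hp : 0 < p) (ha : 0 < a) (hm : 0 < m) (hmM : m ≤ M)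
    (hτ : 0 ≤ τ) (hB : 0 ≤ B) (hε : 0 < ε) :
    ∃ K, 0 ≤ K ∧ ∀ (n : ℕ) (u : ℝ → Fin (n + 1) → ℝ), GridFlow p a m M τ n u →
      (∀ i, |lap (a / (n + 1)) (u 0) i| ≤ B) → ∀ s t, ε ≤ s → s < t → t ≤ τ →
        avg (fun i => (vel p (a / (n + 1)) (u t) i - vel p (a / (n + 1)) (u s) i) ^ 2)
          ≤ K * (t - s) := by
  obtain ⟨K, hK0, hK⟩ := exists_dif_vel_bound hp ha hm hmM hτ hB hε
  have hM : 0 < M := hm.trans_le hmM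
  set C := p ^ 2 / (m ^ p * m ^ 2) * (1 + 2 * a) * (K * (K + K)) with hC
  have hC0 : 0 ≤ C := by positivity
  refine ⟨M ^ p * (C * τ + 2 * K), by positivity, ?_⟩
  intro n u hu hlap s t hs hst ht
  have hKu := hK n u hu hlap
  set h := a / ((n : ℝ) + 1)
  set z : ℝ → ℝ := fun r => - avg (fun i => vel p h (u r) i * opA h (vel p h (u r)) i) with hz
  have hzbd : ∀ r ∈ Icc ε τ, -K ≤ z r ∧ z r ≤ K := by
    intro r hr
    have h1 := avg_mul_opA_self_le h (vel p h (u r))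
    have h2 := neg_avg_dif_sq_le h (vel p h (u r))
    have h3 : 0 ≤ avg (fun i => dif h (vel p h (u r)) i ^ 2) := avg_nonneg fun _ => sq_nonneg _
    have h4 := hKu r hr
    simp only [hz]
    constructor <;> linarith
  set θ : Fin (n + 1) → ℝ := fun i => vel p h (u t) i - vel p h (u s) i with hθ
  set S := avg (fun i => θ i ^ 2) with hS
  have hS0 : 0 ≤ S := avg_nonneg fun _ => sq_nonneg _
  set δ := t - s with hδ
  have hδ0 : 0 < δ := by linarith
  have hsub : Icc ε τ ⊆ Icc 0 τ := Icc_subset_Icc hε.le le_rfl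
  have hMp : 0 < M ^ p := by positivity
  -- Young's inequality with weight `δ = t - s` leaves `δ/2 * avg acc²`; adding `M^p δ/2 * z`
  -- cancels it. Over an interval of length `δ` the term `S / (2δ)` integrates to `S / 2`, which is
  -- absorbed.
  have hmono := le_of_hasDeriv_nonpos (α := ε) (β := τ)
    (F := fun r => avg (fun i => θ i * vel p h (u r) i) - (1 / (2 * δ) * S + M ^ p * δ / 2 * C) * r
      + M ^ p * δ / 2 * z r)
    (F' := fun r => avg (fun i => θ i * acc p h (u r) i) - (1 / (2 * δ) * S + M ^ p * δ / 2 * C)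
      + M ^ p * δ / 2 * (-2 * avg (fun i => acc p h (u r) i * opA h (vel p h (u r)) i)))
    (fun r hr => by
      have h1 := hasDeriv_avg (f := fun r i => θ i * vel p h (u r) i) fun i =>
        (hu.hasDeriv_vel hm (hsub hr) i).const_mul (θ i)
      have h2 := ((hasDerivAt_id r).const_mul
        (1 / (2 * δ) * S + M ^ p * δ / 2 * C)).hasDerivWithinAt (s := Icc 0 τ)
      have h3 := (hu.hasDeriv_velEnergy hm (hsub hr)).const_mul (M ^ p * δ / 2)
      exact (((h1.sub h2).add h3).mono hsub).congr_deriv (by simp only [mul_one]; rfl))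
    (fun r hr => by
      have h2 := neg_avg_acc_mul_opA_vel_le hp ha hm (hu.lower r (hsub hr)) (hu.upper r (hsub hr))
      have hb := hKu r hr
      have h3 : 0 ≤ avg (fun i => vel p h (u r) i ^ 2) := avg_nonneg fun _ => sq_nonneg _
      have h4 : 0 ≤ avg (fun i => dif h (vel p h (u r)) i ^ 2) := avg_nonneg fun _ => sq_nonneg _
      set P := avg (fun i => acc p h (u r) i ^ 2) with hP
      have h5 : -2 * avg (fun i => acc p h (u r) i * opA h (vel p h (u r)) i)
          ≤ - (P / M ^ p) + C := by
        refine h2.trans (add_le_add le_rfl ?_)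
        rw [hC]
        gcongr
        · exact hb.1
        · exact hb.1
        · exact hb.2
      have h6 : avg (fun i => θ i * acc p h (u r) i) ≤ 1 / (2 * δ) * S + δ / 2 * P := by
        rw [hS, hP, ← avg_const_mul, ← avg_const_mul, ← avg_add]
        refine avg_mono fun i => ?_
        have e1 : 0 ≤ (θ i - δ * acc p h (u r) i) ^ 2 / (2 * δ) := by positivity
        have e2 : (θ i - δ * acc p h (u r) i) ^ 2 / (2 * δ) = 1 / (2 * δ) * θ i ^ 2 +
            δ / 2 * acc p h (u r) i ^ 2 - θ i * acc p h (u r) i := by field_simp; ring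
        linarith
      have h7 := mul_le_mul_of_nonneg_left h5 (by positivity : 0 ≤ M ^ p * δ / 2)
      have h8 : M ^ p * δ / 2 * (-(P / M ^ p) + C) = - (δ / 2 * P) + M ^ p * δ / 2 * C := by
        field_simp
      linarith)
    hs hst.le ht
  have h1 : avg (fun i => θ i * vel p h (u t) i) - avg (fun i => θ i * vel p h (u s) i) = S := by
    rw [← avg_sub, hS]; congr 1; funext i; simp only [hθ]; ring
  have h2 := hzbd t ⟨hs.trans hst.le, ht⟩
  have h3 := hzbd s ⟨hs, hst.le.trans ht⟩
  have h4 : 1 / (2 * δ) * S * δ = S / 2 := by field_simp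
  have h5 : δ ≤ τ := by linarith
  have h6 : S / 2 ≤ M ^ p * δ / 2 * (C * δ + 2 * K) := by
    have e1 : M ^ p * δ / 2 * (z s - z t) ≤ M ^ p * δ / 2 * (2 * K) := by
      gcongr; linarith
    have e2 : (1 / (2 * δ) * S + M ^ p * δ / 2 * C) * t - (1 / (2 * δ) * S + M ^ p * δ / 2 * C) * s
      = S / 2 + M ^ p * δ / 2 * (C * δ) := by
      rw [← h4, hδ]; ring
    linarith
  have h7 : M ^ p * δ / 2 * (C * δ + 2 * K) ≤ M ^ p * δ / 2 * (C * τ + 2 * K) := by gcongr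
  have h8 : M ^ p * (C * τ + 2 * K) * δ = 2 * (M ^ p * δ / 2 * (C * τ + 2 * K)) := by ring
  linarith

/-- Uniform Hölder estimates for the velocity of the semi-discrete flow. -/
theorem exists_vel_holder_bound {B ε : ℝ} (hp : 0 < p) (ha : 0 < a) (hm : 0 < m) (hmM : m ≤ M)
    (hτ : 0 ≤ τ) (hB : 0 ≤ B) (hε : 0 < ε) :
    ∃ C, 0 ≤ C ∧ ∀ (n : ℕ) (u : ℝ → Fin (n + 1) → ℝ), GridFlow p a m M τ n u →
      (∀ i, |lap (a / (n + 1)) (u 0) i| ≤ B) → ∀ s ∈ Icc ε τ, ∀ t ∈ Icc ε τ, ∀ i j,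
        |vel p (a / (n + 1)) (u t) i| ≤ C ∧
        |vel p (a / (n + 1)) (u t) j - vel p (a / (n + 1)) (u t) i| ≤
          C * √(a / (n + 1) * |(j : ℝ) - i|) ∧
        |vel p (a / (n + 1)) (u t) i - vel p (a / (n + 1)) (u s) i| ≤ C * √√|t - s| := by
  obtain ⟨K, hK0, hK⟩ := exists_dif_vel_bound hp ha hm hmM hτ hB hε
  obtain ⟨L, hL0, hL⟩ := sq_avg_sub_le hp ha hm hmM hτ hB hε
  set C₁ := (1 + 2 * a) * (K + K) with hC₁
  set C₃ := L * √τ + a * (4 * K + 2 * L) with hC₃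
  have hC₃0 : 0 ≤ C₃ := by positivity
  refine ⟨√C₁ + √(a * K) + √C₃, by positivity, ?_⟩
  intro n u hu hlap
  have hKu := hK n u hu hlap
  have hLu := hL n u hu hlap
  set h := a / ((n : ℝ) + 1) with hh
  have hh0 : 0 < h := by positivity
  have htime : ∀ s t i, ε ≤ s → s < t → t ≤ τ →
      |vel p h (u t) i - vel p h (u s) i| ≤ √C₃ * √√|t - s| := by
    intro s t i hs hst ht
    set θ : Fin (n + 1) → ℝ := fun i => vel p h (u t) i - vel p h (u s) i with hθ
    have hδ : 0 < t - s := by linarith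
    have hS : avg (fun k => θ k ^ 2) ≤ L * (t - s) := hLu s t hs hst ht
    have hD : avg (fun k => dif h θ k ^ 2) ≤ 4 * K := by
      have h1 : ∀ k, dif h θ k ^ 2 ≤ 2 * dif h (vel p h (u t)) k ^ 2 +
          2 * dif h (vel p h (u s)) k ^ 2 := by
        intro k
        rw [hθ, dif_sub]
        nlinarith [sq_nonneg (dif h (vel p h (u t)) k + dif h (vel p h (u s)) k)]
      have h2 := avg_mono h1
      rw [avg_add, avg_const_mul, avg_const_mul] at h2
      linarith [(hKu t ⟨hs.trans hst.le, ht⟩).2, (hKu s ⟨hs, hst.le.trans ht⟩).2]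
    -- With this Agmon parameter both contributions, `r * D` and `(t - s) / r`, have order `r`;
    -- hence the Hölder exponent 1/4 in time.
    set r := √(t - s) with hr
    have hr0 : 0 < r := Real.sqrt_pos.2 hδ
    have hrr : t - s = r * r := (Real.mul_self_sqrt hδ.le).symm
    have hrτ : r ≤ √τ := Real.sqrt_le_sqrt (by linarith)
    have h1 := sq_le_avg_sq_add ha θ hr0 i
    have h2 : θ i ^ 2 ≤ C₃ * r := by
      have hS0 : 0 ≤ avg (fun k => θ k ^ 2) := avg_nonneg fun _ => sq_nonneg _
      calc θ i ^ 2 ≤ L * (t - s) + a * (r * (4 * K) + 2 / r * (L * (t - s))) := by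
            refine h1.trans ?_
            gcongr
        _ = r * (L * r + a * (4 * K + 2 * L)) := by rw [hrr]; field_simp
        _ ≤ r * C₃ := by rw [hC₃]; gcongr
        _ = _ := mul_comm _ _
    rw [abs_of_pos hδ, ← Real.sqrt_mul hC₃0]
    exact Real.abs_le_sqrt h2
  intro s hs t ht i j
  refine ⟨?_, ?_, ?_⟩
  · have h1 := sq_le_of_dif ha (vel p h (u t)) i
    have h2 : vel p h (u t) i ^ 2 ≤ C₁ := h1.trans (by
      rw [hC₁]; gcongr
      · exact (hKu t ht).1
      · exact (hKu t ht).2)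
    have h3 := Real.abs_le_sqrt h2
    have : 0 ≤ √(a * K) := Real.sqrt_nonneg _
    have : 0 ≤ √C₃ := Real.sqrt_nonneg _
    linarith
  · have h1 := sq_sub_le_avg_dif_sq ha (vel p h (u t)) i j
    have h2 : (vel p h (u t) j - vel p h (u t) i) ^ 2 ≤ (a * K) * (h * |(j : ℝ) - i|) := by
      refine h1.trans ?_
      calc a * (h * |(j : ℝ) - i|) * avg (fun k => dif h (vel p h (u t)) k ^ 2)
          ≤ a * (h * |(j : ℝ) - i|) * K := by gcongr; exact (hKu t ht).2
        _ = _ := by ring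
    have h3 := Real.abs_le_sqrt h2
    rw [Real.sqrt_mul (by positivity)] at h3
    refine h3.trans ?_
    gcongr
    have : 0 ≤ √C₁ := Real.sqrt_nonneg _
    have : 0 ≤ √C₃ := Real.sqrt_nonneg _
    linarith
  · have hle : √C₃ * √√|t - s| ≤ (√C₁ + √(a * K) + √C₃) * √√|t - s| := by
      gcongr
      have : 0 ≤ √C₁ := Real.sqrt_nonneg _
      have : 0 ≤ √(a * K) := Real.sqrt_nonneg _
      linarith
    refine le_trans ?_ hle
    rcases lt_trichotomy s t with hst | hst | hst
    · exact htime s t i hs.1 hst ht.2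
    · subst hst; simp
    · have := htime t s i ht.1 hst hs.2
      rwa [abs_sub_comm, abs_sub_comm s t] at this

end Flow

end NonlocalFlow

namespace NonlocalFlow

/-! ### Grid points and Riemann sums -/

/-- The midpoint of the `i`-th of `n + 1` cells of `[0, a]`. -/
def pt (a : ℝ) (n : ℕ) (i : Fin (n + 1)) : ℝ := ((i : ℝ) + 1 / 2) * (a / (n + 1))

/-- The index of a cell of `[0, a]` containing `x`. -/
def idx (a : ℝ) (n : ℕ) (x : ℝ) : Fin (n + 1) := ⟨min ⌊x / (a / (n + 1))⌋₊ n, by omega⟩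

section

variable {a : ℝ} {n : ℕ}

lemma step_pos (ha : 0 < a) (n : ℕ) : 0 < a / ((n : ℝ) + 1) := by positivity

lemma pt_mem (ha : 0 < a) (i : Fin (n + 1)) : pt a n i ∈ Icc 0 a := by
  have hi : (i : ℝ) + 1 ≤ n + 1 := by exact_mod_cast i.is_lt
  have hn : (0 : ℝ) < n + 1 := by positivity
  refine ⟨by unfold pt; positivity, ?_⟩
  unfold pt
  rw [← mul_div_assoc, div_le_iff₀ hn]
  nlinarith

lemma pt_sub (i j : Fin (n + 1)) : pt a n j - pt a n i = ((j : ℝ) - i) * (a / (n + 1)) := by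
  unfold pt; ring

lemma abs_pt_sub (ha : 0 < a) (i j : Fin (n + 1)) :
    |pt a n j - pt a n i| = a / (n + 1) * |(j : ℝ) - i| := by
  rw [pt_sub, abs_mul, abs_of_pos (step_pos ha n), mul_comm]

lemma val_up {i : Fin (n + 1)} (hi : (i : ℕ) < n) : ((up i : Fin (n + 1)) : ℕ) = i + 1 := by
  simp only [up]; omega

lemma dn_up {i : Fin (n + 1)} (hi : (i : ℕ) < n) : dn (up i) = i := by
  apply Fin.ext; simp only [up, dn]; omega

lemma abs_pt_up_sub_le (ha : 0 < a) (i : Fin (n + 1)) :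
    |pt a n (up i) - pt a n i| ≤ a / (n + 1) := by
  have h := step_pos ha n
  rw [abs_pt_sub ha]
  have h1 : |((up i : Fin (n + 1)) : ℝ) - i| ≤ 1 := by
    have h2 : ((up i : Fin (n + 1)) : ℕ) ≤ i + 1 ∧ (i : ℕ) ≤ (up i : Fin (n + 1)) := by
      have := i.is_lt
      simp only [up]; omega
    have h3 : ((up i : Fin (n + 1)) : ℝ) ≤ i + 1 := by exact_mod_cast h2.1
    have h4 : (i : ℝ) ≤ (up i : Fin (n + 1)) := by exact_mod_cast h2.2
    rw [abs_le]; constructor <;> linarith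
  nlinarith

lemma abs_pt_idx_sub_le (ha : 0 < a) (n : ℕ) {x : ℝ} (hx : x ∈ Icc 0 a) :
    |pt a n (idx a n x) - x| ≤ a / (n + 1) := by
  have hh := step_pos ha n
  set h := a / ((n : ℝ) + 1) with hdef
  have hn : (0 : ℝ) < n + 1 := by positivity
  have hq : 0 ≤ x / h := div_nonneg hx.1 hh.le
  have h1 := Nat.floor_le hq
  have h2 := Nat.lt_floor_add_one (x / h)
  have hxq : x = x / h * h := by field_simp
  have hval : ((idx a n x : Fin (n + 1)) : ℝ) = min (⌊x / h⌋₊ : ℝ) n := by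
    simp only [idx]; push_cast; rfl
  have hq2 : x / h ≤ n + 1 := by
    rw [div_le_iff₀ hh, hdef]; field_simp; exact hx.2
  unfold pt
  rw [hval, ← hdef]
  have : |(min (⌊x / h⌋₊ : ℝ) n + 1 / 2) - x / h| ≤ 1 := by
    rcases le_total (⌊x / h⌋₊ : ℝ) n with h3 | h3
    · rw [min_eq_left h3, abs_le]; constructor <;> linarith
    · rw [min_eq_right h3, abs_le]; constructor <;> linarith
  calc |(min (⌊x / h⌋₊ : ℝ) n + 1 / 2) * h - x|
      = |((min (⌊x / h⌋₊ : ℝ) n + 1 / 2) - x / h) * h| := by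
        congr 1; rw [sub_mul, ← hxq]
    _ = |(min (⌊x / h⌋₊ : ℝ) n + 1 / 2) - x / h| * h := by rw [abs_mul, abs_of_pos hh]
    _ ≤ 1 * h := by gcongr
    _ = h := one_mul h

lemma tendsto_step (a : ℝ) :
    Filter.Tendsto (fun n : ℕ => a / ((n : ℝ) + 1)) Filter.atTop (nhds 0) :=
  tendsto_const_nhds.div_atTop
    (Filter.tendsto_atTop_add_const_right _ _ tendsto_natCast_atTop_atTop)

lemma tendsto_pt_idx (ha : 0 < a) {x : ℝ} (hx : x ∈ Icc 0 a) :
    Filter.Tendsto (fun n => pt a n (idx a n x)) Filter.atTop (nhds x) := by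
  rw [tendsto_iff_dist_tendsto_zero]
  exact squeeze_zero (fun _ => dist_nonneg) (fun n => abs_pt_idx_sub_le ha n hx) (tendsto_step a)

/-- The midpoint rule with an error controlled by the oscillation over one cell. -/
lemma abs_avg_sub_mean_le (ha : 0 < a) {φ : ℝ → ℝ} (hφ : ContinuousOn φ (Icc 0 a)) {η : ℝ}
    (h : ∀ x ∈ Icc 0 a, ∀ y ∈ Icc 0 a, |x - y| ≤ a / (n + 1) → |φ x - φ y| ≤ η) :
    |avg (fun i => φ (pt a n i)) - mean a φ| ≤ η := by
  have hh := step_pos ha n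
  set k := a / ((n : ℝ) + 1) with hk
  have hn : (0 : ℝ) < n + 1 := by positivity
  have hend : ((n + 1 : ℕ) : ℝ) * k = a := by rw [hk]; push_cast; field_simp
  have hmem : ∀ i : ℕ, i ≤ n + 1 → (i : ℝ) * k ∈ Icc 0 a := by
    intro i hi
    refine ⟨by positivity, ?_⟩
    rw [← hend]
    gcongr
  have hsub : ∀ i : ℕ, i < n + 1 → Icc ((i : ℝ) * k) ((i + 1 : ℕ) * k) ⊆ Icc 0 a := fun i hi =>
    Icc_subset_Icc (hmem i hi.le).1 (hmem (i + 1) hi).2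
  have hle : ∀ i : ℕ, (i : ℝ) * k ≤ (i + 1 : ℕ) * k := fun i => by
    gcongr; omega
  have hint : ∀ i < n + 1, IntervalIntegrable φ volume ((i : ℝ) * k) ((i + 1 : ℕ) * k) := by
    intro i hi
    refine ContinuousOn.intervalIntegrable ?_
    rw [uIcc_of_le (hle i)]
    exact hφ.mono (hsub i hi)
  have hsum := intervalIntegral.sum_integral_adjacent_intervals (a := fun i : ℕ => (i : ℝ) * k) hint
  simp only [hend, Nat.cast_zero, zero_mul] at hsum
  have hcell : ∀ i : Fin (n + 1),
      |φ (pt a n i) * k - ∫ x in ((i : ℕ) : ℝ) * k..((i : ℕ) + 1 : ℕ) * k, φ x| ≤ η * k := by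
    intro i
    have e1 : φ (pt a n i) * k = ∫ _ in ((i : ℕ) : ℝ) * k..((i : ℕ) + 1 : ℕ) * k, φ (pt a n i) := by
      rw [intervalIntegral.integral_const, smul_eq_mul]; push_cast; ring
    rw [e1, ← intervalIntegral.integral_sub intervalIntegrable_const (hint i i.is_lt)]
    have e2 := intervalIntegral.norm_integral_le_of_norm_le_const (C := η)
      (a := ((i : ℕ) : ℝ) * k) (b := ((i : ℕ) + 1 : ℕ) * k) (f := fun x => φ (pt a n i) - φ x) ?_
    · refine e2.trans (le_of_eq ?_)
      congr 1
      rw [abs_of_nonneg (by linarith [hle i])]; push_cast; ring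
    · intro x hx
      rw [uIoc_of_le (hle i)] at hx
      have hx' : x ∈ Icc 0 a := hsub i i.is_lt ⟨hx.1.le, hx.2⟩
      refine h _ (pt_mem ha i) _ hx' ?_
      have h1 := hx.1
      have h2 := hx.2
      push_cast at h2
      unfold pt
      rw [← hk, abs_le]
      constructor <;> nlinarith
  have e3 : avg (fun i => φ (pt a n i)) - mean a φ
      = a⁻¹ * ∑ i : Fin (n + 1),
        (φ (pt a n i) * k - ∫ x in ((i : ℕ) : ℝ) * k..((i : ℕ) + 1 : ℕ) * k, φ x) := by
    rw [Finset.sum_sub_distrib, ← Finset.sum_mul, mul_sub, mean,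
      Fin.sum_univ_eq_sum_range (fun i => ∫ x in (i : ℝ) * k..(i + 1 : ℕ) * k, φ x) (n + 1), hsum]
    congr 1
    rw [avg, hk]; field_simp
  rw [e3, abs_mul, abs_of_pos (inv_pos.2 ha)]
  calc a⁻¹ * |∑ i : Fin (n + 1), (φ (pt a n i) * k
        - ∫ x in ((i : ℕ) : ℝ) * k..((i : ℕ) + 1 : ℕ) * k, φ x)|
      ≤ a⁻¹ * ∑ i : Fin (n + 1), η * k := by
        gcongr
        exact (Finset.abs_sum_le_sum_abs _ _).trans (Finset.sum_le_sum fun i _ => hcell i)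
    _ = η := by
        rw [Finset.sum_const, Finset.card_univ, Fintype.card_fin, nsmul_eq_mul, hk]
        push_cast; field_simp

lemma tendsto_avg_mean (ha : 0 < a) {φ : ℝ → ℝ} (hφ : ContinuousOn φ (Icc 0 a)) :
    Filter.Tendsto (fun n => avg (fun i => φ (pt a n i))) Filter.atTop (nhds (mean a φ)) := by
  rw [Metric.tendsto_atTop']
  intro η hη
  have huc := isCompact_Icc.uniformContinuousOn_of_continuous hφ
  rw [Metric.uniformContinuousOn_iff_le] at huc
  obtain ⟨δ, hδ, hφδ⟩ := huc (η / 2) (by positivity)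
  obtain ⟨N, hN⟩ := Filter.eventually_atTop.1 ((tendsto_step a).eventually (gt_mem_nhds hδ))
  refine ⟨N, fun n hn => ?_⟩
  refine (abs_avg_sub_mean_le ha hφ (η := η / 2) ?_).trans_lt (by linarith)
  intro x hx y hy hxy
  exact hφδ x hx y hy (hxy.trans (hN n hn.le).le)

end

/-! ### Limits of equicontinuous families of grid functions -/

/-- Equicontinuity in time and space of a family of time dependent grid functions. -/
def EquiGrid (a : ℝ) (S : Set ℝ) (f : (n : ℕ) → ℝ → Fin (n + 1) → ℝ) : Prop :=
  ∀ η > 0, ∃ δ > 0, ∀ n, ∀ s ∈ S, ∀ t ∈ S, ∀ i j, |t - s| ≤ δ → |pt a n j - pt a n i| ≤ δ →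
    |f n t j - f n s i| ≤ η

/-- Convergence of grid functions, along a fixed free ultrafilter. -/
def GridLim (a : ℝ) (S : Set ℝ) (f : (n : ℕ) → ℝ → Fin (n + 1) → ℝ) (F : ℝ → ℝ → ℝ) : Prop :=
  ∀ t ∈ S, ∀ x ∈ Icc 0 a, Filter.Tendsto (fun n => f n t (idx a n x))
    (Filter.hyperfilter ℕ : Filter ℕ) (nhds (F t x))

lemma hyperfilter_le_atTop : (Filter.hyperfilter ℕ : Filter ℕ) ≤ Filter.atTop := by
  rw [← Nat.cofinite_eq_atTop]; exact Filter.hyperfilter_le_cofinite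

/-- Compactness along an ultrafilter replaces the extraction of subsequences: all limits, at all
points and for all families, are taken along the same filter. -/
lemma exists_hyperlim {g : ℕ → ℝ} {K : Set ℝ} (hK : IsCompact K) (hg : ∀ n, g n ∈ K) :
    ∃ L ∈ K, Filter.Tendsto g (Filter.hyperfilter ℕ : Filter ℕ) (nhds L) := by
  have := hK.ultrafilter_le_nhds ((Filter.hyperfilter ℕ).map g)
    (by
      rw [Ultrafilter.coe_map, Filter.le_principal_iff, Filter.mem_map]
      exact Filter.univ_mem' hg)
  simpa [Filter.Tendsto] using this

section

variable {a : ℝ} {S : Set ℝ} {f g : (n : ℕ) → ℝ → Fin (n + 1) → ℝ}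

lemma exists_gridLim {C : ℝ} (hf : ∀ n, ∀ t ∈ S, ∀ i, |f n t i| ≤ C) : ∃ F, GridLim a S f F := by
  have : ∀ t x, ∃ L, t ∈ S → Filter.Tendsto (fun n => f n t (idx a n x))
      (Filter.hyperfilter ℕ : Filter ℕ) (nhds L) := by
    intro t x
    by_cases ht : t ∈ S
    · obtain ⟨L, -, hL⟩ := exists_hyperlim (isCompact_Icc (a := -C) (b := C))
        (g := fun n => f n t (idx a n x)) (fun n => abs_le.1 (hf n t ht _))
      exact ⟨L, fun _ => hL⟩
    · exact ⟨0, fun h => absurd h ht⟩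
  choose F hF using this
  exact ⟨F, fun t ht x _ => hF t x ht⟩

lemma tendsto_pt_sub (ha : 0 < a) {x y : ℝ} (hx : x ∈ Icc 0 a) (hy : y ∈ Icc 0 a) :
    Filter.Tendsto (fun n => pt a n (idx a n y) - pt a n (idx a n x))
      (Filter.hyperfilter ℕ : Filter ℕ) (nhds (y - x)) :=
  ((tendsto_pt_idx ha hy).sub (tendsto_pt_idx ha hx)).mono_left hyperfilter_le_atTop

lemma eventually_abs_pt_sub_le (ha : 0 < a) {x y δ : ℝ} (hx : x ∈ Icc 0 a) (hy : y ∈ Icc 0 a)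
    (h : |y - x| < δ) : ∀ᶠ n in (Filter.hyperfilter ℕ : Filter ℕ),
      |pt a n (idx a n y) - pt a n (idx a n x)| ≤ δ :=
  ((tendsto_pt_sub ha hx hy).abs.eventually (gt_mem_nhds h)).mono fun _ h => h.le

lemma EquiGrid.continuousOn (ha : 0 < a) (hf : EquiGrid a S f) {F : ℝ → ℝ → ℝ}
    (hF : GridLim a S f F) : ContinuousOn (fun z : ℝ × ℝ => F z.1 z.2) (S ×ˢ Icc 0 a) := by
  rintro ⟨s, x⟩ ⟨hs, hx⟩
  rw [Metric.continuousWithinAt_iff]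
  intro η hη
  obtain ⟨δ, hδ, h⟩ := hf (η / 2) (by positivity)
  refine ⟨δ, hδ, ?_⟩
  rintro ⟨t, y⟩ ⟨ht, hy⟩ hd
  rw [Prod.dist_eq, max_lt_iff] at hd
  refine lt_of_le_of_lt ?_ (by linarith : η / 2 < η)
  refine le_of_tendsto ((hF t ht y hy).sub (hF s hs x hx)).abs ?_
  filter_upwards [eventually_abs_pt_sub_le ha hx hy hd.2] with n hn
  exact h n s hs t ht _ _ hd.1.le hn

lemma EquiGrid.add (hf : EquiGrid a S f) (hg : EquiGrid a S g) :
    EquiGrid a S (fun n t i => f n t i + g n t i) := by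
  intro η hη
  obtain ⟨δ₁, hδ₁, h₁⟩ := hf (η / 2) (by positivity)
  obtain ⟨δ₂, hδ₂, h₂⟩ := hg (η / 2) (by positivity)
  refine ⟨min δ₁ δ₂, lt_min hδ₁ hδ₂, fun n s hs t ht i j hts hij => ?_⟩
  have e1 := h₁ n s hs t ht i j (hts.trans (min_le_left _ _)) (hij.trans (min_le_left _ _))
  have e2 := h₂ n s hs t ht i j (hts.trans (min_le_right _ _)) (hij.trans (min_le_right _ _))
  rw [abs_le] at *
  constructor <;> linarith

lemma EquiGrid.neg (hf : EquiGrid a S f) : EquiGrid a S (fun n t i => - f n t i) := by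
  intro η hη
  obtain ⟨δ₁, hδ₁, h₁⟩ := hf η hη
  refine ⟨δ₁, hδ₁, fun n s hs t ht i j hts hij => ?_⟩
  have e1 := h₁ n s hs t ht i j hts hij
  rw [abs_le] at *
  constructor <;> linarith

lemma EquiGrid.mul (hf : EquiGrid a S f) (hg : EquiGrid a S g) {C : ℝ} (hC : 0 < C)
    (hfC : ∀ n, ∀ t ∈ S, ∀ i, |f n t i| ≤ C) (hgC : ∀ n, ∀ t ∈ S, ∀ i, |g n t i| ≤ C) :
    EquiGrid a S (fun n t i => f n t i * g n t i) := by
  intro η hη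
  obtain ⟨δ₁, hδ₁, h₁⟩ := hf (η / (2 * C)) (by positivity)
  obtain ⟨δ₂, hδ₂, h₂⟩ := hg (η / (2 * C)) (by positivity)
  refine ⟨min δ₁ δ₂, lt_min hδ₁ hδ₂, fun n s hs t ht i j hts hij => ?_⟩
  have e1 := h₁ n s hs t ht i j (hts.trans (min_le_left _ _)) (hij.trans (min_le_left _ _))
  have e2 := h₂ n s hs t ht i j (hts.trans (min_le_right _ _)) (hij.trans (min_le_right _ _))
  have e3 : f n t j * g n t j - f n s i * g n s i
      = (f n t j - f n s i) * g n t j + f n s i * (g n t j - g n s i) := by ring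
  rw [e3]
  refine (abs_add_le _ _).trans ?_
  rw [abs_mul, abs_mul]
  calc _ ≤ η / (2 * C) * C + C * (η / (2 * C)) := by
        gcongr
        · exact hgC n t ht j
        · exact hfC n s hs i
    _ = η := by field_simp; norm_num

lemma EquiGrid.comp (hf : EquiGrid a S f) {K : Set ℝ} (hK : IsCompact K) {φ : ℝ → ℝ}
    (hφ : ContinuousOn φ K) (hfK : ∀ n, ∀ t ∈ S, ∀ i, f n t i ∈ K) :
    EquiGrid a S (fun n t i => φ (f n t i)) := by
  intro η hη
  have huc := hK.uniformContinuousOn_of_continuous hφ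
  rw [Metric.uniformContinuousOn_iff_le] at huc
  obtain ⟨δ', hδ', h'⟩ := huc η hη
  obtain ⟨δ₁, hδ₁, h₁⟩ := hf δ' hδ'
  exact ⟨δ₁, hδ₁, fun n s hs t ht i j hts hij =>
    h' _ (hfK n t ht j) _ (hfK n s hs i) (h₁ n s hs t ht i j hts hij)⟩

lemma EquiGrid.avg (hf : EquiGrid a S f) : EquiGrid a S (fun n t _ => avg (f n t)) := by
  intro η hη
  obtain ⟨δ₁, hδ₁, h₁⟩ := hf η hη
  refine ⟨δ₁, hδ₁, fun n s hs t ht i j hts _ => ?_⟩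
  rw [← avg_sub]
  exact abs_avg_le fun k => h₁ n s hs t ht k k hts (by simpa using hδ₁.le)

/-- Limits of difference quotients in space. -/
lemma GridLim.hasDerivWithinAt_space (ha : 0 < a) {F G : ℝ → ℝ → ℝ} (hF : GridLim a S f F)
    (hG : GridLim a S g G) (hg : EquiGrid a S g)
    (hfg : ∀ n, ∀ t ∈ S, ∀ i : Fin (n + 1), (i : ℕ) < n →
      |f n t (up i) - f n t i - a / (n + 1) * g n t i| ≤
        a / (n + 1) * |g n t (up i) - g n t i|) {t : ℝ} (ht : t ∈ S) {x : ℝ} (hx : x ∈ Icc 0 a) :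
    HasDerivWithinAt (F t) (G t x) (Icc 0 a) x := by
  rw [hasDerivWithinAt_iff_isLittleO, Asymptotics.isLittleO_iff]
  intro η hη
  obtain ⟨δ, hδ, hequi⟩ := hg (η / 2) (by positivity)
  have hnhds : ∀ᶠ y in nhdsWithin x (Icc 0 a), |y - x| < δ := by
    have : Metric.ball x δ ∈ nhdsWithin x (Icc 0 a) :=
      nhdsWithin_le_nhds (Metric.ball_mem_nhds x hδ)
    filter_upwards [this] with y hy using hy
  filter_upwards [hnhds, self_mem_nhdsWithin] with y hyx hy
  have hstep : ∀ᶠ n : ℕ in (Filter.hyperfilter ℕ : Filter ℕ), a / ((n : ℝ) + 1) ≤ δ :=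
    (((tendsto_step a).mono_left hyperfilter_le_atTop).eventually (gt_mem_nhds hδ)).mono
      fun _ h => h.le
  have hlim := ((hF t ht y hy).sub (hF t ht x hx)).sub
    ((tendsto_pt_sub ha hx hy).mul (hG t ht x hx))
  refine le_of_tendsto_of_tendsto hlim.norm ((tendsto_pt_sub ha hx hy).norm.const_mul η) ?_
  filter_upwards [hstep, eventually_abs_pt_sub_le ha hx hy hyx] with n hn hpt
  have hh := step_pos ha n
  set h := a / ((n : ℝ) + 1) with hdef
  set i := idx a n x
  set j := idx a n y
  -- Discrete mean value argument: after subtracting the linear function of slope `g n t i`, each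
  -- increment near `i` is at most `h * η`. One half comes from `hfg` and the equicontinuity across
  -- a cell, the other from the variation of `g` between `i` and `k`. The error allowed in `hfg`
  -- accommodates a difference quotient that is given by the neighbouring value of `g`.
  have hmid : ∀ k : Fin (n + 1), |pt a n k - pt a n i| ≤ δ → (k : ℕ) < n →
      |(fun l : Fin (n + 1) => f n t l - (l : ℝ) * h * g n t i) (up k) -
        (fun l : Fin (n + 1) => f n t l - (l : ℝ) * h * g n t i) k| ≤ h * η := by
    intro k hk hkn
    have e1 := hfg n t ht k hkn
    have e2 := hequi n t ht t ht k (up k) (by simpa using hδ.le)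
      ((abs_pt_up_sub_le ha k).trans hn)
    have e3 := hequi n t ht t ht i k (by simpa using hδ.le) hk
    have e4 : f n t (up k) - ((up k : Fin (n + 1)) : ℝ) * h * g n t i -
        (f n t k - (k : ℝ) * h * g n t i)
        = (f n t (up k) - f n t k - h * g n t k) + h * (g n t k - g n t i) := by
      rw [val_up hkn]; push_cast; ring
    simp only [e4]
    refine (abs_add_le _ _).trans ?_
    rw [abs_mul, abs_of_pos hh]
    have e5 : h * |g n t (up k) - g n t k| ≤ h * (η / 2) := by gcongr
    have e6 : h * |g n t k - g n t i| ≤ h * (η / 2) := by gcongr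
    linarith
  have hconv : f n t j - f n t i - (pt a n j - pt a n i) * g n t i =
      (f n t j - (j : ℝ) * h * g n t i) - (f n t i - (i : ℝ) * h * g n t i) := by
    rw [pt_sub]; ring
  rw [Real.norm_eq_abs, Real.norm_eq_abs, hconv, abs_pt_sub ha, ← hdef]
  rw [abs_pt_sub ha, ← hdef] at hpt
  have hnear : ∀ k : Fin (n + 1), |(k : ℝ) - i| ≤ |(j : ℝ) - i| → |pt a n k - pt a n i| ≤ δ := by
    intro k hk
    rw [abs_pt_sub ha, ← hdef]
    exact (mul_le_mul_of_nonneg_left hk hh.le).trans hpt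
  rcases le_total i j with hij | hij
  · have hij' : (i : ℝ) ≤ j := by exact_mod_cast hij
    refine (abs_sub_le_of_step (fun l : Fin (n + 1) => f n t l - (l : ℝ) * h * g n t i) hij
      (c := h * η) ?_).trans (le_of_eq ?_)
    · intro k hik hkj
      have h1 : (i : ℝ) ≤ k := by exact_mod_cast hik
      have h2 : (k : ℝ) ≤ j := by exact_mod_cast hkj.le
      refine hmid k (hnear k ?_) (by have := j.is_lt; have : (k : ℕ) < j := hkj; omega)
      rw [abs_of_nonneg (by linarith), abs_of_nonneg (by linarith)]
      linarith
    · rw [abs_of_nonneg (by linarith)]; ring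
  · have hij' : (j : ℝ) ≤ i := by exact_mod_cast hij
    rw [abs_sub_comm]
    refine (abs_sub_le_of_step (fun l : Fin (n + 1) => f n t l - (l : ℝ) * h * g n t i) hij
      (c := h * η) ?_).trans (le_of_eq ?_)
    · intro k hik hkj
      have h1 : (j : ℝ) ≤ k := by exact_mod_cast hik
      have h2 : (k : ℝ) ≤ i := by exact_mod_cast hkj.le
      refine hmid k (hnear k ?_) (by have := i.is_lt; have : (k : ℕ) < i := hkj; omega)
      rw [abs_of_nonpos (by linarith), abs_of_nonpos (by linarith)]
      linarith
    · rw [abs_of_nonpos (by linarith)]; ring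

/-- Limits of time derivatives. -/
lemma GridLim.hasDerivWithinAt_time {F G : ℝ → ℝ → ℝ} (hS : Convex ℝ S)
    (hF : GridLim a S f F) (hG : GridLim a S g G) (hg : EquiGrid a S g)
    (hfg : ∀ n, ∀ t ∈ S, ∀ i, HasDerivWithinAt (fun r => f n r i) (g n t i) S t)
    {s : ℝ} (hs : s ∈ S) {x : ℝ} (hx : x ∈ Icc 0 a) :
    HasDerivWithinAt (fun r => F r x) (G s x) S s := by
  rw [hasDerivWithinAt_iff_isLittleO, Asymptotics.isLittleO_iff]
  intro η hη
  obtain ⟨δ, hδ, hequi⟩ := hg η hη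
  have hnhds : ∀ᶠ y in nhdsWithin s S, y ∈ Metric.closedBall s δ :=
    nhdsWithin_le_nhds (Metric.closedBall_mem_nhds s hδ)
  filter_upwards [hnhds, self_mem_nhdsWithin] with t htδ ht
  have hlim := ((hF t ht x hx).sub (hF s hs x hx)).sub ((hG s hs x hx).const_mul (t - s))
  refine le_of_tendsto hlim.norm (Filter.Eventually.of_forall fun n => ?_)
  set i := idx a n x
  have hconv : Convex ℝ (S ∩ Metric.closedBall s δ) := hS.inter (convex_closedBall s δ)
  have := hconv.norm_image_sub_le_of_norm_hasDerivWithin_le (C := η)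
    (f := fun r => f n r i - r * g n s i) (f' := fun r => g n r i - 1 * g n s i)
    (x := s) (y := t) ?_ ?_ ⟨hs, Metric.mem_closedBall_self hδ.le⟩ ⟨ht, htδ⟩
  · refine le_trans (le_of_eq ?_) this
    congr 1; ring
  · intro r hr
    exact ((hfg n r hr.1 i).sub ((hasDerivAt_id r).mul_const _).hasDerivWithinAt).mono
      inter_subset_left
  · intro r hr
    rw [one_mul]
    exact hequi n s hs r hr.1 i i hr.2 (by simpa using hδ.le)

/-- The averages of an equicontinuous family converge to the average of the limit. -/
lemma GridLim.tendsto_avg (ha : 0 < a) {F : ℝ → ℝ → ℝ} (hF : GridLim a S f F)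
    (hf : EquiGrid a S f) {t : ℝ} (ht : t ∈ S) :
    Filter.Tendsto (fun n => NonlocalFlow.avg (f n t)) (Filter.hyperfilter ℕ : Filter ℕ)
      (nhds (mean a (F t))) := by
  have hcont : ContinuousOn (F t) (Icc 0 a) :=
    (hf.continuousOn ha hF).comp (f := fun x => (t, x)) (by fun_prop) (fun x hx => ⟨ht, hx⟩)
  have h1 := (tendsto_avg_mean ha hcont).mono_left hyperfilter_le_atTop
  have h2 : Filter.Tendsto (fun n => NonlocalFlow.avg (f n t)
      - NonlocalFlow.avg (fun i => F t (pt a n i)))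
      (Filter.hyperfilter ℕ : Filter ℕ) (nhds 0) := by
    rw [Metric.tendsto_nhds]
    intro η hη
    -- Convergence is uniform over the grid. Otherwise, by the ultrafilter property, bad indices
    -- exist for eventually all `n`; their points converge to some `y`, and equicontinuity
    -- contradicts the convergence at `y`.
    have key : ∀ᶠ n in (Filter.hyperfilter ℕ : Filter ℕ),
        ∀ i : Fin (n + 1), |f n t i - F t (pt a n i)| ≤ η / 2 := by
      by_contra hcon
      rw [← Ultrafilter.eventually_not] at hcon
      simp only [not_forall, not_le] at hcon
      have hex : ∀ n, ∃ i : Fin (n + 1), (∃ i : Fin (n + 1), η / 2 < |f n t i - F t (pt a n i)|) →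
          η / 2 < |f n t i - F t (pt a n i)| := by
        intro n
        by_cases h : ∃ i : Fin (n + 1), η / 2 < |f n t i - F t (pt a n i)|
        · exact ⟨h.choose, fun _ => h.choose_spec⟩
        · exact ⟨0, fun h' => absurd h' h⟩
      choose i hi using hex
      obtain ⟨y, hy, hlim⟩ := exists_hyperlim isCompact_Icc (g := fun n => pt a n (i n))
        (fun n => pt_mem ha (i n))
      obtain ⟨δ, hδ, hequi⟩ := hf (η / 8) (by positivity)
      have e1 : Filter.Tendsto (fun n => F t (pt a n (i n))) (Filter.hyperfilter ℕ : Filter ℕ)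
          (nhds (F t y)) :=
        (hcont y hy).tendsto.comp (tendsto_nhdsWithin_iff.2
          ⟨hlim, Filter.Eventually.of_forall fun n => pt_mem ha (i n)⟩)
      have e2 : Filter.Tendsto (fun n => pt a n (i n) - pt a n (idx a n y))
          (Filter.hyperfilter ℕ : Filter ℕ) (nhds 0) := by
        have := hlim.sub ((tendsto_pt_idx ha hy).mono_left hyperfilter_le_atTop)
        rwa [sub_self] at this
      have e3 := Metric.tendsto_nhds.1 e1 (η / 8) (by positivity)
      have e4 := Metric.tendsto_nhds.1 (hF t ht y hy) (η / 8) (by positivity)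
      have e5 := Metric.tendsto_nhds.1 e2 δ hδ
      obtain ⟨n, h1, h2, h3, h4⟩ := (hcon.and (e3.and (e4.and e5))).exists
      have h5 := hi n h1
      rw [Real.dist_eq] at h2 h3 h4
      rw [sub_zero] at h4
      have h6 := hequi n t ht t ht (idx a n y) (i n) (by simpa using hδ.le) h4.le
      rw [abs_lt] at h2 h3
      rw [abs_le] at h6
      rw [lt_abs] at h5
      rcases h5 with h5 | h5 <;> linarith
    filter_upwards [key] with n hn
    rw [Real.dist_eq, sub_zero, ← avg_sub]
    exact (abs_avg_le hn).trans_lt (by linarith)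
  simpa using h2.add h1

end

end NonlocalFlow

namespace NonlocalFlow

/-! ### The limit of the semi-discrete flows -/

section

variable {n : ℕ} {p a m M τ : ℝ}

lemma dif_up_sub_dif {h : ℝ} (hh : h ≠ 0) (f : Fin (n + 1) → ℝ) {i : Fin (n + 1)}
    (hi : (i : ℕ) < n) : dif h f (up i) - dif h f i = h * lap h f (up i) := by
  simp only [dif, lap, dn_up hi]; field_simp; ring

lemma dif_last (h : ℝ) (f : Fin (n + 1) → ℝ) : dif h f (Fin.last n) = 0 := by
  simp [dif, up_last]

lemma dif_zero_eq (h : ℝ) (f : Fin (n + 1) → ℝ) (hh : h ≠ 0) : dif h f 0 = h * lap h f 0 := by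
  simp only [dif, lap, dn_zero]; field_simp; ring

/-- The difference quotient vanishes at the last index, the discrete Neumann condition; summing the
second differences from there costs at most the length `a`. -/
lemma abs_dif_le (ha : 0 < a) (f : Fin (n + 1) → ℝ) {G : ℝ} (hG0 : 0 ≤ G)
    (hG : ∀ i, |lap (a / (n + 1)) f i| ≤ G) (i : Fin (n + 1)) :
    |dif (a / (n + 1)) f i| ≤ a * G := by
  have hh := step_pos ha n
  have h1 := abs_sub_le_of_step (dif (a / (n + 1)) f) (Fin.le_last i) (c := a / (n + 1) * G) ?_
  · rw [dif_last, zero_sub, abs_neg] at h1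
    refine h1.trans ?_
    have h2 : ((Fin.last n : Fin (n + 1)) : ℝ) - i ≤ n + 1 := by
      have : (0 : ℝ) ≤ (i : ℝ) := by positivity
      simp only [Fin.val_last]; linarith
    calc _ ≤ ((n : ℝ) + 1) * (a / (n + 1) * G) := by gcongr
      _ = a * G := by field_simp
  · intro k _ hk
    have hk' : (k : ℕ) < n := hk
    rw [dif_up_sub_dif hh.ne' f hk', abs_mul, abs_of_pos hh]
    gcongr
    exact hG _

lemma abs_sub_le_of_dif_le (ha : 0 < a) (f : Fin (n + 1) → ℝ) {G : ℝ}
    (hG : ∀ i, |dif (a / (n + 1)) f i| ≤ G) (i j : Fin (n + 1)) :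
    |f j - f i| ≤ G * |pt a n j - pt a n i| := by
  have hh := step_pos ha n
  have key : ∀ i j : Fin (n + 1), i ≤ j → |f j - f i| ≤ G * |pt a n j - pt a n i| := by
    intro i j hij
    have hij' : (i : ℝ) ≤ j := by exact_mod_cast hij
    refine (abs_sub_le_of_step f hij (c := a / (n + 1) * G) ?_).trans (le_of_eq ?_)
    · intro k _ _
      have e : f (up k) - f k = a / (n + 1) * dif (a / (n + 1)) f k := by
        simp only [dif]; field_simp
      rw [e, abs_mul, abs_of_pos hh]
      gcongr
      exact hG _
    · rw [abs_pt_sub ha, abs_of_nonneg (by linarith)]; ring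
  rcases le_total i j with h | h
  · exact key i j h
  · rw [abs_sub_comm, abs_sub_comm (pt a n j)]; exact key j i h

/-- The equation solved for the second difference: as `f` stays away from zero, bounds and
equicontinuity pass from the velocity to the Laplacian. -/
lemma lap_eq_of_vel {h : ℝ} {f : Fin (n + 1) → ℝ} {i : Fin (n + 1)} (hpos : 0 < f i) :
    lap h f i = vel p h f i * f i ^ (-p) + -f i + avg f := by
  have : f i ^ p * f i ^ (-p) = 1 := by rw [← Real.rpow_add hpos]; simp
  have h2 : vel p h f i * f i ^ (-p) = (f i ^ p * f i ^ (-p)) * opA h f i := by unfold vel; ring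
  rw [h2, this]; unfold opA; ring

end

lemma exists_pos_sqrt_lt (C : ℝ) {η : ℝ} (hη : 0 < η) :
    ∃ δ > 0, C * √δ + C * √√δ < η := by
  have hc : Filter.Tendsto (fun δ : ℝ => C * √δ + C * √√δ) (nhdsWithin 0 (Ioi 0)) (nhds 0) := by
    have : Continuous (fun δ : ℝ => C * √δ + C * √√δ) := by fun_prop
    have := this.tendsto 0
    simp only [Real.sqrt_zero, mul_zero, add_zero] at this
    exact this.mono_left nhdsWithin_le_nhds
  obtain ⟨δ, h1, h2⟩ := ((hc.eventually (gt_mem_nhds hη)).and self_mem_nhdsWithin).exists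
  exact ⟨δ, h2, h1⟩

/-- Semi-discrete flows with uniform Hölder bounds of the velocity converge, along an
ultrafilter, to a classical solution of the nonlocal equation. -/
theorem exists_limit_flow {p a m M τ ε C : ℝ} (ha : 0 < a) (hm : 0 < m)
    (hmM : m ≤ M) (hε : 0 < ε) (hC : 0 ≤ C)
    {u : (n : ℕ) → ℝ → Fin (n + 1) → ℝ} (hu : ∀ n, GridFlow p a m M τ n (u n))
    (hw : ∀ n : ℕ, ∀ s ∈ Icc ε τ, ∀ t ∈ Icc ε τ, ∀ i j,
        |vel p (a / (n + 1)) (u n t) i| ≤ C ∧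
        |vel p (a / (n + 1)) (u n t) j - vel p (a / (n + 1)) (u n t) i| ≤
          C * √(a / (n + 1) * |(j : ℝ) - i|) ∧
        |vel p (a / (n + 1)) (u n t) i - vel p (a / (n + 1)) (u n s) i| ≤ C * √√|t - s|) :
    ∃ v vt vx vxx : ℝ → ℝ → ℝ, GridLim a (Icc ε τ) u v ∧
      ContinuousOn (fun z : ℝ × ℝ => v z.1 z.2) (Icc ε τ ×ˢ Icc 0 a) ∧
      ContinuousOn (fun z : ℝ × ℝ => vt z.1 z.2) (Icc ε τ ×ˢ Icc 0 a) ∧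
      ContinuousOn (fun z : ℝ × ℝ => vx z.1 z.2) (Icc ε τ ×ˢ Icc 0 a) ∧
      ContinuousOn (fun z : ℝ × ℝ => vxx z.1 z.2) (Icc ε τ ×ˢ Icc 0 a) ∧
      (∀ t ∈ Icc ε τ, ∀ x ∈ Icc 0 a, m ≤ v t x ∧
        HasDerivWithinAt (fun s => v s x) (vt t x) (Icc ε τ) t ∧
        HasDerivWithinAt (v t) (vx t x) (Icc 0 a) x ∧
        HasDerivWithinAt (vx t) (vxx t x) (Icc 0 a) x ∧
        vt t x = v t x ^ p * (vxx t x + v t x - mean a (v t))) ∧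
      ∀ t ∈ Icc ε τ, vx t 0 = 0 ∧ vx t a = 0 := by
  set S := Icc ε τ with hS
  have hS0 : S ⊆ Icc 0 τ := Icc_subset_Icc hε.le le_rfl
  have hM : 0 < M := hm.trans_le hmM
  have hl : ∀ n, ∀ t ∈ S, ∀ i, m ≤ u n t i := fun n t ht i => (hu n).lower t (hS0 ht) i
  have hr : ∀ n, ∀ t ∈ S, ∀ i, u n t i ≤ M := fun n t ht i => (hu n).upper t (hS0 ht) i
  have huabs : ∀ n, ∀ t ∈ S, ∀ i, |u n t i| ≤ M := fun n t ht i =>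
    abs_le.2 ⟨by linarith [hl n t ht i], hr n t ht i⟩
  set w : (n : ℕ) → ℝ → Fin (n + 1) → ℝ := fun n t => vel p (a / (n + 1)) (u n t) with hwdef
  set g : (n : ℕ) → ℝ → Fin (n + 1) → ℝ := fun n t => lap (a / (n + 1)) (u n t) with hgdef
  set d : (n : ℕ) → ℝ → Fin (n + 1) → ℝ := fun n t => dif (a / (n + 1)) (u n t) with hddef
  have hwC : ∀ n, ∀ t ∈ S, ∀ i, |w n t i| ≤ C := fun n t ht i => (hw n t ht t ht i i).1
  have hgeq : ∀ n, ∀ t ∈ S, ∀ i, g n t i = w n t i * u n t i ^ (-p) + -u n t i + avg (u n t) :=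
    fun n t ht i => lap_eq_of_vel (hm.trans_le (hl n t ht i))
  have hφ : ContinuousOn (fun s : ℝ => s ^ (-p)) (Icc m M) := fun s hs =>
    (Real.continuousAt_rpow_const _ _ (Or.inl (hm.trans_le hs.1).ne')).continuousWithinAt
  obtain ⟨R, hR⟩ := isCompact_Icc.exists_bound_of_continuousOn hφ
  have hR' : ∀ n, ∀ t ∈ S, ∀ i, |u n t i ^ (-p)| ≤ R := fun n t ht i =>
    hR _ ⟨hl n t ht i, hr n t ht i⟩
  have hR0 : 0 ≤ R := (norm_nonneg _).trans (hR m ⟨le_rfl, hmM⟩)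
  set G := C * R + M + M with hG
  have hG0 : 0 ≤ G := by positivity
  have hgG : ∀ n, ∀ t ∈ S, ∀ i, |g n t i| ≤ G := by
    intro n t ht i
    rw [hgeq n t ht i]
    refine (abs_add_le _ _).trans (add_le_add ((abs_add_le _ _).trans (add_le_add ?_ ?_)) ?_)
    · rw [abs_mul]
      exact mul_le_mul (hwC n t ht i) (hR' n t ht i) (abs_nonneg _) hC
    · rw [abs_neg]; exact huabs n t ht i
    · exact abs_avg_le (huabs n t ht)
  have hdG : ∀ n, ∀ t ∈ S, ∀ i, |d n t i| ≤ a * G := fun n t ht i =>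
    abs_dif_le ha _ hG0 (hgG n t ht) i
  have hwE : EquiGrid a S w := by
    intro η hη
    obtain ⟨δ, hδ, hlt⟩ := exists_pos_sqrt_lt C hη
    refine ⟨δ, hδ, fun n s hs t ht i j hts hij => ?_⟩
    obtain ⟨-, h1, -⟩ := hw n t ht t ht i j
    obtain ⟨-, -, h2⟩ := hw n s hs t ht i i
    rw [← abs_pt_sub ha] at h1
    have h3 : C * √|pt a n j - pt a n i| ≤ C * √δ := by gcongr
    have h4 : C * √√|t - s| ≤ C * √√δ := by gcongr
    have h5 := abs_sub_le (w n t j) (w n t i) (w n s i)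
    simp only [hwdef] at h5 ⊢
    linarith
  have hutime : ∀ n, ∀ s ∈ S, ∀ t ∈ S, ∀ i, |u n t i - u n s i| ≤ C * |t - s| := by
    intro n s hs t ht i
    exact (convex_Icc ε τ).norm_image_sub_le_of_norm_hasDerivWithin_le
      (f := fun r => u n r i) (f' := fun r => w n r i)
      (fun r hr => ((hu n).hasDeriv r (hS0 hr) i).mono hS0) (fun r hr => hwC n r hr i) hs ht
  have huE : EquiGrid a S u := by
    intro η hη
    refine ⟨η / (a * G + C + 1), by positivity, fun n s hs t ht i j hts hij => ?_⟩
    have h1 := abs_sub_le_of_dif_le ha (u n t) (hdG n t ht) i j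
    have h2 := hutime n s hs t ht i
    have h5 := abs_sub_le (u n t j) (u n t i) (u n s i)
    have h3 : a * G * |pt a n j - pt a n i| ≤ a * G * (η / (a * G + C + 1)) := by gcongr
    have h4 : C * |t - s| ≤ C * (η / (a * G + C + 1)) := by gcongr
    have h6 : (a * G + C) * (η / (a * G + C + 1)) ≤ η := by
      rw [← mul_div_assoc, div_le_iff₀ (by positivity)]
      nlinarith
    linarith
  have hgE : EquiGrid a S g := by
    have h1 := ((hwE.mul (huE.comp isCompact_Icc hφ fun n t ht i =>
      ⟨hl n t ht i, hr n t ht i⟩) (C := C + R + 1) (by positivity)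
      (fun n t ht i => (hwC n t ht i).trans (by linarith))
      (fun n t ht i => (hR' n t ht i).trans (by linarith))).add huE.neg).add huE.avg
    intro η hη
    obtain ⟨δ, hδ, h⟩ := h1 η hη
    refine ⟨δ, hδ, fun n s hs t ht i j hts hij => ?_⟩
    rw [hgeq n t ht, hgeq n s hs]
    exact h n s hs t ht i j hts hij
  have hdE : EquiGrid a S d := by
    intro η hη
    obtain ⟨δ, hδ, h⟩ := hgE (η / (2 * a)) (by positivity)
    refine ⟨min δ (η / (2 * (G + 1))), by positivity, fun n s hs t ht i j hts hij => ?_⟩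
    have h1 : |d n t j - d n t i| ≤ η / 2 := by
      have hG1 : 0 < G + 1 := by positivity
      have hh := step_pos ha n
      have e1 : ∀ i j : Fin (n + 1), i ≤ j → |d n t j - d n t i| ≤ G * |pt a n j - pt a n i| := by
        intro i j hij
        have hij' : (i : ℝ) ≤ j := by exact_mod_cast hij
        refine (abs_sub_le_of_step (d n t) hij (c := a / (n + 1) * G) ?_).trans (le_of_eq ?_)
        · intro k _ hk
          have hk' : (k : ℕ) < n := by have := j.is_lt; have : (k : ℕ) < j := hk; omega
          rw [hddef]
          simp only
          rw [dif_up_sub_dif hh.ne' _ hk', abs_mul, abs_of_pos hh]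
          gcongr
          exact hgG n t ht _
        · rw [abs_pt_sub ha, abs_of_nonneg (by linarith)]; ring
      have e2 : |d n t j - d n t i| ≤ G * |pt a n j - pt a n i| := by
        rcases le_total i j with h | h
        · exact e1 i j h
        · rw [abs_sub_comm, abs_sub_comm (pt a n j)]; exact e1 j i h
      refine e2.trans ?_
      calc G * |pt a n j - pt a n i| ≤ G * (η / (2 * (G + 1))) := by
            gcongr; exact hij.trans (min_le_right _ _)
        _ ≤ (G + 1) * (η / (2 * (G + 1))) := by gcongr; linarith
        _ = η / 2 := by field_simp
    -- Continuity in time of the first differences: `abs_dif_le` applied to `u n t - u n s`, whose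
    -- Laplacian is small by the equicontinuity of `g`.
    have h2 : |d n t i - d n s i| ≤ η / 2 := by
      have e1 : d n t i - d n s i = dif (a / (n + 1)) (fun k => u n t k - u n s k) i := by
        rw [dif_sub]
      rw [e1]
      refine (abs_dif_le ha _ (G := η / (2 * a)) (by positivity) (fun k => ?_) i).trans
        (le_of_eq (by field_simp))
      rw [lap_sub]
      exact h n s hs t ht k k (hts.trans (min_le_left _ _)) (by simpa using hδ.le)
    have h5 := abs_sub_le (d n t j) (d n t i) (d n s i)
    linarith
  obtain ⟨v, hv⟩ := exists_gridLim (a := a) huabs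
  obtain ⟨vt, hvt⟩ := exists_gridLim (a := a) hwC
  obtain ⟨vx, hvx⟩ := exists_gridLim (a := a) hdG
  obtain ⟨vxx, hvxx⟩ := exists_gridLim (a := a) hgG
  have hvm : ∀ t ∈ S, ∀ x ∈ Icc 0 a, m ≤ v t x := fun t ht x hx =>
    ge_of_tendsto (hv t ht x hx) (Filter.Eventually.of_forall fun n => hl n t ht _)
  have hstep0 : Filter.Tendsto (fun n : ℕ => a / ((n : ℝ) + 1) * G)
      (Filter.hyperfilter ℕ : Filter ℕ) (nhds 0) := by
    simpa using ((tendsto_step a).mono_left hyperfilter_le_atTop).mul_const G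
  refine ⟨v, vt, vx, vxx, hv, huE.continuousOn ha hv, hwE.continuousOn ha hvt,
    hdE.continuousOn ha hvx, hgE.continuousOn ha hvxx, ?_, ?_⟩
  · intro t ht x hx
    refine ⟨hvm t ht x hx, ?_, ?_, ?_, ?_⟩
    · exact hv.hasDerivWithinAt_time (convex_Icc ε τ) hvt hwE
        (fun n t ht i => ((hu n).hasDeriv t (hS0 ht) i).mono hS0) ht hx
    · refine hv.hasDerivWithinAt_space ha hvx hdE ?_ ht hx
      intro n t ht i _
      have hh := step_pos ha n
      have : u n t (up i) - u n t i - a / (n + 1) * d n t i = 0 := by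
        simp only [hddef, dif]; field_simp; ring
      rw [this, abs_zero]; positivity
    · refine hvx.hasDerivWithinAt_space ha hvxx hgE ?_ ht hx
      intro n t ht i hi
      have hh := step_pos ha n
      have : d n t (up i) - d n t i - a / (n + 1) * g n t i =
          a / (n + 1) * (g n t (up i) - g n t i) := by
        simp only [hddef, hgdef]
        rw [dif_up_sub_dif hh.ne' _ hi]; ring
      rw [this, abs_mul, abs_of_pos hh]
    · have h1 : Filter.Tendsto (fun n => w n t (idx a n x)) (Filter.hyperfilter ℕ : Filter ℕ)
          (nhds (v t x ^ p * (vxx t x + v t x - mean a (v t)))) :=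
        ((hv t ht x hx).rpow_const (Or.inl (hm.trans_le (hvm t ht x hx)).ne')).mul
          (((hvxx t ht x hx).add (hv t ht x hx)).sub (hv.tendsto_avg ha huE ht))
      exact tendsto_nhds_unique (hvt t ht x hx) h1
  · intro t ht
    constructor
    -- At the left end the forward quotient is not zero but `h * lap`, hence of order `h`; at the
    -- right end it vanishes identically.
    · refine tendsto_nhds_unique (hvx t ht 0 ⟨le_rfl, ha.le⟩) (squeeze_zero_norm ?_ hstep0)
      intro n
      have hh := step_pos ha n
      have h0 : idx a n 0 = 0 := by apply Fin.ext; simp [idx]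
      rw [h0, hddef]
      simp only
      rw [dif_zero_eq _ _ hh.ne', norm_mul, Real.norm_eq_abs, Real.norm_eq_abs, abs_of_pos hh]
      gcongr
      exact hgG n t ht 0
    · refine tendsto_nhds_unique (hvx t ht a ⟨ha.le, le_rfl⟩) (tendsto_const_nhds.congr ?_)
      intro n
      have h0 : idx a n a = Fin.last n := by
        apply Fin.ext
        -- At `x = a` the floor is `n + 1`, which the minimum in `idx` cuts down to the last cell.
        have : a / (a / ((n : ℝ) + 1)) = ((n + 1 : ℕ) : ℝ) := by push_cast; field_simp
        simp only [idx, this, Nat.floor_natCast, Fin.val_last]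
        omega
      rw [h0, hddef]
      simp only
      rw [dif_last]

end NonlocalFlow

namespace NonlocalFlow

/-! ### Classical solutions on a set of times -/

/-- The data of a classical solution of the nonlocal equation for times in `I`, with the equation
holding up to the boundary. -/
structure ClassicalOn (p a : ℝ) (I : Set ℝ) (u ut ux uxx : ℝ → ℝ → ℝ) : Prop where
  cont : ContinuousOn (fun z : ℝ × ℝ => u z.1 z.2) (I ×ˢ Icc 0 a)
  cont_t : ContinuousOn (fun z : ℝ × ℝ => ut z.1 z.2) (I ×ˢ Icc 0 a)
  cont_x : ContinuousOn (fun z : ℝ × ℝ => ux z.1 z.2) (I ×ˢ Icc 0 a)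
  cont_xx : ContinuousOn (fun z : ℝ × ℝ => uxx z.1 z.2) (I ×ˢ Icc 0 a)
  deriv_t : ∀ t ∈ I, ∀ x ∈ Icc 0 a, HasDerivAt (fun s => u s x) (ut t x) t
  deriv_x : ∀ t ∈ I, ∀ x ∈ Icc 0 a, HasDerivWithinAt (u t) (ux t x) (Icc 0 a) x
  deriv_xx : ∀ t ∈ I, ∀ x ∈ Icc 0 a, HasDerivWithinAt (ux t) (uxx t x) (Icc 0 a) x
  eqn : ∀ t ∈ I, ∀ x ∈ Icc 0 a, ut t x = u t x ^ p * (uxx t x + u t x - mean a (u t))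
  nonneg : ∀ t ∈ I, ∀ x ∈ Icc 0 a, 0 ≤ u t x
  left : ∀ t ∈ I, ux t 0 = 0
  right : ∀ t ∈ I, ux t a = 0

lemma continuousOn_slice {I : Set ℝ} {a : ℝ} {f : ℝ → ℝ → ℝ}
    (hf : ContinuousOn (fun z : ℝ × ℝ => f z.1 z.2) (I ×ˢ Icc 0 a)) {t : ℝ} (ht : t ∈ I) :
    ContinuousOn (f t) (Icc 0 a) :=
  hf.comp (f := fun x => (t, x)) (by fun_prop) (fun _ hx => ⟨ht, hx⟩)

lemma continuousOn_slice_time {I : Set ℝ} {a : ℝ} {f : ℝ → ℝ → ℝ}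
    (hf : ContinuousOn (fun z : ℝ × ℝ => f z.1 z.2) (I ×ˢ Icc 0 a)) {x : ℝ} (hx : x ∈ Icc 0 a) :
    ContinuousOn (fun t => f t x) I :=
  hf.comp (f := fun t => (t, x)) (by fun_prop) (fun _ ht => ⟨ht, hx⟩)

/-- The set of positive times before `T`. -/
def posTimes (T : EReal) : Set ℝ := {t | 0 < t ∧ (t : EReal) < T}

lemma openSlab_eq (a : ℝ) (T : EReal) : openSlab a T = posTimes T ×ˢ Icc 0 a := by
  ext z
  simp only [openSlab, posTimes, mem_ofPred_eq, mem_prod, and_assoc]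

lemma isOpen_posTimes (T : EReal) : IsOpen (posTimes T) :=
  (isOpen_lt continuous_const continuous_id).inter
    (isOpen_lt continuous_coe_real_ereal continuous_const)

lemma posTimes_of_le {T : EReal} {s t : ℝ} (hs : 0 < s) (hst : s ≤ t) (ht : t ∈ posTimes T) :
    s ∈ posTimes T :=
  ⟨hs, lt_of_le_of_lt (EReal.coe_le_coe_iff.2 hst) ht.2⟩

/-- `IsSolution` requires the equation only for `0 < x < a`; both sides are continuous in `x` on
`[0, a]`, so it holds at the endpoints too. -/
lemma IsSolution.exists_classicalOn {p a : ℝ} {u₀ : ℝ → ℝ} {T : EReal} {u : ℝ → ℝ → ℝ}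
    (hp : 0 < p) (ha : 0 < a) (hu : IsSolution p a u₀ T u) :
    ∃ ut ux uxx, ClassicalOn p a (posTimes T) u ut ux uxx := by
  obtain ⟨ut, ux, uxx, h1, h2, h3, h4, h5, h6⟩ := hu.equation
  rw [openSlab_eq] at h1 h2 h3
  have hmem : ∀ t ∈ posTimes T, ∀ x ∈ Icc 0 a, (t, x) ∈ slab a T := fun t ht x hx =>
    ⟨ht.1.le, ht.2, hx⟩
  have hmem' : ∀ t ∈ posTimes T, ∀ x ∈ Icc 0 a, (t, x) ∈ openSlab a T := fun t ht x hx =>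
    ⟨ht.1, ht.2, hx⟩
  have h0 : ContinuousOn (fun z : ℝ × ℝ => u z.1 z.2) (posTimes T ×ˢ Icc 0 a) :=
    hu.continuousOn.mono fun z hz => hmem z.1 hz.1 z.2 hz.2
  refine ⟨ut, ux, uxx, h0, h1, h2, h3, fun t ht x hx => (h4 t x (hmem' t ht x hx)).1,
    fun t ht x hx => (h4 t x (hmem' t ht x hx)).2.1,
    fun t ht x hx => (h4 t x (hmem' t ht x hx)).2.2, ?_,
    fun t ht x hx => hu.nonneg t x (hmem t ht x hx), fun t ht => (h6 t ht.1 ht.2).1,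
    fun t ht => (h6 t ht.1 ht.2).2⟩
  intro t ht
  have hcu := continuousOn_slice h0 ht
  have key : EqOn (ut t) (fun x => u t x ^ p * (uxx t x + u t x - mean a (u t))) (Icc 0 a) := by
    refine Set.EqOn.of_subset_closure (s := Ioo 0 a) (fun x hx => h5 t x ht.1 ht.2 hx)
      (continuousOn_slice h1 ht) ?_ Ioo_subset_Icc_self (by rw [closure_Ioo ha.ne])
    exact (hcu.rpow_const fun _ _ => Or.inr hp.le).mul
      (((continuousOn_slice h3 ht).add hcu).sub continuousOn_const)
  exact fun x hx => key hx

lemma abs_mean_le {a : ℝ} (ha : 0 < a) {φ : ℝ → ℝ} {C : ℝ} (hφ : ∀ x ∈ Icc 0 a, |φ x| ≤ C) :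
    |mean a φ| ≤ C := by
  have h := intervalIntegral.norm_integral_le_of_norm_le_const (a := 0) (b := a) (C := C) (f := φ)
    (fun x hx => hφ x (by rw [uIoc_of_le ha.le] at hx; exact ⟨hx.1.le, hx.2⟩))
  rw [mean, abs_mul, abs_of_pos (inv_pos.2 ha), inv_mul_le_iff₀ ha, mul_comm]
  simpa [abs_of_pos ha] using h

/-- A solution of the degenerate equation that starts positive stays positive. -/
lemma ClassicalOn.pos {p a : ℝ} {I : Set ℝ} {u ut ux uxx : ℝ → ℝ → ℝ} (hp : 1 < p) (ha : 0 < a)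
    (hu : ClassicalOn p a I u ut ux uxx) {s t : ℝ} (hst : s ≤ t) (hI : Icc s t ⊆ I) {x : ℝ}
    (hx : x ∈ Icc 0 a) (hpos : 0 < u s x) : 0 < u t x := by
  have hK : IsCompact (Icc s t ×ˢ Icc 0 a) := isCompact_Icc.prod isCompact_Icc
  have hsub : Icc s t ×ˢ Icc 0 a ⊆ I ×ˢ Icc 0 a := prod_mono_left hI
  obtain ⟨C, hC⟩ := hK.exists_bound_of_continuousOn (hu.cont.mono hsub)
  obtain ⟨D, hD⟩ := hK.exists_bound_of_continuousOn (hu.cont_xx.mono hsub)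
  have hC' : ∀ r ∈ Icc s t, ∀ y ∈ Icc 0 a, |u r y| ≤ C := fun r hr y hy => hC (r, y) ⟨hr, hy⟩
  have hC0 : 0 ≤ C := (abs_nonneg _).trans (hC' s ⟨le_rfl, hst⟩ x hx)
  set L := D + C + C with hL
  have hD0 : 0 ≤ D := (norm_nonneg _).trans (hD (s, x) ⟨⟨le_rfl, hst⟩, hx⟩)
  have hL0 : 0 ≤ L := by positivity
  -- On the compact time interval `u_t ≥ -C^(p-1) L u`, since `p > 1` lets one factor `u` be split
  -- off `u^p`. So `u(r, x) exp(K r)` does not decrease.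
  set K := C ^ (p - 1) * L with hKdef
  have hmono := le_of_hasDeriv_nonpos (α := s) (β := t)
    (F := fun r => -(u r x * Real.exp (K * r)))
    (F' := fun r => -(ut r x * Real.exp (K * r) + u r x * (Real.exp (K * r) * (K * 1))))
    (fun r hr => (((hu.deriv_t r (hI hr) x hx).mul
      ((hasDerivAt_id r).const_mul K).exp).neg).hasDerivWithinAt)
    (fun r hr => by
      have h0 := hu.nonneg r (hI hr) x hx
      have h1 : |uxx r x + u r x - mean a (u r)| ≤ L := by
        have e1 : |uxx r x| ≤ D := hD (r, x) ⟨hr, hx⟩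
        have e2 := hC' r hr x hx
        have e3 := abs_mean_le ha (hC' r hr)
        rw [abs_le] at *
        constructor <;> linarith
      have h2 : u r x ^ p = u r x ^ (p - 1) * u r x := by
        rw [← Real.rpow_add_one' h0 (by linarith)]; ring_nf
      have h3 : u r x ^ (p - 1) ≤ C ^ (p - 1) :=
        Real.rpow_le_rpow h0 ((le_abs_self _).trans (hC' r hr x hx)) (by linarith)
      have h4 : -(K * u r x) ≤ ut r x := by
        rw [hu.eqn r (hI hr) x hx, h2, hKdef]
        have e1 : u r x ^ (p - 1) * u r x ≤ C ^ (p - 1) * u r x := by gcongr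
        have e2 : 0 ≤ u r x ^ (p - 1) * u r x := by positivity
        calc -(C ^ (p - 1) * L * u r x) = -((C ^ (p - 1) * u r x) * L) := by ring
          _ ≤ -((u r x ^ (p - 1) * u r x) * L) := by gcongr
          _ = (u r x ^ (p - 1) * u r x) * -L := by ring
          _ ≤ _ := mul_le_mul_of_nonneg_left (abs_le.1 h1).1 e2
      have h5 : 0 < Real.exp (K * r) := Real.exp_pos _
      nlinarith)
    le_rfl hst le_rfl
  have h1 : 0 < u s x * Real.exp (K * s) := by positivity
  have h2 : 0 < u t x * Real.exp (K * t) := by linarith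
  exact (pos_iff_pos_of_mul_pos h2).2 (Real.exp_pos _)

/-! ### Consistency and convergence of the semi-discretization -/

/-- First order Taylor estimate for functions with a one-sided derivative at the ends. -/
lemma taylor_one {a : ℝ} {φ φ' : ℝ → ℝ} (hφ : ∀ x ∈ Icc 0 a, HasDerivWithinAt φ (φ' x) (Icc 0 a) x)
    {η h : ℝ} (hosc : ∀ x ∈ Icc 0 a, ∀ y ∈ Icc 0 a, |x - y| ≤ h → |φ' x - φ' y| ≤ η)
    {x y : ℝ} (hx : x ∈ Icc 0 a) (hy : y ∈ Icc 0 a) (hxy : |x - y| ≤ h) :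
    |φ x - φ y - (x - y) * φ' y| ≤ η * |x - y| := by
  have hconv : Convex ℝ (Icc 0 a ∩ Metric.closedBall y h) :=
    (convex_Icc _ _).inter (convex_closedBall y h)
  have h0 : 0 ≤ h := (abs_nonneg _).trans hxy
  have := hconv.norm_image_sub_le_of_norm_hasDerivWithin_le (C := η)
    (f := fun r => φ r - r * φ' y) (f' := fun r => φ' r - 1 * φ' y) (x := y) (y := x)
    (fun r hr => ((hφ r hr.1).sub ((hasDerivAt_id r).mul_const _).hasDerivWithinAt).mono
      inter_subset_left)
    (fun r hr => by rw [one_mul]; exact hosc r hr.1 y hy hr.2)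
    ⟨hy, Metric.mem_closedBall_self h0⟩ ⟨hx, hxy⟩
  refine le_trans (le_of_eq ?_) this
  rw [Real.norm_eq_abs]
  congr 1; ring

/-- Second order Taylor estimate for functions with one-sided derivatives at the ends. -/
lemma taylor_two {a : ℝ} {φ φ' φ'' : ℝ → ℝ}
    (hφ : ∀ x ∈ Icc 0 a, HasDerivWithinAt φ (φ' x) (Icc 0 a) x)
    (hφ' : ∀ x ∈ Icc 0 a, HasDerivWithinAt φ' (φ'' x) (Icc 0 a) x)
    {η h : ℝ} (hη : 0 ≤ η)
    (hosc : ∀ x ∈ Icc 0 a, ∀ y ∈ Icc 0 a, |x - y| ≤ h → |φ'' x - φ'' y| ≤ η)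
    {x y : ℝ} (hx : x ∈ Icc 0 a) (hy : y ∈ Icc 0 a) (hxy : |x - y| ≤ h) :
    |φ x - φ y - (x - y) * φ' y - (x - y) ^ 2 / 2 * φ'' y| ≤ η * |x - y| ^ 2 := by
  set r := |x - y| with hr
  have hconv : Convex ℝ (Icc 0 a ∩ Metric.closedBall y r) :=
    (convex_Icc _ _).inter (convex_closedBall y r)
  have h0 : 0 ≤ r := abs_nonneg _
  have := hconv.norm_image_sub_le_of_norm_hasDerivWithin_le (C := η * r)
    (f := fun s => φ s - s * φ' y - (s - y) ^ 2 / 2 * φ'' y)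
    (f' := fun s => φ' s - φ' y - (s - y) * φ'' y) (x := y) (y := x)
    (fun s hs => by
      have h1 : HasDerivAt (fun s : ℝ => s * φ' y) (φ' y) s := by
        simpa using (hasDerivAt_id s).mul_const (φ' y)
      have h2 : HasDerivAt (fun s : ℝ => (s - y) ^ 2 / 2 * φ'' y) ((s - y) * φ'' y) s := by
        have := ((((hasDerivAt_id s).sub_const y).pow 2).div_const 2).mul_const (φ'' y)
        refine this.congr_deriv ?_
        simp
      exact (((hφ s hs.1).sub h1.hasDerivWithinAt).sub h2.hasDerivWithinAt).mono inter_subset_left)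
    (fun s hs => by
      have hs2 : |s - y| ≤ r := hs.2
      refine (taylor_one hφ' hosc hs.1 hy (hs2.trans hxy)).trans ?_
      gcongr)
    ⟨hy, Metric.mem_closedBall_self h0⟩ ⟨hx, hr.symm.le⟩
  rw [Real.norm_eq_abs, Real.norm_eq_abs, ← hr] at this
  calc _ = |φ x - x * φ' y - (x - y) ^ 2 / 2 * φ'' y - (φ y - y * φ' y - (y - y) ^ 2 / 2 * φ'' y)| := by
        congr 1; ring
    _ ≤ η * r * r := this
    _ = _ := by ring

/-- Consistency of the discrete Neumann Laplacian. -/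
lemma abs_lap_sub_le {a : ℝ} (ha : 0 < a) {n : ℕ} {φ φ' φ'' : ℝ → ℝ}
    (hφ : ∀ x ∈ Icc 0 a, HasDerivWithinAt φ (φ' x) (Icc 0 a) x)
    (hφ' : ∀ x ∈ Icc 0 a, HasDerivWithinAt φ' (φ'' x) (Icc 0 a) x)
    (h0 : φ' 0 = 0) (h1 : φ' a = 0) {η : ℝ} (hη : 0 ≤ η)
    (hosc : ∀ x ∈ Icc 0 a, ∀ y ∈ Icc 0 a, |x - y| ≤ a / (n + 1) → |φ'' x - φ'' y| ≤ η)
    (i : Fin (n + 1)) :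
    |lap (a / (n + 1)) (fun j => φ (pt a n j)) i - φ'' (pt a n i)| ≤ 2 * η := by
  have hh := step_pos ha n
  have hnh : ((n : ℝ) + 1) * (a / (n + 1)) = a := by field_simp
  set h := a / ((n : ℝ) + 1) with hdef
  set f : Fin (n + 1) → ℝ := fun j => φ (pt a n j) with hf
  have hmem : ∀ k : ℕ, k ≤ n + 1 → (k : ℝ) * h ∈ Icc 0 a := by
    intro k hk
    refine ⟨by positivity, ?_⟩
    have : (k : ℝ) ≤ n + 1 := by exact_mod_cast hk
    rw [← hnh]; gcongr
  -- The nodes are cell midpoints, so `dif` is a centred quotient at the right face `(j + 1) h` of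
  -- the cell; at the last face `x = a` both terms vanish. The two flux errors and the two Taylor
  -- errors of `φ'` over half a cell are each `η h / 2`, which gives `2 η` after division by `h`.
  have hflux : ∀ j : Fin (n + 1), |dif h f j - φ' (((j : ℝ) + 1) * h)| ≤ η * h / 2 := by
    intro j
    rcases (Nat.lt_succ_iff.1 j.is_lt).lt_or_eq with hj | hj
    · have hy : ((j : ℝ) + 1) * h ∈ Icc 0 a := by exact_mod_cast hmem (j + 1) (by omega)
      set y := ((j : ℝ) + 1) * h with hydef
      have hpj : pt a n j - y = -(h / 2) := by rw [hydef, pt, ← hdef]; ring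
      have hpu : pt a n (up j) - y = h / 2 := by
        rw [hydef, pt, ← hdef, val_up hj]; push_cast; ring
      have e1 := taylor_two hφ hφ' hη hosc (pt_mem ha j) hy
        (by rw [hpj, abs_neg, abs_of_pos (by positivity)]; linarith)
      have e2 := taylor_two hφ hφ' hη hosc (pt_mem ha (up j)) hy
        (by rw [hpu, abs_of_pos (by positivity)]; linarith)
      rw [hpj, abs_neg, abs_of_pos (by positivity : 0 < h / 2)] at e1
      rw [hpu, abs_of_pos (by positivity : 0 < h / 2)] at e2
      have e3 : dif h f j - φ' y = (f (up j) - f j - h * φ' y) / h := by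
        simp only [dif]; field_simp
      rw [e3, abs_div, abs_of_pos hh, div_le_iff₀ hh]
      simp only [hf]
      rw [abs_le] at *
      constructor <;> nlinarith
    · have hlast : j = Fin.last n := Fin.ext hj
      rw [hlast, dif_last]
      simp only [Fin.val_last, hnh, h1, sub_self, abs_zero]
      positivity
  have hT : ∀ x ∈ Icc 0 a, |x - pt a n i| = h / 2 →
      |φ' x - φ' (pt a n i) - (x - pt a n i) * φ'' (pt a n i)| ≤ η * (h / 2) := by
    intro x hx hd
    rw [← hd]
    exact taylor_one hφ' hosc hx (pt_mem ha i) (by rw [hd]; linarith)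
  have hr := hT (((i : ℝ) + 1) * h) (by exact_mod_cast hmem (i + 1) (by omega))
    (by rw [pt, ← hdef, show ((i : ℝ) + 1) * h - ((i : ℝ) + 1 / 2) * h = h / 2 by ring,
          abs_of_pos (by positivity)])
  have hl := hT ((i : ℝ) * h) (hmem i (by omega))
    (by rw [pt, ← hdef, show (i : ℝ) * h - ((i : ℝ) + 1 / 2) * h = -(h / 2) by ring, abs_neg,
          abs_of_pos (by positivity)])
  -- `F` is the flux through the left face: the previous difference quotient, or 0 at the boundary
  -- `x = 0`.
  have hfl : ∃ F, |F - φ' ((i : ℝ) * h)| ≤ η * h / 2 ∧ lap h f i = (dif h f i - F) / h := by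
    rcases Nat.eq_zero_or_pos (i : ℕ) with hi | hi
    · have : i = 0 := Fin.ext hi
      subst this
      refine ⟨0, ?_, ?_⟩
      · simp only [Fin.val_zero, Nat.cast_zero, zero_mul, h0, sub_self, abs_zero]; positivity
      · rw [dif_zero_eq h f hh.ne']; field_simp; ring
    · refine ⟨dif h f (dn i), ?_, ?_⟩
      · have := hflux (dn i)
        have e : ((dn i : Fin (n + 1)) : ℝ) + 1 = i := by
          have : ((dn i : Fin (n + 1)) : ℕ) + 1 = i := by simp only [dn]; omega
          exact_mod_cast this
        rwa [e] at this
      · have hlt : ((dn i : Fin (n + 1)) : ℕ) < n := by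
          have := i.is_lt; simp only [dn]; omega
        have hud : up (dn i) = i := by
          apply Fin.ext; rw [val_up hlt]; simp only [dn]; omega
        have := dif_up_sub_dif hh.ne' f hlt
        rw [hud] at this
        rw [this]; field_simp
  obtain ⟨F, hF, hlap⟩ := hfl
  have hi := hflux i
  have e : lap h f i - φ'' (pt a n i) = (dif h f i - F - h * φ'' (pt a n i)) / h := by
    rw [hlap]; field_simp
  rw [e, abs_div, abs_of_pos hh, div_le_iff₀ hh]
  have ept : ((i : ℝ) + 1) * h - pt a n i = h / 2 := by rw [pt, ← hdef]; ring
  have ept' : (i : ℝ) * h - pt a n i = -(h / 2) := by rw [pt, ← hdef]; ring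
  rw [ept] at hr
  rw [ept'] at hl
  rw [abs_le] at *
  constructor <;> linarith

end NonlocalFlow

/-! ### Comparison of a classical solution with its grid flows in the maximum norm. -/

namespace NonlocalFlow

lemma abs_rpow_sub_rpow_le {p M x y : ℝ} (hp : 1 ≤ p) (hx : x ∈ Icc 0 M) (hy : y ∈ Icc 0 M) :
    |x ^ p - y ^ p| ≤ p * M ^ (p - 1) * |x - y| := by
  refine (convex_Icc 0 M).norm_image_sub_le_of_norm_hasDerivWithin_le (f := fun s => s ^ p)
    (f' := fun s => p * s ^ (p - 1))
    (fun s _ => (Real.hasDerivAt_rpow_const (Or.inr hp)).hasDerivWithinAt) (fun s hs => ?_) hy hx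
  have := hs.1
  rw [Real.norm_eq_abs, abs_of_nonneg (by positivity)]
  gcongr
  exact hs.2

lemma opA_sub {n : ℕ} (h : ℝ) (f g : Fin (n + 1) → ℝ) (i : Fin (n + 1)) :
    opA h (fun j => f j - g j) i = opA h f i - opA h g i := by
  unfold opA; rw [lap_sub, avg_sub]; ring

/-- If `|e| ≤ B` on the grid with equality at `i`, then `e i * opA e i ≤ 2 B²`. -/
lemma mul_opA_le {n : ℕ} (h : ℝ) {e : Fin (n + 1) → ℝ} {B : ℝ} (he : ∀ j, e j ^ 2 ≤ B ^ 2)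
    {i : Fin (n + 1)} (hi : e i ^ 2 = B ^ 2) : e i * opA h e i ≤ 2 * B ^ 2 := by
  have hmul : ∀ j, |e i * e j| ≤ B ^ 2 := by
    intro j
    rw [abs_le]
    constructor <;> nlinarith [he j, sq_nonneg (e i - e j), sq_nonneg (e i + e j)]
  have h1 : e i * lap h e i ≤ 0 := by
    have : e i * lap h e i = (e i * e (up i) + e i * e (dn i) - 2 * e i ^ 2) / h ^ 2 := by
      unfold lap; ring
    rw [this]
    refine div_nonpos_of_nonpos_of_nonneg ?_ (sq_nonneg h)
    linarith [(abs_le.1 (hmul (up i))).2, (abs_le.1 (hmul (dn i))).2]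
  have h2 : |e i * avg e| ≤ B ^ 2 := by
    rw [← avg_const_mul]; exact abs_avg_le hmul
  have h3 : e i * opA h e i = e i * lap h e i + e i ^ 2 - e i * avg e := by unfold opA; ring
  rw [h3]
  linarith [(abs_le.1 h2).1]

/-- A classical solution is the limit of the semi-discrete flows with the same initial datum. -/
theorem ClassicalOn.eventually_abs_sub_gridFlow_le {p a m M τ t₀ t₁ : ℝ} {I : Set ℝ}
    {u ut ux uxx : ℝ → ℝ → ℝ} (hp : 1 < p) (ha : 0 < a) (hm : 0 < m)
    (hu : ClassicalOn p a I u ut ux uxx) (ht : t₀ ≤ t₁) (hI : Icc t₀ t₁ ⊆ I) (hτ : t₁ - t₀ ≤ τ)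
    (hM : ∀ t ∈ Icc t₀ t₁, ∀ x ∈ Icc 0 a, u t x ≤ M)
    {U : (n : ℕ) → ℝ → Fin (n + 1) → ℝ} (hU : ∀ n, GridFlow p a m M τ n (U n))
    (hinit : ∀ n i, U n 0 i = u t₀ (pt a n i)) {η : ℝ} (hη : 0 < η) :
    ∀ᶠ n in Filter.atTop, ∀ s ∈ Icc 0 (t₁ - t₀), ∀ i,
      |U n s i - u (t₀ + s) (pt a n i)| ≤ η := by
  have hK : IsCompact (Icc t₀ t₁ ×ˢ Icc 0 a) := isCompact_Icc.prod isCompact_Icc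
  have hsub : Icc t₀ t₁ ×ˢ Icc 0 a ⊆ I ×ˢ Icc 0 a := prod_mono_left hI
  have hM0 : 0 ≤ M := (hu.nonneg t₀ (hI ⟨le_rfl, ht⟩) 0 ⟨le_rfl, ha.le⟩).trans
    (hM t₀ ⟨le_rfl, ht⟩ 0 ⟨le_rfl, ha.le⟩)
  obtain ⟨D, hD⟩ := hK.exists_bound_of_continuousOn (hu.cont_xx.mono hsub)
  have hD0 : 0 ≤ D := (norm_nonneg _).trans (hD (t₀, 0) ⟨⟨le_rfl, ht⟩, ⟨le_rfl, ha.le⟩⟩)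
  set Λ := p * M ^ (p - 1) with hΛ
  have hΛ0 : 0 ≤ Λ := by positivity
  set N := D + M + M + 3 with hN
  have hN0 : 0 ≤ N := by positivity
  -- Growth rate of the error barrier `B = B₀ exp(K s)`: `2 M^p` from `mul_opA_le`, `Λ N` from the
  -- difference of the powers times the bounded `opA (V s)`, and 1 for the consistency error, which
  -- is below `B₀ ≤ B` by the choice of `ρ`. `B₀` is such that the barrier reaches `η` at the final
  -- time.
  set K := 2 * M ^ p + Λ * N + 1 with hKdef
  have hMp : 0 ≤ M ^ p := by positivity
  have hK0 : 0 < K := by positivity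
  set B₀ := η * Real.exp (-(K * (t₁ - t₀))) with hB₀
  have hB₀0 : 0 < B₀ := by positivity
  set ρ := min 1 (B₀ / (3 * (M ^ p + 1))) with hρ
  have hρ0 : 0 < ρ := lt_min one_pos (by positivity)
  have hρ1 : ρ ≤ 1 := min_le_left _ _
  have hρB : M ^ p * (3 * ρ) < B₀ := by
    have h1 : ρ ≤ B₀ / (3 * (M ^ p + 1)) := min_le_right _ _
    rw [le_div_iff₀ (by positivity)] at h1
    nlinarith
  have huc := hK.uniformContinuousOn_of_continuous (hu.cont.mono hsub)
  have hucx := hK.uniformContinuousOn_of_continuous (hu.cont_xx.mono hsub)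
  rw [Metric.uniformContinuousOn_iff_le] at huc hucx
  obtain ⟨δ₁, hδ₁, hosc₁⟩ := huc ρ hρ0
  obtain ⟨δ₂, hδ₂, hosc₂⟩ := hucx ρ hρ0
  have hdist : ∀ t x y : ℝ, dist (t, x) (t, y) = |x - y| := by
    intro t x y; rw [Prod.dist_eq]; simp [Real.dist_eq]
  filter_upwards [(tendsto_step a).eventually (gt_mem_nhds hδ₁),
    (tendsto_step a).eventually (gt_mem_nhds hδ₂)] with n hn₁ hn₂ s₀ hs₀ i₀
  have hh := step_pos ha n
  set h := a / ((n : ℝ) + 1) with hdef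
  have hmemt : ∀ s ∈ Icc 0 (t₁ - t₀), t₀ + s ∈ Icc t₀ t₁ := fun s hs =>
    ⟨by linarith [hs.1], by linarith [hs.2]⟩
  have hsubτ : Icc 0 (t₁ - t₀) ⊆ Icc 0 τ := Icc_subset_Icc le_rfl hτ
  set V : ℝ → Fin (n + 1) → ℝ := fun s j => u (t₀ + s) (pt a n j) with hV
  -- The consistency error is `2 ρ` from the Laplacian and `ρ` from the midpoint rule for the mean.
  have hcons : ∀ s ∈ Icc 0 (t₁ - t₀), ∀ i, |opA h (V s) i - (uxx (t₀ + s) (pt a n i) + V s i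
      - mean a (u (t₀ + s)))| ≤ 3 * ρ := by
    intro s hs i
    have hts := hmemt s hs
    have h1 := abs_lap_sub_le ha (n := n) (hu.deriv_x _ (hI hts)) (hu.deriv_xx _ (hI hts))
      (hu.left _ (hI hts)) (hu.right _ (hI hts)) hρ0.le
      (fun x hx y hy hxy => hosc₂ (t₀ + s, x) ⟨hts, hx⟩ (t₀ + s, y) ⟨hts, hy⟩
        (by rw [hdist]; exact hxy.trans hn₂.le)) i
    have h2 := abs_avg_sub_mean_le (n := n) ha (continuousOn_slice hu.cont (hI hts)) (η := ρ)
      (fun x hx y hy hxy => hosc₁ (t₀ + s, x) ⟨hts, hx⟩ (t₀ + s, y) ⟨hts, hy⟩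
        (by rw [hdist]; exact hxy.trans hn₁.le))
    rw [← hdef] at h1
    unfold opA
    rw [abs_le] at *
    constructor <;> linarith
  have hVderiv : ∀ s ∈ Icc 0 (t₁ - t₀), ∀ i, HasDerivWithinAt (fun r => V r i)
      (ut (t₀ + s) (pt a n i)) (Icc 0 (t₁ - t₀)) s := by
    intro s hs i
    exact ((hu.deriv_t _ (hI (hmemt s hs)) _ (pt_mem ha i)).comp_const_add t₀ s).hasDerivWithinAt
  have hUderiv : ∀ s ∈ Icc 0 (t₁ - t₀), ∀ i, HasDerivWithinAt (fun r => U n r i)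
      (vel p h (U n s) i) (Icc 0 (t₁ - t₀)) s := fun s hs i =>
    ((hU n).hasDeriv s (hsubτ hs) i).mono hsubτ
  have hcU := continuousOn_uncurry_of_hasDeriv hUderiv
  have hcV := continuousOn_uncurry_of_hasDeriv hVderiv
  -- Squares treat both signs of the error at once. A first touching point is a grid maximum of `|U
  -- - V|`, where the Laplacian has the favourable sign.
  have hfinal := pos_of_firstTouch (τ := t₁ - t₀) (X := Fin (n + 1))
    (f := fun s i => (B₀ * Real.exp (K * s)) ^ 2 - (U n s i - V s i) ^ 2)
    (by fun_prop)
    (fun i => by simp only [hinit, hV, add_zero]; simp; positivity)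
    (fun s hs i h0 hge => ?_) hs₀ i₀
  · have h1 : |U n s₀ i₀ - V s₀ i₀| ≤ B₀ * Real.exp (K * s₀) :=
      abs_le_of_sq_le_sq (by linarith) (by positivity)
    refine h1.trans ?_
    rw [hB₀, mul_assoc, ← Real.exp_add]
    have : Real.exp (-(K * (t₁ - t₀)) + K * s₀) ≤ 1 := by
      rw [Real.exp_le_one_iff]
      nlinarith [hs₀.2]
    nlinarith
  · have hs' := Ioc_subset_Icc_self hs
    have hts := hmemt s hs'
    set B := B₀ * Real.exp (K * s) with hB
    have hBB₀ : B₀ ≤ B := by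
      have : 1 ≤ Real.exp (K * s) := Real.one_le_exp (by have := hs'.1; positivity)
      nlinarith
    have hBpos : 0 < B := hB₀0.trans_le hBB₀
    set e : Fin (n + 1) → ℝ := fun j => U n s j - V s j with he
    have hei : e i ^ 2 = B ^ 2 := by simp only [he]; linarith
    have hej : ∀ j, e j ^ 2 ≤ B ^ 2 := fun j => by simp only [he]; linarith [hge j]
    have hUm : U n s i ∈ Icc 0 M :=
      ⟨hm.le.trans ((hU n).lower s (hsubτ hs') i), (hU n).upper s (hsubτ hs') i⟩
    have hVm : ∀ j, V s j ∈ Icc 0 M := fun j =>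
      ⟨hu.nonneg _ (hI hts) _ (pt_mem ha j), hM _ hts _ (pt_mem ha j)⟩
    have habs : |e i| = B := by
      rw [← Real.sqrt_sq_eq_abs, hei, Real.sqrt_sq hBpos.le]
    refine ⟨2 * B * (K * B) - 2 * e i * (vel p h (U n s) i - ut (t₀ + s) (pt a n i)), ?_, ?_⟩
    · set ν := opA h (V s) i - (uxx (t₀ + s) (pt a n i) + V s i - mean a (u (t₀ + s))) with hν
      have hν1 : |ν| ≤ 3 * ρ := hcons s hs' i
      have hopV : |opA h (V s) i| ≤ N := by
        have e1 : |uxx (t₀ + s) (pt a n i)| ≤ D := hD (t₀ + s, pt a n i) ⟨hts, pt_mem ha i⟩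
        have e2 := abs_mean_le ha (φ := u (t₀ + s)) (C := M) (fun x hx => abs_le.2
          ⟨by linarith [hu.nonneg _ (hI hts) x hx], hM _ hts x hx⟩)
        have e3 : opA h (V s) i = ν + (uxx (t₀ + s) (pt a n i) + V s i
          - mean a (u (t₀ + s))) := by rw [hν]; ring
        have e4 := hVm i
        rw [e3]
        rw [abs_le] at *
        constructor <;> linarith [e4.1, e4.2]
      have hut : ut (t₀ + s) (pt a n i) = V s i ^ p * (opA h (V s) i - ν) := by
        rw [hu.eqn _ (hI hts) _ (pt_mem ha i), hν]; ring
      have hdecomp : e i * (vel p h (U n s) i - ut (t₀ + s) (pt a n i)) =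
          U n s i ^ p * (e i * opA h e i) + e i * ((U n s i ^ p - V s i ^ p) * opA h (V s) i)
            + e i * (V s i ^ p * ν) := by
        rw [hut, he, opA_sub]; unfold vel; ring
      have hUp : U n s i ^ p ≤ M ^ p := Real.rpow_le_rpow hUm.1 hUm.2 (by linarith)
      have hUp0 : 0 ≤ U n s i ^ p := Real.rpow_nonneg hUm.1 p
      have hVp : V s i ^ p ≤ M ^ p := Real.rpow_le_rpow (hVm i).1 (hVm i).2 (by linarith)
      have hVp0 : 0 ≤ V s i ^ p := Real.rpow_nonneg (hVm i).1 p
      have t1 : U n s i ^ p * (e i * opA h e i) ≤ M ^ p * (2 * B ^ 2) :=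
        (mul_le_mul_of_nonneg_left (mul_opA_le h hej hei) hUp0).trans
          (mul_le_mul_of_nonneg_right hUp (by positivity))
      have t2 : e i * ((U n s i ^ p - V s i ^ p) * opA h (V s) i) ≤ B * (Λ * B * N) := by
        refine (le_abs_self _).trans ?_
        rw [abs_mul, abs_mul, habs]
        have e1 := abs_rpow_sub_rpow_le hp.le hUm (hVm i)
        rw [show U n s i - V s i = e i from rfl, habs] at e1
        gcongr
      have t3 : e i * (V s i ^ p * ν) ≤ B * (M ^ p * (3 * ρ)) := by
        refine (le_abs_self _).trans ?_
        rw [abs_mul, abs_mul, habs, abs_of_nonneg hVp0]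
        gcongr
      have t4 : B * (M ^ p * (3 * ρ)) < B * B := by
        have : M ^ p * (3 * ρ) < B := hρB.trans_le hBB₀
        gcongr
      have t5 : K * B * B = M ^ p * (2 * B ^ 2) + B * (Λ * B * N) + B * B := by rw [hKdef]; ring
      have t6 : e i * (vel p h (U n s) i - ut (t₀ + s) (pt a n i)) < K * B * B := by
        rw [hdecomp]; linarith
      linarith
    · have hBd : HasDerivAt (fun r : ℝ => B₀ * Real.exp (K * r)) (K * B) s := by
        have := ((hasDerivAt_id s).const_mul K).exp.const_mul B₀
        refine this.congr_deriv ?_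
        simp only [id, hB]; ring
      have h1 := (hBd.pow 2).hasDerivWithinAt (s := Icc 0 (t₁ - t₀))
      have h2 := ((hUderiv s hs' i).sub (hVderiv s hs' i)).pow 2
      refine (h1.sub h2).congr_deriv ?_
      simp [he, hB]

end NonlocalFlow

namespace NonlocalFlow

/-! ### Continuation of bounded solutions -/

lemma exists_mem_posTimes_lt {T : EReal} (hT : 0 < T) {r : ℝ} (hr : 0 < r) :
    ∃ s ∈ posTimes T, s < r := by
  obtain ⟨q, hq0, hqT⟩ := EReal.lt_iff_exists_real_btwn.1 hT
  have hq : 0 < q := by exact_mod_cast hq0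
  refine ⟨min q (r / 2), ⟨by positivity, lt_of_le_of_lt ?_ hqT⟩,
    (min_le_right _ _).trans_lt (by linarith)⟩
  exact EReal.coe_le_coe_iff.2 (min_le_left _ _)

lemma IsSolution.continuousWithinAt_zero {p a : ℝ} {u₀ : ℝ → ℝ} {T : EReal} {u : ℝ → ℝ → ℝ}
    (hu : IsSolution p a u₀ T u) {x : ℝ} (hx : x ∈ Icc 0 a) :
    ContinuousWithinAt (fun t => u t x) (posTimes T) 0 := by
  have h0 : ((0 : ℝ), x) ∈ slab a T := ⟨le_rfl, hu.time_pos, hx⟩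
  exact (hu.continuousOn _ h0).comp (f := fun t : ℝ => (t, x)) (by fun_prop)
    (fun t ht => ⟨ht.1.le, ht.2, hx⟩)

lemma zero_mem_closure_posTimes {T : EReal} (hT : 0 < T) : (0 : ℝ) ∈ closure (posTimes T) := by
  rw [Metric.mem_closure_iff]
  intro ε hε
  obtain ⟨s, hs, hsε⟩ := exists_mem_posTimes_lt hT hε
  exact ⟨s, hs, by rw [Real.dist_eq, zero_sub, abs_neg, abs_of_pos hs.1]; exact hsε⟩

/-- `ClassicalOn.pos` starts from a positive time, as the derivatives are not controlled at 0;
continuity of `u` at 0 provides such a time at which `u` is still positive. -/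
lemma IsSolution.pos {p a : ℝ} {u₀ : ℝ → ℝ} {T : EReal} {u : ℝ → ℝ → ℝ}
    (hp : 1 < p) (ha : 0 < a) (hu₀ : ∀ x ∈ Icc 0 a, 0 < u₀ x) (hu : IsSolution p a u₀ T u)
    {t : ℝ} (ht : t ∈ posTimes T) {x : ℝ} (hx : x ∈ Icc 0 a) : 0 < u t x := by
  obtain ⟨ut, ux, uxx, hcl⟩ := hu.exists_classicalOn (by linarith) ha
  have h1 := hu.continuousWithinAt_zero hx
  have h2 : 0 < u 0 x := by rw [hu.initial x hx]; exact hu₀ x hx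
  have hne : (nhdsWithin (0 : ℝ) (posTimes T)).NeBot :=
    mem_closure_iff_nhdsWithin_neBot.1 (zero_mem_closure_posTimes hu.time_pos)
  obtain ⟨s, hs, hst, hs'⟩ := ((h1.eventually (lt_mem_nhds h2)).and
    (((gt_mem_nhds ht.1).filter_mono nhdsWithin_le_nhds).and eventually_mem_nhdsWithin)).exists
  exact hcl.pos hp ha hst.le (fun r hr => posTimes_of_le (hs'.1.trans_le hr.1) hr.2 ht) hx hs

/-- Concatenation in time. -/
def glue (T : ℝ) (f g : ℝ → ℝ → ℝ) (t x : ℝ) : ℝ := if t < T then f t x else g t x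

lemma glue_of_lt {T t : ℝ} {f g : ℝ → ℝ → ℝ} (h : t < T) : glue T f g t = f t := by
  funext x; simp [glue, h]

lemma glue_eq_right {T t₁ T' a : ℝ} {f g : ℝ → ℝ → ℝ}
    (hfg : ∀ t ∈ Ioo t₁ T, ∀ x ∈ Icc 0 a, f t x = g t x) {t x : ℝ} (ht : t ∈ Ioo t₁ T')
    (hx : x ∈ Icc 0 a) : glue T f g t x = g t x := by
  unfold glue
  split_ifs with h
  · exact hfg t ⟨ht.1, h⟩ x hx
  · rfl

lemma continuousOn_glue {T t₁ T' a : ℝ} {S : Set ℝ} {f g : ℝ → ℝ → ℝ} (h1 : t₁ < T)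
    (hf : ContinuousOn (fun z : ℝ × ℝ => f z.1 z.2) ((S ∩ Iio T) ×ˢ Icc 0 a))
    (hg : ContinuousOn (fun z : ℝ × ℝ => g z.1 z.2) (Ioo t₁ T' ×ˢ Icc 0 a))
    (hfg : ∀ t ∈ Ioo t₁ T, ∀ x ∈ Icc 0 a, f t x = g t x) :
    ContinuousOn (fun z : ℝ × ℝ => glue T f g z.1 z.2) ((S ∩ Iio T') ×ˢ Icc 0 a) := by
  rintro ⟨t, x⟩ ⟨⟨htS, htT'⟩, hx⟩
  rcases lt_or_ge t T with htT | htT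
  · have hnhds : {z : ℝ × ℝ | z.1 < T} ∈ nhds (t, x) :=
      (isOpen_lt continuous_fst continuous_const).mem_nhds htT
    have hc := hf (t, x) ⟨⟨htS, htT⟩, hx⟩
    have hmem : (S ∩ Iio T) ×ˢ Icc 0 a ∈ nhdsWithin (t, x) ((S ∩ Iio T') ×ˢ Icc 0 a) := by
      filter_upwards [self_mem_nhdsWithin, mem_nhdsWithin_of_mem_nhds hnhds] with z hz hzT
      exact ⟨⟨hz.1.1, hzT⟩, hz.2⟩
    refine (hc.mono_of_mem_nhdsWithin hmem).congr_of_eventuallyEq ?_ (by simp [glue, htT])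
    filter_upwards [mem_nhdsWithin_of_mem_nhds hnhds] with z hz
    rw [glue_of_lt hz]
  · have hnhds : {z : ℝ × ℝ | t₁ < z.1} ∈ nhds (t, x) :=
      (isOpen_lt continuous_const continuous_fst).mem_nhds (h1.trans_le htT)
    have hc := hg (t, x) ⟨⟨h1.trans_le htT, htT'⟩, hx⟩
    have hmem : Ioo t₁ T' ×ˢ Icc 0 a ∈ nhdsWithin (t, x) ((S ∩ Iio T') ×ˢ Icc 0 a) := by
      filter_upwards [self_mem_nhdsWithin, mem_nhdsWithin_of_mem_nhds hnhds] with z hz hzT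
      exact ⟨⟨hzT, hz.1.2⟩, hz.2⟩
    refine (hc.mono_of_mem_nhdsWithin hmem).congr_of_eventuallyEq ?_
      (glue_eq_right hfg ⟨h1.trans_le htT, htT'⟩ hx)
    filter_upwards [hmem] with z hz
    exact glue_eq_right hfg hz.1 hz.2

/-- Two classical solutions data for the same function have the same derivatives. -/
lemma ClassicalOn.deriv_unique {p a t₁ T : ℝ} (ha : 0 < a) {u ut ux uxx v vt vx vxx : ℝ → ℝ → ℝ}
    (hu : ClassicalOn p a (Ioo t₁ T) u ut ux uxx) (hv : ClassicalOn p a (Ioo t₁ T) v vt vx vxx)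
    (huv : ∀ t ∈ Ioo t₁ T, ∀ x ∈ Icc 0 a, u t x = v t x) :
    (∀ t ∈ Ioo t₁ T, ∀ x ∈ Icc 0 a, ut t x = vt t x) ∧
    (∀ t ∈ Ioo t₁ T, ∀ x ∈ Icc 0 a, ux t x = vx t x) ∧
    (∀ t ∈ Ioo t₁ T, ∀ x ∈ Icc 0 a, uxx t x = vxx t x) := by
  have hud : UniqueDiffOn ℝ (Icc 0 a) := uniqueDiffOn_Icc ha
  have hx : ∀ t ∈ Ioo t₁ T, ∀ x ∈ Icc 0 a, ux t x = vx t x := fun t ht x hx =>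
    (hud x hx).eq_deriv _ (hu.deriv_x t ht x hx)
      ((hv.deriv_x t ht x hx).congr (huv t ht) (huv t ht x hx))
  refine ⟨fun t ht x hxm => ?_, hx, fun t ht x hxm => (hud x hxm).eq_deriv _
    (hu.deriv_xx t ht x hxm) ((hv.deriv_xx t ht x hxm).congr (hx t ht) (hx t ht x hxm))⟩
  refine (hu.deriv_t t ht x hxm).unique ((hv.deriv_t t ht x hxm).congr_of_eventuallyEq ?_)
  filter_upwards [isOpen_Ioo.mem_nhds ht] with s hs
  exact huv s hs x hxm

lemma ClassicalOn.mono {p a : ℝ} {I J : Set ℝ} {u ut ux uxx : ℝ → ℝ → ℝ}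
    (hu : ClassicalOn p a I u ut ux uxx) (h : J ⊆ I) : ClassicalOn p a J u ut ux uxx where
  cont := hu.cont.mono (prod_mono_left h)
  cont_t := hu.cont_t.mono (prod_mono_left h)
  cont_x := hu.cont_x.mono (prod_mono_left h)
  cont_xx := hu.cont_xx.mono (prod_mono_left h)
  deriv_t t ht := hu.deriv_t t (h ht)
  deriv_x t ht := hu.deriv_x t (h ht)
  deriv_xx t ht := hu.deriv_xx t (h ht)
  eqn t ht := hu.eqn t (h ht)
  nonneg t ht := hu.nonneg t (h ht)
  left t ht := hu.left t (h ht)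
  right t ht := hu.right t (h ht)

lemma mean_congr {a : ℝ} (ha : 0 < a) {φ ψ : ℝ → ℝ} (h : ∀ x ∈ Icc 0 a, φ x = ψ x) :
    mean a φ = mean a ψ := by
  unfold mean
  congr 1
  refine intervalIntegral.integral_congr fun x hx => h x ?_
  rwa [uIcc_of_le ha.le] at hx

/-- A solution on `[0, T)` that coincides on `(t₁, T)` with a classical solution on `(t₁, T')`
extends to a solution on `[0, T')`. -/
lemma IsSolution.glue {p a T t₁ T' : ℝ} {u₀ : ℝ → ℝ} {u v vt vx vxx : ℝ → ℝ → ℝ} (hp : 0 < p)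
    (ha : 0 < a) (hu : IsSolution p a u₀ T u) (h0 : 0 < t₁) (h1 : t₁ < T) (hT : T < T')
    (hv : ClassicalOn p a (Ioo t₁ T') v vt vx vxx)
    (huv : ∀ t ∈ Ioo t₁ T, ∀ x ∈ Icc 0 a, u t x = v t x) :
    IsSolution p a u₀ T' (NonlocalFlow.glue T u v) := by
  obtain ⟨ut, ux, uxx, hcl⟩ := hu.exists_classicalOn hp ha
  have hpos : ∀ R : ℝ, posTimes (R : EReal) = Ioi 0 ∩ Iio R := by
    intro R; ext t; simp [posTimes]
  have hslab : ∀ R : ℝ, slab a (R : EReal) = (Ici 0 ∩ Iio R) ×ˢ Icc 0 a := by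
    intro R; ext z; simp [slab, and_assoc]
  obtain ⟨ht, hx, hxx⟩ := (hcl.mono (J := Ioo t₁ T) (by
    rw [hpos]; exact fun t ht => ⟨h0.trans ht.1, ht.2⟩)).deriv_unique ha
      (hv.mono (Ioo_subset_Ioo le_rfl hT.le)) huv
  have hcont := hu.continuousOn
  have hc1 := hcl.cont_t
  have hc2 := hcl.cont_x
  have hc3 := hcl.cont_xx
  rw [hpos] at hc1 hc2 hc3
  rw [hslab] at hcont
  have hcase : ∀ t : ℝ, 0 < t → t < T' → t ∈ posTimes (T : EReal) ∧ t < T ∨ t ∈ Ioo t₁ T' := by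
    intro t ht0 htT'
    rcases lt_or_ge t T with h | h
    · exact Or.inl ⟨by rw [hpos]; exact ⟨ht0, h⟩, h⟩
    · exact Or.inr ⟨h1.trans_le h, htT'⟩
  refine ⟨by exact_mod_cast (h0.trans h1).trans hT, ?_, ?_, ?_, NonlocalFlow.glue T ut vt,
    NonlocalFlow.glue T ux vx, NonlocalFlow.glue T uxx vxx, ?_, ?_, ?_, ?_, ?_, ?_⟩
  · rw [hslab]; exact continuousOn_glue h1 hcont hv.cont huv
  · rintro t x ⟨ht0, htT', hxm⟩
    unfold NonlocalFlow.glue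
    split_ifs with h
    · exact hu.nonneg t x ⟨ht0, by exact_mod_cast h, hxm⟩
    · exact hv.nonneg t ⟨h1.trans_le (not_lt.1 h), by exact_mod_cast htT'⟩ x hxm
  · intro x hxm
    rw [glue_of_lt (h0.trans h1)]; exact hu.initial x hxm
  · rw [openSlab_eq, hpos]; exact continuousOn_glue h1 hc1 hv.cont_t ht
  · rw [openSlab_eq, hpos]; exact continuousOn_glue h1 hc2 hv.cont_x hx
  · rw [openSlab_eq, hpos]; exact continuousOn_glue h1 hc3 hv.cont_xx hxx
  · rintro t x ⟨ht0, htT', hxm⟩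
    rcases hcase t ht0 (by exact_mod_cast htT') with ⟨htp, htT⟩ | htv
    · rw [glue_of_lt htT, glue_of_lt htT, glue_of_lt htT]
      refine ⟨(hcl.deriv_t t htp x hxm).congr_of_eventuallyEq ?_, ?_, ?_⟩
      · filter_upwards [isOpen_Iio.mem_nhds htT] with s hs
        rw [glue_of_lt hs]
      · simpa only [glue_of_lt htT] using hcl.deriv_x t htp x hxm
      · simpa only [glue_of_lt htT] using hcl.deriv_xx t htp x hxm
    · rw [glue_eq_right ht htv hxm, glue_eq_right hx htv hxm, glue_eq_right hxx htv hxm]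
      refine ⟨(hv.deriv_t t htv x hxm).congr_of_eventuallyEq ?_, ?_, ?_⟩
      · filter_upwards [isOpen_Ioo.mem_nhds htv] with s hs
        exact glue_eq_right huv hs hxm
      · exact (hv.deriv_x t htv x hxm).congr (fun y hy => glue_eq_right huv htv hy)
          (glue_eq_right huv htv hxm)
      · exact (hv.deriv_xx t htv x hxm).congr (fun y hy => glue_eq_right hx htv hy)
          (glue_eq_right hx htv hxm)
  · intro t x ht0 htT' hxo
    have hxm := Ioo_subset_Icc_self hxo
    rcases hcase t ht0 (by exact_mod_cast htT') with ⟨htp, htT⟩ | htv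
    · simp only [glue_of_lt htT]
      exact hcl.eqn t htp x hxm
    · rw [glue_eq_right ht htv hxm, glue_eq_right huv htv hxm, glue_eq_right hxx htv hxm,
        mean_congr ha fun y hy => glue_eq_right huv htv hy]
      exact hv.eqn t htv x hxm
  · intro t ht0 htT'
    rcases hcase t ht0 (by exact_mod_cast htT') with ⟨htp, htT⟩ | htv
    · simp only [glue_of_lt htT]
      exact ⟨hcl.left t htp, hcl.right t htp⟩
    · rw [glue_eq_right hx htv ⟨le_rfl, ha.le⟩, glue_eq_right hx htv ⟨ha.le, le_rfl⟩]
      exact ⟨hv.left t htv, hv.right t htv⟩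

/-- A bounded positive solution on a bounded time interval extends beyond its final time. -/
theorem IsSolution.exists_extension {p a T : ℝ} {u₀ : ℝ → ℝ} {u : ℝ → ℝ → ℝ} (hp : 1 < p)
    (ha : 0 < a) (hu₀ : ∀ x ∈ Icc 0 a, 0 < u₀ x) (hu : IsSolution p a u₀ T u)
    (hb : IsBoundedOn a T u) :
    ∃ (T' : ℝ) (v : ℝ → ℝ → ℝ), T < T' ∧ IsSolution p a u₀ T' v ∧
      ∀ t x : ℝ, (t, x) ∈ slab a T → v t x = u t x := by
  have hT : 0 < T := by exact_mod_cast hu.time_pos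
  obtain ⟨C₀, hC₀⟩ := hb
  have hp0 : 0 < p := by linarith
  obtain ⟨ut, ux, uxx, hcl⟩ := hu.exists_classicalOn hp0 ha
  have hmemT : ∀ t : ℝ, 0 < t → t < T → t ∈ posTimes (T : EReal) := fun t h0 h1 =>
    ⟨h0, by exact_mod_cast h1⟩
  set M₀ := |C₀| + 1 with hM₀
  have hM₀pos : 0 < M₀ := by positivity
  have hbound : ∀ t : ℝ, 0 < t → t < T → ∀ x ∈ Icc 0 a, u t x < M₀ := by
    intro t h0 h1 x hx
    have := hC₀ t x ⟨h0.le, by exact_mod_cast h1, hx⟩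
    linarith [le_abs_self (u t x), le_abs_self C₀]
  set τ := M₀ / (2 * (2 * M₀) ^ p * (2 * M₀)) with hτ
  have hτ0 : 0 < τ := by positivity
  -- The grid lifetime `τ` depends only on the bound `M₀`, not on the lower bound of the datum, so
  -- restarting within `τ / 2` of `T` carries the flow beyond `T`.
  set t₀ := max (T / 2) (T - τ / 2) with ht₀
  have ht₀0 : 0 < t₀ := lt_max_of_lt_left (by positivity)
  have ht₀T : t₀ < T := max_lt (by linarith) (by linarith)
  have ht₀τ : T - t₀ ≤ τ / 2 := by linarith [le_max_right (T / 2) (T - τ / 2)]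
  have ht₀mem := hmemT t₀ ht₀0 ht₀T
  obtain ⟨x₁, hx₁, hmin⟩ := isCompact_Icc.exists_isMinOn (nonempty_Icc.2 ha.le)
    (continuousOn_slice hcl.cont ht₀mem)
  have hu1 : 0 < u t₀ x₁ := hu.pos hp ha hu₀ ht₀mem hx₁
  set m₀ := u t₀ x₁ / 2 with hm₀
  have hm₀pos : 0 < m₀ := by positivity
  have hm₀lt : ∀ x ∈ Icc 0 a, m₀ < u t₀ x := fun x hx => by
    have : u t₀ x₁ ≤ u t₀ x := hmin hx
    linarith
  obtain ⟨m, hm, hex⟩ := exists_gridFlow a hp hm₀pos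
    ((hm₀lt x₁ hx₁).trans (hbound t₀ ht₀0 ht₀T x₁ hx₁))
  choose U hU hU0 using fun n : ℕ => hex n (fun i => u t₀ (pt a n i))
    (fun i => hm₀lt _ (pt_mem ha i)) (fun i => hbound t₀ ht₀0 ht₀T _ (pt_mem ha i))
  rw [← hτ] at hU
  have hmM : m ≤ 2 * M₀ := ((hU 0).lower 0 ⟨le_rfl, hτ0.le⟩ 0).trans
    ((hU 0).upper 0 ⟨le_rfl, hτ0.le⟩ 0)
  obtain ⟨D, hD⟩ := isCompact_Icc.exists_bound_of_continuousOn
    (continuousOn_slice hcl.cont_xx ht₀mem)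
  have hD0 : 0 ≤ D := (norm_nonneg _).trans (hD 0 ⟨le_rfl, ha.le⟩)
  -- With `|u_xx| ≤ D` the oscillation is at most `2D`; the consistency estimate then gives an error
  -- `4D`, added to `D`.
  have hlap : ∀ (n : ℕ) (i : Fin (n + 1)), |lap (a / (n + 1)) (U n 0) i| ≤ 5 * D := by
    intro n i
    have h1 := abs_lap_sub_le ha (n := n) (hcl.deriv_x _ ht₀mem) (hcl.deriv_xx _ ht₀mem)
      (hcl.left _ ht₀mem) (hcl.right _ ht₀mem) (η := 2 * D) (by positivity)
      (fun x hx y hy _ => by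
        have e1 := abs_le.1 (hD x hx)
        have e2 := abs_le.1 (hD y hy)
        rw [abs_le]; constructor <;> linarith [e1.1, e1.2, e2.1, e2.2]) i
    have e1 := abs_le.1 (hD _ (pt_mem ha i))
    rw [hU0]
    rw [abs_le] at *
    constructor <;> linarith [e1.1, e1.2]
  -- The velocity bounds hold only from `ε` on; half of the remaining time leaves an overlap `(t₀ +
  -- ε, T)` with the given solution.
  set ε := (T - t₀) / 2 with hε
  have hε0 : 0 < ε := by rw [hε]; linarith
  obtain ⟨C, hC0, hC⟩ := exists_vel_holder_bound hp0 ha hm hmM hτ0.le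
    (by positivity : 0 ≤ 5 * D) hε0
  obtain ⟨v, vt, vx, vxx, hlim, hv1, hv2, hv3, hv4, hv5, hv6⟩ :=
    exists_limit_flow ha hm hmM hε0 hC0 hU (fun n => hC n (U n) (hU n) (hlap n))
  set T' := t₀ + τ with hT'
  set t₁ := t₀ + ε with ht₁
  have hTT' : T < T' := by linarith
  have ht₁T : t₁ < T := by rw [ht₁, hε]; linarith
  have hshift : ∀ t ∈ Ioo t₁ T', t - t₀ ∈ Icc ε τ := fun t ht =>
    ⟨by linarith [ht.1], by linarith [ht.2]⟩
  have hcomp : ∀ {f : ℝ → ℝ → ℝ}, ContinuousOn (fun z : ℝ × ℝ => f z.1 z.2) (Icc ε τ ×ˢ Icc 0 a) →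
      ContinuousOn (fun z : ℝ × ℝ => f (z.1 - t₀) z.2) (Ioo t₁ T' ×ˢ Icc 0 a) := fun hf =>
    hf.comp (f := fun z : ℝ × ℝ => (z.1 - t₀, z.2)) (by fun_prop)
      (fun z hz => ⟨hshift z.1 hz.1, hz.2⟩)
  have hV : ClassicalOn p a (Ioo t₁ T') (fun t => v (t - t₀)) (fun t => vt (t - t₀))
      (fun t => vx (t - t₀)) (fun t => vxx (t - t₀)) := by
    refine ⟨hcomp hv1, hcomp hv2, hcomp hv3, hcomp hv4, fun t ht x hx => ?_,
      fun t ht x hx => (hv5 _ (hshift t ht) x hx).2.2.1,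
      fun t ht x hx => (hv5 _ (hshift t ht) x hx).2.2.2.1,
      fun t ht x hx => (hv5 _ (hshift t ht) x hx).2.2.2.2,
      fun t ht x hx => hm.le.trans (hv5 _ (hshift t ht) x hx).1,
      fun t ht => (hv6 _ (hshift t ht)).1, fun t ht => (hv6 _ (hshift t ht)).2⟩
    have h1 := (hv5 _ (hshift t ht) x hx).2.1
    have h2 : HasDerivAt (fun s => v s x) (vt (t - t₀) x) (t - t₀) :=
      h1.hasDerivAt (Icc_mem_nhds (by linarith [ht.1]) (by linarith [ht.2]))
    exact h2.comp_sub_const t t₀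
  -- On the overlap both functions are limits of the same grid flows: `v` by construction, `u` by
  -- convergence of the scheme.
  have huv : ∀ t ∈ Ioo t₁ T, ∀ x ∈ Icc 0 a, u t x = v (t - t₀) x := by
    intro t ht x hx
    have ht' : t - t₀ ∈ Icc ε τ := hshift t ⟨ht.1, ht.2.trans hTT'⟩
    have htpos : 0 < t := by linarith [ht.1]
    have h1 := hlim _ ht' x hx
    have h2 : Filter.Tendsto (fun n => u t (pt a n (idx a n x))) (Filter.hyperfilter ℕ : Filter ℕ)
        (nhds (u t x)) :=
      ((continuousOn_slice hcl.cont (hmemT t htpos ht.2)) x hx).tendsto.comp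
        (tendsto_nhdsWithin_iff.2 ⟨(tendsto_pt_idx ha hx).mono_left hyperfilter_le_atTop,
          Filter.Eventually.of_forall fun n => pt_mem ha _⟩)
    have h3 : Filter.Tendsto (fun n => U n (t - t₀) (idx a n x) - u t (pt a n (idx a n x)))
        (Filter.hyperfilter ℕ : Filter ℕ) (nhds 0) := by
      rw [Metric.tendsto_nhds]
      intro η hη
      have h4 := hcl.eventually_abs_sub_gridFlow_le hp ha hm (t₀ := t₀) (t₁ := t)
        (by linarith [ht.1]) (fun r hr => hmemT r (by linarith [hr.1]) (by linarith [hr.2, ht.2]))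
        (by linarith [ht'.2]) (fun r hr x hx =>
          (hbound r (by linarith [hr.1]) (by linarith [hr.2, ht.2]) x hx).le.trans
            (by linarith : M₀ ≤ 2 * M₀)) hU
        (fun n i => by rw [hU0]) (η := η / 2) (by positivity)
      filter_upwards [hyperfilter_le_atTop h4] with n hn
      have h5 := hn (t - t₀) ⟨hε0.le.trans ht'.1, le_rfl⟩ (idx a n x)
      rw [add_sub_cancel] at h5
      rw [Real.dist_eq, sub_zero]
      linarith
    have h6 := h3.add h2
    simp only [sub_add_cancel, zero_add] at h6
    exact tendsto_nhds_unique h6 h1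
  refine ⟨T', NonlocalFlow.glue T u (fun t => v (t - t₀)), hTT',
    hu.glue hp0 ha (by linarith) ht₁T hTT' hV huv, ?_⟩
  rintro t x ⟨-, h, -⟩
  rw [glue_of_lt (by exact_mod_cast h)]

end NonlocalFlow

namespace NonlocalFlow

/-! ### Integrals depending on time -/

section Parametric

variable {a : ℝ} {I : Set ℝ}

lemma intervalIntegrable_of_Icc (ha : 0 < a) {φ : ℝ → ℝ} (hφ : ContinuousOn φ (Icc 0 a)) :
    IntervalIntegrable φ volume 0 a := by
  refine ContinuousOn.intervalIntegrable ?_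
  rwa [uIcc_of_le ha.le]

lemma aestronglyMeasurable_of_Icc (ha : 0 < a) {φ : ℝ → ℝ} (hφ : ContinuousOn φ (Icc 0 a)) :
    AEStronglyMeasurable φ (volume.restrict (Set.uIoc 0 a)) := by
  rw [uIoc_of_le ha.le]
  exact (hφ.mono Ioc_subset_Icc_self).aestronglyMeasurable measurableSet_Ioc

lemma mem_Icc_of_mem_uIoc (ha : 0 < a) {x : ℝ} (hx : x ∈ Set.uIoc 0 a) : x ∈ Icc 0 a := by
  rw [uIoc_of_le ha.le] at hx; exact ⟨hx.1.le, hx.2⟩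

lemma exists_local_bound (hI : IsOpen I) {F : ℝ → ℝ → ℝ}
    (hF : ContinuousOn (fun z : ℝ × ℝ => F z.1 z.2) (I ×ˢ Icc 0 a)) {t : ℝ} (ht : t ∈ I) :
    ∃ δ > 0, ∃ C, Metric.closedBall t δ ⊆ I ∧
      ∀ s ∈ Metric.closedBall t δ, ∀ x ∈ Icc 0 a, |F s x| ≤ C := by
  obtain ⟨δ, hδ, hsub⟩ := Metric.nhds_basis_closedBall.mem_iff.1 (hI.mem_nhds ht)
  obtain ⟨C, hC⟩ := ((isCompact_closedBall t δ).prod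
    (isCompact_Icc (a := 0) (b := a))).exists_bound_of_continuousOn (hF.mono (prod_mono_left hsub))
  exact ⟨δ, hδ, C, hsub, fun s hs x hx => hC (s, x) ⟨hs, hx⟩⟩

lemma hasDerivAt_integral (ha : 0 < a) (hI : IsOpen I) {F F' : ℝ → ℝ → ℝ}
    (hF : ContinuousOn (fun z : ℝ × ℝ => F z.1 z.2) (I ×ˢ Icc 0 a))
    (hF' : ContinuousOn (fun z : ℝ × ℝ => F' z.1 z.2) (I ×ˢ Icc 0 a))
    (hd : ∀ t ∈ I, ∀ x ∈ Icc 0 a, HasDerivAt (fun s => F s x) (F' t x) t) {t : ℝ} (ht : t ∈ I) :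
    HasDerivAt (fun s => ∫ x in (0 : ℝ)..a, F s x) (∫ x in (0 : ℝ)..a, F' t x) t := by
  obtain ⟨δ, hδ, C, hsub, hC⟩ := exists_local_bound hI hF' ht
  refine (intervalIntegral.hasDerivAt_integral_of_dominated_loc_of_deriv_le
    (s := Metric.closedBall t δ) (bound := fun _ => C) (Metric.closedBall_mem_nhds t hδ) ?_
    (intervalIntegrable_of_Icc ha (continuousOn_slice hF ht))
    (aestronglyMeasurable_of_Icc ha (continuousOn_slice hF' ht)) ?_ intervalIntegrable_const ?_).2
  · filter_upwards [hI.mem_nhds ht] with s hs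
    exact aestronglyMeasurable_of_Icc ha (continuousOn_slice hF hs)
  · exact Filter.Eventually.of_forall fun x hx s hs => hC s hs x (mem_Icc_of_mem_uIoc ha hx)
  · exact Filter.Eventually.of_forall fun x hx s hs =>
      hd s (hsub hs) x (mem_Icc_of_mem_uIoc ha hx)

/-- The derivative at `s = t` of `∫ (F s - F t) G s`, where `G` need not be differentiable. -/
lemma hasDerivAt_integral_sub_mul (ha : 0 < a) (hI : IsOpen I) {F F' G : ℝ → ℝ → ℝ}
    (hF : ContinuousOn (fun z : ℝ × ℝ => F z.1 z.2) (I ×ˢ Icc 0 a))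
    (hF' : ContinuousOn (fun z : ℝ × ℝ => F' z.1 z.2) (I ×ˢ Icc 0 a))
    (hG : ContinuousOn (fun z : ℝ × ℝ => G z.1 z.2) (I ×ˢ Icc 0 a))
    (hd : ∀ t ∈ I, ∀ x ∈ Icc 0 a, HasDerivAt (fun s => F s x) (F' t x) t) {t : ℝ} (ht : t ∈ I) :
    HasDerivAt (fun s => ∫ x in (0 : ℝ)..a, (F s x - F t x) * G s x)
      (∫ x in (0 : ℝ)..a, F' t x * G t x) t := by
  obtain ⟨δ, hδ, C, hsub, hC⟩ := exists_local_bound hI hF' ht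
  obtain ⟨δ', hδ', C', hsub', hC'⟩ := exists_local_bound hI hG ht
  rw [hasDerivAt_iff_tendsto_slope]
  have hslope : ∀ s, slope (fun s => ∫ x in (0 : ℝ)..a, (F s x - F t x) * G s x) t s
      = ∫ x in (0 : ℝ)..a, slope (fun r => F r x) t s * G s x := by
    intro s
    simp only [slope_def_field, sub_self, zero_mul, intervalIntegral.integral_zero, sub_zero]
    rw [div_eq_inv_mul, ← intervalIntegral.integral_const_mul]
    congr 1; funext x; ring
  rw [show slope (fun s => ∫ x in (0 : ℝ)..a, (F s x - F t x) * G s x) t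
      = fun s => ∫ x in (0 : ℝ)..a, slope (fun r => F r x) t s * G s x from funext hslope]
  have hnear : ∀ᶠ s in nhdsWithin t {t}ᶜ, s ∈ Metric.closedBall t δ ∧ s ∈ Metric.closedBall t δ' :=
    nhdsWithin_le_nhds (Filter.inter_mem (Metric.closedBall_mem_nhds t hδ)
      (Metric.closedBall_mem_nhds t hδ'))
  refine intervalIntegral.tendsto_integral_filter_of_dominated_convergence (fun _ => C * C')
    ?_ ?_ intervalIntegrable_const ?_
  · filter_upwards [hnear] with s hs
    refine aestronglyMeasurable_of_Icc ha ?_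
    simp only [slope_def_field]
    exact (((continuousOn_slice hF (hsub hs.1)).sub (continuousOn_slice hF ht)).div_const _).mul
      (continuousOn_slice hG (hsub hs.1))
  · filter_upwards [hnear, self_mem_nhdsWithin] with s hs hst
    refine Filter.Eventually.of_forall fun x hx => ?_
    have hx' := mem_Icc_of_mem_uIoc ha hx
    have h1 : |F s x - F t x| ≤ C * |s - t| :=
      (convex_closedBall t δ).norm_image_sub_le_of_norm_hasDerivWithin_le
        (f := fun r => F r x) (f' := fun r => F' r x)
        (fun r hr => (hd r (hsub hr) x hx').hasDerivWithinAt) (fun r hr => hC r hr x hx')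
        (Metric.mem_closedBall_self hδ.le) hs.1
    have hst' : 0 < |s - t| := abs_pos.2 (sub_ne_zero.2 hst)
    have hC0 : 0 ≤ C := (abs_nonneg _).trans (hC s hs.1 x hx')
    rw [norm_mul, slope_def_field, Real.norm_eq_abs, abs_div]
    refine mul_le_mul ?_ (hC' s hs.2 x hx') (norm_nonneg _) hC0
    rwa [div_le_iff₀ hst']
  · refine Filter.Eventually.of_forall fun x hx => ?_
    have hx' := mem_Icc_of_mem_uIoc ha hx
    have h1 := (hasDerivAt_iff_tendsto_slope.1 (hd t ht x hx'))
    have h2 : Filter.Tendsto (fun s => G s x) (nhdsWithin t {t}ᶜ) (nhds (G t x)) :=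
      ((continuousOn_slice_time hG hx').continuousAt (hI.mem_nhds ht)).tendsto.mono_left
        nhdsWithin_le_nhds
    exact h1.mul h2

lemma continuousOn_integral_of_Icc (ha : 0 < a) {s t : ℝ} {F : ℝ → ℝ → ℝ}
    (hF : ContinuousOn (fun z : ℝ × ℝ => F z.1 z.2) (Icc s t ×ˢ Icc 0 a)) :
    ContinuousOn (fun r => ∫ x in (0 : ℝ)..a, F r x) (Icc s t) := by
  obtain ⟨C, hC⟩ := (isCompact_Icc.prod isCompact_Icc).exists_bound_of_continuousOn hF
  intro r hr
  refine intervalIntegral.continuousWithinAt_of_dominated_interval (bound := fun _ => C) ?_ ?_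
    intervalIntegrable_const ?_
  · filter_upwards [self_mem_nhdsWithin] with q hq
    exact aestronglyMeasurable_of_Icc ha (continuousOn_slice hF hq)
  · filter_upwards [self_mem_nhdsWithin] with q hq
    exact Filter.Eventually.of_forall fun x hx => hC (q, x) ⟨hq, mem_Icc_of_mem_uIoc ha hx⟩
  · exact Filter.Eventually.of_forall fun x hx =>
      continuousOn_slice_time hF (mem_Icc_of_mem_uIoc ha hx) r hr

lemma integral_congr_Icc (ha : 0 < a) {φ ψ : ℝ → ℝ} (h : ∀ x ∈ Icc 0 a, φ x = ψ x) :
    ∫ x in (0 : ℝ)..a, φ x = ∫ x in (0 : ℝ)..a, ψ x := by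
  refine intervalIntegral.integral_congr fun x hx => h x ?_
  rwa [uIcc_of_le ha.le] at hx

lemma integral_eq_mul_mean (ha : 0 < a) (φ : ℝ → ℝ) : ∫ x in (0 : ℝ)..a, φ x = a * mean a φ := by
  unfold mean; field_simp

lemma integral_sub_mean_sq (ha : 0 < a) {φ : ℝ → ℝ} (hφ : ContinuousOn φ (Icc 0 a)) :
    ∫ x in (0 : ℝ)..a, (φ x - mean a φ) ^ 2 =
      (∫ x in (0 : ℝ)..a, φ x ^ 2) - a * mean a φ ^ 2 := by
  have h1 : ∀ x, (φ x - mean a φ) ^ 2 = φ x ^ 2 - 2 * mean a φ * φ x + mean a φ ^ 2 := by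
    intro x; ring
  simp only [h1]
  rw [intervalIntegral.integral_add, intervalIntegral.integral_sub,
    intervalIntegral.integral_const_mul, integral_eq_mul_mean ha φ, intervalIntegral.integral_const]
  · simp only [smul_eq_mul]; ring
  · exact intervalIntegrable_of_Icc ha (hφ.pow 2)
  · exact intervalIntegrable_of_Icc ha (hφ.const_mul _)
  · exact intervalIntegrable_of_Icc ha ((hφ.pow 2).sub (hφ.const_mul _))
  · exact intervalIntegrable_const

end Parametric

/-! ### Energy identities -/

/-- The real-valued energy along a classical solution. -/
def energyAt (a : ℝ) (u ux : ℝ → ℝ → ℝ) (t : ℝ) : ℝ :=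
  ∫ x in (0 : ℝ)..a, ((ux t x) ^ 2 - (u t x - mean a (u t)) ^ 2)

/-- The right hand side `u_xx + u - mean u` without the degenerate factor. -/
def force (a : ℝ) (u uxx : ℝ → ℝ → ℝ) (t x : ℝ) : ℝ := uxx t x + u t x - mean a (u t)

namespace ClassicalOn

variable {p a : ℝ} {I : Set ℝ} {u ut ux uxx : ℝ → ℝ → ℝ}

lemma continuousOn_mean (hu : ClassicalOn p a I u ut ux uxx) (ha : 0 < a) (hI : IsOpen I) :
    ContinuousOn (fun t => mean a (u t)) I := fun _ ht =>
  (((hasDerivAt_integral ha hI hu.cont hu.cont_t hu.deriv_t ht).const_mul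
    a⁻¹).continuousAt).continuousWithinAt

lemma continuousOn_force (hu : ClassicalOn p a I u ut ux uxx) (ha : 0 < a) (hI : IsOpen I) :
    ContinuousOn (fun z : ℝ × ℝ => force a u uxx z.1 z.2) (I ×ˢ Icc 0 a) :=
  (hu.cont_xx.add hu.cont).sub
    ((hu.continuousOn_mean ha hI).comp continuousOn_fst fun _ hz => hz.1)

lemma continuousOn_force_slice (hu : ClassicalOn p a I u ut ux uxx) {t : ℝ} (ht : t ∈ I) :
    ContinuousOn (force a u uxx t) (Icc 0 a) :=
  ((continuousOn_slice hu.cont_xx ht).add (continuousOn_slice hu.cont ht)).sub continuousOn_const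

lemma integral_mul_uxx (hu : ClassicalOn p a I u ut ux uxx) (ha : 0 < a) {s t : ℝ} (hs : s ∈ I)
    (ht : t ∈ I) : ∫ x in (0 : ℝ)..a, u s x * uxx t x = - ∫ x in (0 : ℝ)..a, ux s x * ux t x := by
  have h := intervalIntegral.integral_mul_deriv_eq_deriv_mul_of_hasDerivWithinAt
    (a := 0) (b := a) (u := u s) (v := ux t) (u' := ux s) (v' := uxx t)
    (by rw [uIcc_of_le ha.le]; exact hu.deriv_x s hs)
    (by rw [uIcc_of_le ha.le]; exact hu.deriv_xx t ht)
    (intervalIntegrable_of_Icc ha (continuousOn_slice hu.cont_x hs))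
    (intervalIntegrable_of_Icc ha (continuousOn_slice hu.cont_xx ht))
  rw [h, hu.left t ht, hu.right t ht]; ring

/-- The symmetric bilinear form behind the energy. -/
lemma integral_mul_force (hu : ClassicalOn p a I u ut ux uxx) (ha : 0 < a) {s t : ℝ} (hs : s ∈ I)
    (ht : t ∈ I) : ∫ x in (0 : ℝ)..a, u s x * force a u uxx t x =
      - (∫ x in (0 : ℝ)..a, ux s x * ux t x) + (∫ x in (0 : ℝ)..a, u s x * u t x)
        - a * mean a (u s) * mean a (u t) := by
  have hcs := continuousOn_slice hu.cont hs
  have hct := continuousOn_slice hu.cont ht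
  have hcxx := continuousOn_slice hu.cont_xx ht
  have h1 : ∀ x, u s x * force a u uxx t x =
      u s x * uxx t x + u s x * u t x - mean a (u t) * u s x := by
    intro x; unfold force; ring
  simp only [h1]
  rw [intervalIntegral.integral_sub, intervalIntegral.integral_add,
    intervalIntegral.integral_const_mul, hu.integral_mul_uxx ha hs ht, integral_eq_mul_mean ha (u s)]
  · ring
  · exact intervalIntegrable_of_Icc ha (hcs.mul hcxx)
  · exact intervalIntegrable_of_Icc ha (hcs.mul hct)
  · exact intervalIntegrable_of_Icc ha ((hcs.mul hcxx).add (hcs.mul hct))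
  · exact intervalIntegrable_of_Icc ha (hcs.const_mul _)

lemma energyAt_split (hu : ClassicalOn p a I u ut ux uxx) (ha : 0 < a) {t : ℝ} (ht : t ∈ I) :
    energyAt a u ux t =
      (∫ x in (0 : ℝ)..a, ux t x ^ 2) - ∫ x in (0 : ℝ)..a, (u t x - mean a (u t)) ^ 2 :=
  intervalIntegral.integral_sub
    (intervalIntegrable_of_Icc ha ((continuousOn_slice hu.cont_x ht).pow 2))
    (intervalIntegrable_of_Icc ha (((continuousOn_slice hu.cont ht).sub continuousOn_const).pow 2))

lemma energyAt_eq (hu : ClassicalOn p a I u ut ux uxx) (ha : 0 < a) {t : ℝ} (ht : t ∈ I) :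
    energyAt a u ux t = - ∫ x in (0 : ℝ)..a, u t x * force a u uxx t x := by
  rw [hu.energyAt_split ha ht, integral_sub_mean_sq ha (continuousOn_slice hu.cont ht),
    hu.integral_mul_force ha ht ht]
  simp only [sq]; ring

/-- The energy is minus the symmetric form B(u, u) = ∫ u F, so E(s) - E(t) = -∫ (u(s) - u(t)) (F(s)
+ F(t)). Only `u` is differentiated in time; no time derivative of `u_x` or `u_xx`, which need not
exist, enters. -/
lemma hasDerivAt_energyAt (hu : ClassicalOn p a I u ut ux uxx) (ha : 0 < a) (hI : IsOpen I) {t : ℝ}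
    (ht : t ∈ I) : HasDerivAt (energyAt a u ux)
      (-2 * ∫ x in (0 : ℝ)..a, ut t x * force a u uxx t x) t := by
  have hg := hu.continuousOn_force ha hI
  have hgt : ContinuousOn (fun z : ℝ × ℝ => force a u uxx t z.2) (I ×ˢ Icc 0 a) :=
    (hu.continuousOn_force_slice ht).comp continuousOn_snd fun _ hz => hz.2
  have h1 := hasDerivAt_integral_sub_mul ha hI (G := fun s x => force a u uxx s x
    + force a u uxx t x) hu.cont hu.cont_t (hg.add hgt) hu.deriv_t ht
  have h2 : ∀ s ∈ I, energyAt a u ux s = energyAt a u ux t -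
      ∫ x in (0 : ℝ)..a, (u s x - u t x) * (force a u uxx s x + force a u uxx t x) := by
    intro s hs
    have hus := continuousOn_slice hu.cont hs
    have hut := continuousOn_slice hu.cont ht
    have hgs := hu.continuousOn_force_slice hs
    have hgt := hu.continuousOn_force_slice ht
    have e1 : ∀ x, (u s x - u t x) * (force a u uxx s x + force a u uxx t x) =
      (u s x * force a u uxx s x - u t x * force a u uxx s x) +
        (u s x * force a u uxx t x - u t x * force a u uxx t x) := by intro x; ring
    have e2 : ∫ x in (0 : ℝ)..a, u t x * force a u uxx s x
        = ∫ x in (0 : ℝ)..a, u s x * force a u uxx t x := by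
      rw [hu.integral_mul_force ha ht hs, hu.integral_mul_force ha hs ht]
      simp only [mul_comm (ux t _), mul_comm (u t _)]; ring
    simp only [e1]
    rw [hu.energyAt_eq ha hs, hu.energyAt_eq ha ht, intervalIntegral.integral_add,
      intervalIntegral.integral_sub, intervalIntegral.integral_sub, e2]
    · ring
    all_goals apply intervalIntegrable_of_Icc ha
    · exact hus.mul hgt
    · exact hut.mul hgt
    · exact hus.mul hgs
    · exact hut.mul hgs
    · exact (hus.mul hgs).sub (hut.mul hgs)
    · exact (hus.mul hgt).sub (hut.mul hgt)
  have h3 := (h1.const_sub (energyAt a u ux t)).congr_of_eventuallyEq (f₁ := energyAt a u ux)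
    (by filter_upwards [hI.mem_nhds ht] with s hs using h2 s hs)
  refine h3.congr_deriv ?_
  rw [← intervalIntegral.integral_neg, ← intervalIntegral.integral_const_mul]
  congr 1; funext x; ring

lemma hasDerivAt_integral_comp (hu : ClassicalOn p a I u ut ux uxx) (ha : 0 < a) (hI : IsOpen I)
    (hpos : ∀ t ∈ I, ∀ x ∈ Icc 0 a, 0 < u t x) {Ψ ψ : ℝ → ℝ}
    (hΨ : ∀ s, 0 < s → HasDerivAt Ψ (ψ s) s) (hψ : ContinuousOn ψ (Ioi 0)) {t : ℝ} (ht : t ∈ I) :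
    HasDerivAt (fun s => ∫ x in (0 : ℝ)..a, Ψ (u s x)) (∫ x in (0 : ℝ)..a, ψ (u t x) * ut t x) t := by
  have hΨc : ContinuousOn Ψ (Ioi 0) := fun s hs => (hΨ s hs).continuousAt.continuousWithinAt
  refine hasDerivAt_integral ha hI (F := fun s x => Ψ (u s x))
    (F' := fun s x => ψ (u s x) * ut s x) ?_ ?_ ?_ ht
  · exact hΨc.comp hu.cont fun z hz => hpos z.1 hz.1 z.2 hz.2
  · exact (hψ.comp hu.cont fun z hz => hpos z.1 hz.1 z.2 hz.2).mul hu.cont_t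
  · intro s hs x hx
    exact (hΨ _ (hpos s hs x hx)).comp s (hu.deriv_t s hs x hx)

lemma rpow_mul_ut (hu : ClassicalOn p a I u ut ux uxx)
    (hpos : ∀ t ∈ I, ∀ x ∈ Icc 0 a, 0 < u t x) {t : ℝ} (ht : t ∈ I) {x : ℝ} (hx : x ∈ Icc 0 a)
    (q : ℝ) : u t x ^ q * ut t x = u t x ^ (q + p) * force a u uxx t x := by
  rw [hu.eqn t ht x hx, Real.rpow_add (hpos t ht x hx)]; unfold force; ring

lemma continuousOn_rpow_const (q : ℝ) : ContinuousOn (fun s : ℝ => s ^ q) (Ioi 0) := fun _ hs =>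
  (Real.continuousAt_rpow_const _ _ (Or.inl (ne_of_gt hs))).continuousWithinAt

/-- If `Ψ' = c s^(1-p)`, then `∫ Ψ(u)` has derivative `- c E`. -/
lemma hasDerivAt_integral_comp_energyAt (hu : ClassicalOn p a I u ut ux uxx) (ha : 0 < a)
    (hI : IsOpen I) (hpos : ∀ t ∈ I, ∀ x ∈ Icc 0 a, 0 < u t x) {Ψ : ℝ → ℝ} {c : ℝ}
    (hΨ : ∀ s, 0 < s → HasDerivAt Ψ (c * s ^ (1 - p)) s) {t : ℝ} (ht : t ∈ I) :
    HasDerivAt (fun s => ∫ x in (0 : ℝ)..a, Ψ (u s x)) (-(c * energyAt a u ux t)) t := by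
  refine (hu.hasDerivAt_integral_comp ha hI hpos hΨ
    ((continuousOn_rpow_const _).const_mul c) ht).congr_deriv ?_
  rw [hu.energyAt_eq ha ht, mul_neg, neg_neg, ← intervalIntegral.integral_const_mul]
  refine integral_congr_Icc ha fun x hx => ?_
  rw [mul_assoc, hu.rpow_mul_ut hpos ht hx]; simp

/-- Conservation of `∫ u^(1-p)`. -/
lemma hasDerivAt_integral_rpow_one_sub (hu : ClassicalOn p a I u ut ux uxx) (ha : 0 < a)
    (hI : IsOpen I) (hpos : ∀ t ∈ I, ∀ x ∈ Icc 0 a, 0 < u t x) {t : ℝ} (ht : t ∈ I) :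
    HasDerivAt (fun s => ∫ x in (0 : ℝ)..a, u s x ^ (1 - p)) 0 t := by
  refine (hu.hasDerivAt_integral_comp ha hI hpos (Ψ := fun s => s ^ (1 - p))
    (ψ := fun s => (1 - p) * s ^ (-p)) (fun s hs => ?_)
    ((continuousOn_rpow_const _).const_mul _) ht).congr_deriv ?_
  · have := Real.hasDerivAt_rpow_const (p := 1 - p) (Or.inl (ne_of_gt hs))
    rwa [show 1 - p - 1 = -p by ring] at this
  · have hct := continuousOn_slice hu.cont ht
    have hcxx := continuousOn_slice hu.cont_xx ht
    have e1 : ∫ x in (0 : ℝ)..a, uxx t x = 0 := by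
      have := intervalIntegral.integral_eq_sub_of_hasDerivAt_of_le ha.le
        (continuousOn_slice hu.cont_x ht) (f' := uxx t) (fun x hx =>
          (hu.deriv_xx t ht x (Ioo_subset_Icc_self hx)).hasDerivAt (Icc_mem_nhds hx.1 hx.2))
        (intervalIntegrable_of_Icc ha hcxx)
      rw [this, hu.left t ht, hu.right t ht, sub_zero]
    have e2 : ∫ x in (0 : ℝ)..a, force a u uxx t x = 0 := by
      unfold force
      rw [intervalIntegral.integral_sub, intervalIntegral.integral_add, e1,
        integral_eq_mul_mean ha (u t), intervalIntegral.integral_const]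
      · simp
      · exact intervalIntegrable_of_Icc ha hcxx
      · exact intervalIntegrable_of_Icc ha hct
      · exact intervalIntegrable_of_Icc ha (hcxx.add hct)
      · exact intervalIntegrable_const
    calc _ = ∫ x in (0 : ℝ)..a, (1 - p) * force a u uxx t x := by
          refine integral_congr_Icc ha fun x hx => ?_
          rw [mul_assoc, hu.rpow_mul_ut hpos ht hx]; simp
      _ = 0 := by rw [intervalIntegral.integral_const_mul, e2, mul_zero]

lemma integral_ut_mul_force_nonneg (hu : ClassicalOn p a I u ut ux uxx) (ha : 0 < a)
    {t : ℝ} (ht : t ∈ I) : 0 ≤ ∫ x in (0 : ℝ)..a, ut t x * force a u uxx t x := by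
  refine intervalIntegral.integral_nonneg ha.le fun x hx => ?_
  have h0 := hu.nonneg t ht x hx
  have : ut t x * force a u uxx t x = u t x ^ p * force a u uxx t x ^ 2 := by
    rw [hu.eqn t ht x hx]; unfold force; ring
  rw [this]; positivity

lemma energyAt_antitone (hu : ClassicalOn p a I u ut ux uxx) (ha : 0 < a) (hI : IsOpen I)
    {s t : ℝ} (hst : s ≤ t) (h : Icc s t ⊆ I) : energyAt a u ux t ≤ energyAt a u ux s :=
  le_of_hasDeriv_nonpos (α := s) (β := t)
    (fun _ hr => (hu.hasDerivAt_energyAt ha hI (h hr)).hasDerivWithinAt)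
    (fun r hr => by linarith [hu.integral_ut_mul_force_nonneg ha (h hr)]) le_rfl hst le_rfl

lemma integral_rpow_pos (hu : ClassicalOn p a I u ut ux uxx) (ha : 0 < a)
    (hpos : ∀ t ∈ I, ∀ x ∈ Icc 0 a, 0 < u t x) {t : ℝ} (ht : t ∈ I) (q : ℝ) :
    0 < ∫ x in (0 : ℝ)..a, u t x ^ q := by
  refine intervalIntegral.intervalIntegral_pos_of_pos_on (intervalIntegrable_of_Icc ha
    ((continuousOn_rpow_const q).comp (continuousOn_slice hu.cont ht) (hpos t ht))) ?_ ha
  intro x hx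
  have := hpos t ht x (Ioo_subset_Icc_self hx)
  positivity

/-- The Cauchy-Schwarz inequality `E² ≤ ∫ u^(2-p) · ∫ u^(-p) u_t²`. -/
lemma energyAt_sq_le (hu : ClassicalOn p a I u ut ux uxx) (ha : 0 < a)
    (hpos : ∀ t ∈ I, ∀ x ∈ Icc 0 a, 0 < u t x) {t : ℝ} (ht : t ∈ I) :
    energyAt a u ux t ^ 2 ≤ (∫ x in (0 : ℝ)..a, u t x ^ (2 - p)) *
      ∫ x in (0 : ℝ)..a, ut t x * force a u uxx t x := by
  have hct := continuousOn_slice hu.cont ht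
  have hg := hu.continuousOn_force_slice ht
  have hutc := continuousOn_slice hu.cont_t ht
  have hr : ContinuousOn (fun x => u t x ^ (2 - p)) (Icc 0 a) :=
    (continuousOn_rpow_const _).comp hct (hpos t ht)
  set y := ∫ x in (0 : ℝ)..a, u t x ^ (2 - p) with hy
  have hy0 : 0 < y := hu.integral_rpow_pos ha hpos ht _
  set W := ∫ x in (0 : ℝ)..a, ut t x * force a u uxx t x with hW
  set w := ∫ x in (0 : ℝ)..a, u t x * force a u uxx t x with hw
  rw [hu.energyAt_eq ha ht, neg_sq]
  -- The minimizer of the quadratic `W - 2 l w + l² y`, which is ∫ u^p (F - l u^(1-p))² and hence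
  -- nonnegative.
  set l := w / y with hl
  have h0 : 0 ≤ ∫ x in (0 : ℝ)..a, (ut t x * force a u uxx t x
      - 2 * l * (u t x * force a u uxx t x) + l ^ 2 * u t x ^ (2 - p)) := by
    refine intervalIntegral.integral_nonneg ha.le fun x hx => ?_
    have h0 := hpos t ht x hx
    have e1 : ut t x = u t x ^ p * force a u uxx t x := hu.eqn t ht x hx
    have e2 : u t x ^ p * u t x ^ (1 - p) = u t x := by
      rw [← Real.rpow_add h0]; simp
    have e3 : u t x ^ (2 - p) = u t x ^ p * (u t x ^ (1 - p)) ^ 2 := by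
      rw [sq, ← mul_assoc, e2]
      nth_rewrite 2 [← Real.rpow_one (u t x)]
      rw [← Real.rpow_add h0]; ring_nf
    have e5 : u t x * force a u uxx t x = u t x ^ p * u t x ^ (1 - p) * force a u uxx t x := by
      rw [e2]
    have e4 : ut t x * force a u uxx t x - 2 * l * (u t x * force a u uxx t x)
        + l ^ 2 * u t x ^ (2 - p)
        = u t x ^ p * (force a u uxx t x - l * u t x ^ (1 - p)) ^ 2 := by
      rw [e1, e3, e5]; ring
    rw [e4]; positivity
  rw [intervalIntegral.integral_add, intervalIntegral.integral_sub,
    intervalIntegral.integral_const_mul, intervalIntegral.integral_const_mul, ← hy, ← hW, ← hw] at h0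
  · have h1 : l * y = w := by rw [hl]; field_simp
    have h2 : 0 ≤ (W - 2 * l * w + l ^ 2 * y) * y := by positivity
    nlinarith
  · exact intervalIntegrable_of_Icc ha (hutc.mul hg)
  · exact intervalIntegrable_of_Icc ha ((hct.mul hg).const_mul _)
  · exact intervalIntegrable_of_Icc ha ((hutc.mul hg).sub ((hct.mul hg).const_mul _))
  · exact intervalIntegrable_of_Icc ha (hr.const_mul _)

end ClassicalOn

end NonlocalFlow

namespace NonlocalFlow

/-! ### The energy in terms of absolutely continuous functions -/

section AbsolutelyContinuous

variable {a : ℝ} {φ φ' : ℝ → ℝ}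

lemma absolutelyContinuousOnInterval_of_hasDerivWithinAt (ha : 0 < a)
    (hφ : ∀ x ∈ Icc 0 a, HasDerivWithinAt φ (φ' x) (Icc 0 a) x) (hφ' : ContinuousOn φ' (Icc 0 a)) :
    AbsolutelyContinuousOnInterval φ 0 a := by
  obtain ⟨C, hC⟩ := isCompact_Icc.exists_bound_of_continuousOn hφ'
  have h : LipschitzOnWith C.toNNReal φ (Icc 0 a) :=
    (convex_Icc 0 a).lipschitzOnWith_of_nnnorm_hasDerivWithin_le hφ fun x hx => by
      rw [← NNReal.coe_le_coe, coe_nnnorm]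
      exact (hC x hx).trans (Real.le_coe_toNNReal C)
  refine LipschitzOnWith.absolutelyContinuousOnInterval (K := C.toNNReal) ?_
  rwa [uIcc_of_le ha.le]

lemma deriv_eq_of_hasDerivWithinAt (hφ : ∀ x ∈ Icc 0 a, HasDerivWithinAt φ (φ' x) (Icc 0 a) x) {x : ℝ}
    (hx : x ∈ Ioo 0 a) : deriv φ x = φ' x :=
  ((hφ x (Ioo_subset_Icc_self hx)).hasDerivAt (Icc_mem_nhds hx.1 hx.2)).deriv

lemma integral_congr_Ioo (ha : 0 < a) {f g : ℝ → ℝ} (h : ∀ x ∈ Ioo 0 a, f x = g x) :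
    ∫ x in (0 : ℝ)..a, f x = ∫ x in (0 : ℝ)..a, g x := by
  rw [intervalIntegral.integral_of_le ha.le, intervalIntegral.integral_of_le ha.le,
    integral_Ioc_eq_integral_Ioo, integral_Ioc_eq_integral_Ioo]
  exact setIntegral_congr_fun measurableSet_Ioo h

lemma memH1_of_hasDerivWithinAt (ha : 0 < a)
    (hφ : ∀ x ∈ Icc 0 a, HasDerivWithinAt φ (φ' x) (Icc 0 a) x) (hφ' : ContinuousOn φ' (Icc 0 a)) :
    MemH1 a φ := by
  refine ⟨absolutelyContinuousOnInterval_of_hasDerivWithinAt ha hφ hφ', ?_⟩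
  obtain ⟨C, hC⟩ := isCompact_Icc.exists_bound_of_continuousOn hφ'
  have h : MemLp φ' 2 (volume.restrict (Ioo 0 a)) := by
    refine MemLp.of_bound ((hφ'.mono Ioo_subset_Icc_self).aestronglyMeasurable measurableSet_Ioo) C ?_
    filter_upwards [ae_restrict_mem measurableSet_Ioo] with x hx
    exact hC x (Ioo_subset_Icc_self hx)
  refine h.ae_eq ?_
  filter_upwards [ae_restrict_mem measurableSet_Ioo] with x hx
  exact (deriv_eq_of_hasDerivWithinAt hφ hx).symm

end AbsolutelyContinuous

lemma ClassicalOn.energy_eq {p a : ℝ} {I : Set ℝ} {u ut ux uxx : ℝ → ℝ → ℝ}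
    (hu : ClassicalOn p a I u ut ux uxx) (ha : 0 < a) {t : ℝ} (ht : t ∈ I) :
    energy a (u t) = (energyAt a u ux t : EReal) := by
  rw [energy, if_pos (memH1_of_hasDerivWithinAt ha (hu.deriv_x t ht) (continuousOn_slice hu.cont_x ht)),
    energyAt]
  congr 1
  refine integral_congr_Ioo ha fun x hx => ?_
  rw [deriv_eq_of_hasDerivWithinAt (hu.deriv_x t ht) hx]

/-! ### Global solutions have nonnegative energy -/

/-- If E < 0 at some time then E stays negative, and (y/E)' = ((p-2)E² + 2yW)/E² ≥ p by E² ≤ yW. So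
y/(-E) > 0 would decrease at rate at least p forever. -/
lemma ClassicalOn.energyAt_nonneg_of_global {p a : ℝ} {u ut ux uxx : ℝ → ℝ → ℝ} (hp : 0 < p)
    (hu : ClassicalOn p a (Ioi 0) u ut ux uxx) (ha : 0 < a)
    (hpos : ∀ t ∈ Ioi (0 : ℝ), ∀ x ∈ Icc 0 a, 0 < u t x) {t : ℝ} (ht : 0 < t) :
    0 ≤ energyAt a u ux t := by
  by_contra! hneg
  have hE : ∀ s, t ≤ s → energyAt a u ux s < 0 := fun s hs =>
    (hu.energyAt_antitone ha isOpen_Ioi hs fun r hr => ht.trans_le hr.1).trans_lt hneg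
  set y : ℝ → ℝ := fun s => ∫ x in (0 : ℝ)..a, u s x ^ (2 - p) with hy
  set W : ℝ → ℝ := fun s => ∫ x in (0 : ℝ)..a, ut s x * force a u uxx s x with hW
  have hyd : ∀ s, t ≤ s → HasDerivAt y (-((2 - p) * energyAt a u ux s)) s := fun s hs =>
    hu.hasDerivAt_integral_comp_energyAt ha isOpen_Ioi hpos (Ψ := fun r => r ^ (2 - p))
      (fun r hr => by
        have := Real.hasDerivAt_rpow_const (p := 2 - p) (Or.inl (ne_of_gt hr))
        rwa [show 2 - p - 1 = 1 - p by ring] at this) (ht.trans_le hs)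
  have hEd : ∀ s, t ≤ s → HasDerivAt (energyAt a u ux) (-2 * W s) s := fun s hs =>
    hu.hasDerivAt_energyAt ha isOpen_Ioi (ht.trans_le hs)
  have hy0 : ∀ s, t ≤ s → 0 < y s := fun s hs =>
    hu.integral_rpow_pos ha hpos (ht.trans_le hs) _
  have hcs : ∀ s, t ≤ s → energyAt a u ux s ^ 2 ≤ y s * W s := fun s hs =>
    hu.energyAt_sq_le ha hpos (ht.trans_le hs)
  have hq : ∀ s, t ≤ s → HasDerivAt (fun r => p * r - y r / energyAt a u ux r)
      (p * 1 - (-((2 - p) * energyAt a u ux s) * energyAt a u ux s - y s * (-2 * W s))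
        / energyAt a u ux s ^ 2) s := fun s hs =>
    ((hasDerivAt_id s).const_mul p).sub ((hyd s hs).div (hEd s hs) (hE s hs).ne)
  -- The time by which `y / (-E)`, decreasing at rate `p`, would have reached zero.
  set R : ℝ := t + (y t / (-energyAt a u ux t)) / p with hR
  have htR : t ≤ R := by
    have := hy0 t le_rfl
    have h2 : 0 < -energyAt a u ux t := by linarith
    have : 0 < (y t / (-energyAt a u ux t)) / p := by positivity
    linarith
  have hle := le_of_hasDeriv_nonpos (α := t) (β := R) (fun s hs => (hq s hs.1).hasDerivWithinAt)
    (fun s hs => by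
      have h1 := hcs s hs.1
      have h2 : 0 < energyAt a u ux s ^ 2 := by have := hE s hs.1; exact sq_pos_of_neg this
      rw [sub_nonpos, le_div_iff₀ h2]; nlinarith) le_rfl htR le_rfl
  have h1 : 0 < y R / (-energyAt a u ux R) := div_pos (hy0 R htR) (by linarith [hE R htR])
  rw [div_neg] at h1
  have h2 : p * R = p * t - y t / energyAt a u ux t := by
    rw [hR, div_neg]; field_simp
    ring
  linarith

/-! ### A primitive of `s ↦ s^(1-p)` -/

/-- A primitive of `s ↦ s^(1-p)` on `(0, ∞)` which dominates the logarithm. -/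
def primitive (p s : ℝ) : ℝ := if p = 2 then Real.log s else (s ^ (2 - p) - 1) / (2 - p)

lemma hasDerivAt_primitive (p : ℝ) {s : ℝ} (hs : 0 < s) :
    HasDerivAt (primitive p) (s ^ (1 - p)) s := by
  unfold primitive
  split_ifs with h
  · subst h
    have := Real.hasDerivAt_log hs.ne'
    rwa [show (1 : ℝ) - 2 = -1 by norm_num, Real.rpow_neg_one]
  · have h2 : 2 - p ≠ 0 := fun h' => h (by linarith)
    have := ((Real.hasDerivAt_rpow_const (p := 2 - p) (Or.inl hs.ne')).sub_const 1).div_const (2 - p)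
    rwa [show 2 - p - 1 = 1 - p by ring, mul_div_cancel_left₀ _ h2] at this

/-- For `p < 2` this is `log x ≤ x - 1` at `x = s^(2-p)`. The assumption `p ≤ 2` ensures that the
primitive is unbounded at infinity. -/
lemma log_le_primitive {p : ℝ} (hp : p ≤ 2) {s : ℝ} (hs : 0 < s) : Real.log s ≤ primitive p s := by
  unfold primitive
  split_ifs with h
  · rfl
  · have h2 : 0 < 2 - p := by
      rcases hp.lt_or_eq with h' | h'
      · linarith
      · exact absurd h' h
    rw [le_div_iff₀ h2, mul_comm, ← Real.log_rpow hs]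
    exact Real.log_le_sub_one_of_pos (Real.rpow_pos_of_pos hs _)

/-- The nonnegative function of `s`, vanishing at `s = c`, with derivative `s^(-p) (s - c)`. -/
def bregman (p s c : ℝ) : ℝ :=
  primitive p s - primitive p c + c * (s ^ (1 - p) - c ^ (1 - p)) / (p - 1)

lemma bregman_self (p c : ℝ) : bregman p c c = 0 := by simp [bregman]

lemma hasDerivAt_bregman {p : ℝ} (hp : 1 < p) (c : ℝ) {s : ℝ} (hs : 0 < s) :
    HasDerivAt (fun s => bregman p s c) (s ^ (-p) * (s - c)) s := by
  have h1 := (Real.hasDerivAt_rpow_const (p := 1 - p) (Or.inl hs.ne'))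
  have h2 := ((hasDerivAt_primitive p hs).sub_const (primitive p c)).add
    (((h1.sub_const (c ^ (1 - p))).const_mul c).div_const (p - 1))
  refine h2.congr_deriv ?_
  have h3 : s ^ (1 - p) = s ^ (-p) * s := by
    nth_rewrite 3 [← Real.rpow_one s]
    rw [← Real.rpow_add hs]; ring_nf
  have h4 : p - 1 ≠ 0 := by linarith
  rw [show 1 - p - 1 = -p by ring, h3]
  field_simp
  ring

/-- The derivative `s^(-p) (s - c)` has the sign of `s - c`, so `s = c`, where the function
vanishes, is the minimum. -/
lemma bregman_nonneg {p : ℝ} (hp : 1 < p) {s c : ℝ} (hs : 0 < s) (hc : 0 < c) :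
    0 ≤ bregman p s c := by
  rw [← bregman_self p c]
  rcases le_total c s with h | h
  · have := le_of_hasDeriv_nonpos (α := c) (β := s) (F := fun r => - bregman p r c)
      (fun r hr => (hasDerivAt_bregman hp c (hc.trans_le hr.1)).neg.hasDerivWithinAt)
      (fun r hr => by
        have h1 : 0 ≤ r - c := sub_nonneg.2 hr.1
        have h2 : 0 < r := hc.trans_le hr.1
        have : 0 ≤ r ^ (-p) * (r - c) := by positivity
        linarith) le_rfl h le_rfl
    simpa using this
  · exact le_of_hasDeriv_nonpos (α := s) (β := c) (F := fun r => bregman p r c)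
      (fun r hr => (hasDerivAt_bregman hp c (hs.trans_le hr.1)).hasDerivWithinAt)
      (fun r hr => by
        have h1 : 0 ≤ c - r := sub_nonneg.2 hr.2
        have h2 : 0 < r := hs.trans_le hr.1
        have : 0 ≤ r ^ (-p) * (c - r) := by positivity
        linarith) le_rfl h le_rfl

/-! ### Pointwise bounds from integral bounds -/

/-- The primitive may be negative for small `s`. Adding a multiple of the conserved density
`s^(1-p)`, which dominates `-log s`, makes it nonnegative while it still dominates `log s`. -/
lemma log_le_primitive_add {p : ℝ} (hp1 : 1 < p) (hp2 : p ≤ 2) {s : ℝ} (hs : 0 < s) :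
    0 ≤ primitive p s + s ^ (1 - p) / (p - 1) ∧
      Real.log s ≤ primitive p s + s ^ (1 - p) / (p - 1) := by
  have h1 := log_le_primitive hp2 hs
  have h0 : 0 < p - 1 := by linarith
  have h2 : 0 < s ^ (1 - p) := Real.rpow_pos_of_pos hs _
  have h3 : - Real.log s ≤ s ^ (1 - p) / (p - 1) := by
    rw [le_div_iff₀ h0]
    have := Real.log_le_sub_one_of_pos h2
    rw [Real.log_rpow hs] at this
    linarith
  have h4 : 0 < s ^ (1 - p) / (p - 1) := by positivity
  constructor <;> linarith

lemma abs_sub_le_integral_abs_deriv {a : ℝ} (ha : 0 < a) {φ φ' : ℝ → ℝ}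
    (hφ : ∀ x ∈ Icc 0 a, HasDerivWithinAt φ (φ' x) (Icc 0 a) x) (hφ' : ContinuousOn φ' (Icc 0 a))
    {x y : ℝ} (hx : x ∈ Icc 0 a) (hy : y ∈ Icc 0 a) :
    |φ y - φ x| ≤ ∫ z in (0 : ℝ)..a, |φ' z| := by
  have hsub : uIcc x y ⊆ Icc 0 a := by
    rw [← uIcc_of_le ha.le] at hx hy ⊢; exact uIcc_subset_uIcc hx hy
  have h := intervalIntegral.integral_eq_sub_of_hasDeriv_right (a := x) (b := y) (f := φ) (f' := φ')
    (fun z hz => ((hφ z (hsub hz)).continuousWithinAt).mono hsub)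
    (fun z hz => by
      have h1 : 0 < z := lt_of_le_of_lt (le_min hx.1 hy.1) hz.1
      have h2 : z < a := lt_of_lt_of_le hz.2 (max_le hx.2 hy.2)
      exact ((hφ z ⟨h1.le, h2.le⟩).hasDerivAt (Icc_mem_nhds h1 h2)).hasDerivWithinAt)
    ((hφ'.mono hsub).intervalIntegrable)
  rw [← h, intervalIntegral.integral_of_le ha.le, ← Real.norm_eq_abs]
  refine (intervalIntegral.norm_integral_le_integral_norm_uIoc).trans ?_
  have hi : IntegrableOn (fun z => |φ' z|) (Ioc 0 a) := by
    have := (intervalIntegrable_of_Icc ha hφ'.abs).1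
    exact this
  refine setIntegral_mono_set hi (Filter.Eventually.of_forall fun z => abs_nonneg _) ?_
  refine Filter.Eventually.of_forall fun z (hz : z ∈ uIoc x y) => ?_
  exact ⟨lt_of_le_of_lt (le_min hx.1 hy.1) hz.1, hz.2.trans (max_le hx.2 hy.2)⟩

/-- Integral bounds on the conserved quantity, on a primitive and on the energy bound a positive
function from above. -/
lemma exists_bound_of_energy_le {p a : ℝ} (hp1 : 1 < p) (hp2 : p ≤ 2) (ha : 0 < a) {c C E : ℝ}
    (hc : 0 < c) : ∃ B, ∀ φ φ' : ℝ → ℝ, (∀ x ∈ Icc 0 a, 0 < φ x) →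
      (∀ x ∈ Icc 0 a, HasDerivWithinAt φ (φ' x) (Icc 0 a) x) → ContinuousOn φ' (Icc 0 a) →
      (∫ x in (0 : ℝ)..a, φ x ^ (1 - p)) = c → (∫ x in (0 : ℝ)..a, primitive p (φ x)) ≤ C →
      (∫ x in (0 : ℝ)..a, φ' x ^ 2) ≤ E + ∫ x in (0 : ℝ)..a, φ x ^ 2 →
      ∀ x ∈ Icc 0 a, φ x ≤ B := by
  set A : ℝ := (c / a) ^ (1 / (1 - p)) with hA
  set D : ℝ := C + c / (p - 1) with hD
  -- Chosen so that `a |D| / L ≤ 1/2`. Above the level `K = exp L` the logarithm exceeds `L`, hence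
  -- `φ² ≤ M² ≤ (M² / L) log φ` there, and this part of `∫ φ²` contributes only a small multiple of
  -- `M²`.
  set L : ℝ := 2 * a * |D| + 1 with hL
  have hL0 : 0 < L := by positivity
  set K : ℝ := Real.exp L with hK
  refine ⟨max 1 (4 * A + 2 * a * (|E| + a * K ^ 2)), fun φ φ' hpos hd hd' hc' hC hE => ?_⟩
  have hφ : ContinuousOn φ (Icc 0 a) := fun x hx => (hd x hx).continuousWithinAt
  have hne : (Icc 0 a).Nonempty := ⟨0, le_rfl, ha.le⟩
  obtain ⟨x₀, hx₀, hmin⟩ := isCompact_Icc.exists_isMinOn hne hφ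
  obtain ⟨x₁, hx₁, hmax⟩ := isCompact_Icc.exists_isMaxOn hne hφ
  set M := φ x₁ with hM
  suffices M ≤ max 1 (4 * A + 2 * a * (|E| + a * K ^ 2)) from fun x hx => (hmax hx).trans this
  rcases le_or_gt M 1 with hM1 | hM1
  · exact le_max_of_le_left hM1
  refine le_max_of_le_right ?_
  have hr : ∀ q : ℝ, ContinuousOn (fun x => φ x ^ q) (Icc 0 a) := fun q =>
    (ClassicalOn.continuousOn_rpow_const q).comp hφ hpos
  have hprim : ContinuousOn (fun x => primitive p (φ x)) (Icc 0 a) :=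
    ContinuousOn.comp (t := Ioi 0)
      (fun s hs => (hasDerivAt_primitive p hs).continuousAt.continuousWithinAt) hφ hpos
  -- As `1 - p < 0`, the conserved integral is at most `a (min φ)^(1-p)`, which bounds the minimum
  -- from above.
  have hmA : φ x₀ ≤ A := by
    have h1 : c ≤ a * φ x₀ ^ (1 - p) := by
      rw [← hc']
      calc _ ≤ ∫ x in (0 : ℝ)..a, φ x₀ ^ (1 - p) := by
            refine intervalIntegral.integral_mono_on ha.le (intervalIntegrable_of_Icc ha (hr _))
              intervalIntegrable_const fun x hx => ?_
            exact Real.rpow_le_rpow_of_nonpos (hpos _ hx₀) (hmin hx) (by linarith)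
        _ = _ := by simp
    have h2 : c / a ≤ φ x₀ ^ (1 - p) := by rwa [div_le_iff₀' ha]
    have h3 := Real.rpow_le_rpow_of_nonpos (z := 1 / (1 - p)) (by positivity) h2
      (div_nonpos_of_nonneg_of_nonpos zero_le_one (by linarith))
    rwa [← Real.rpow_mul (hpos _ hx₀).le, mul_one_div_cancel (by linarith), Real.rpow_one] at h3
  have hP : ∫ x in (0 : ℝ)..a, (primitive p (φ x) + φ x ^ (1 - p) / (p - 1)) ≤ D := by
    rw [intervalIntegral.integral_add (intervalIntegrable_of_Icc ha hprim)
      (intervalIntegrable_of_Icc ha ((hr _).div_const _)), intervalIntegral.integral_div, hc', hD]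
    linarith
  have hPc : ContinuousOn (fun x => primitive p (φ x) + φ x ^ (1 - p) / (p - 1)) (Icc 0 a) :=
    hprim.add ((hr _).div_const _)
  have hsq : ∫ x in (0 : ℝ)..a, φ x ^ 2 ≤ a * K ^ 2 + M ^ 2 / L * D := by
    calc _ ≤ ∫ x in (0 : ℝ)..a,
          (K ^ 2 + M ^ 2 / L * (primitive p (φ x) + φ x ^ (1 - p) / (p - 1))) := by
          refine intervalIntegral.integral_mono_on ha.le (intervalIntegrable_of_Icc ha (hφ.pow 2))
            (intervalIntegrable_of_Icc ha (continuousOn_const.add (hPc.const_mul _))) fun x hx => ?_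
          have h0 := hpos x hx
          obtain ⟨h1, h2⟩ := log_le_primitive_add hp1 hp2 h0
          rcases le_or_gt (φ x) K with hxK | hxK
          · have : φ x ^ 2 ≤ K ^ 2 := by gcongr
            have : 0 ≤ M ^ 2 / L * (primitive p (φ x) + φ x ^ (1 - p) / (p - 1)) := by positivity
            linarith
          · have h3 : L ≤ Real.log (φ x) := by
              rw [Real.le_log_iff_exp_le h0]; exact hxK.le
            have h4 : φ x ^ 2 ≤ M ^ 2 := by
              have : φ x ≤ M := hmax hx
              gcongr
            have h5 : M ^ 2 / L * L ≤ M ^ 2 / L * (primitive p (φ x) + φ x ^ (1 - p) / (p - 1)) := by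
              gcongr; linarith
            rw [div_mul_cancel₀ _ hL0.ne'] at h5
            have : 0 ≤ K ^ 2 := sq_nonneg _
            linarith
      _ = a * K ^ 2 + M ^ 2 / L *
          ∫ x in (0 : ℝ)..a, (primitive p (φ x) + φ x ^ (1 - p) / (p - 1)) := by
          rw [intervalIntegral.integral_add intervalIntegrable_const
            (intervalIntegrable_of_Icc ha (hPc.const_mul _)), intervalIntegral.integral_const_mul]
          simp
      _ ≤ _ := by gcongr
  have hosc : M - φ x₀ ≤ ∫ z in (0 : ℝ)..a, |φ' z| :=
    (le_abs_self _).trans (abs_sub_le_integral_abs_deriv ha hd hd' hx₀ hx₁)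
  have hM0 : 0 < M := by linarith
  -- Young's inequality weighted by the maximum `M`. Together with `hJ` it gives `M - A ≤ M/2 + M/4`
  -- plus a constant, whence the factor 4 in the final bound.
  have hyoung : ∫ z in (0 : ℝ)..a, |φ' z| ≤ M / 2 + a / (2 * M) * ∫ z in (0 : ℝ)..a, φ' z ^ 2 := by
    calc _ ≤ ∫ z in (0 : ℝ)..a, (M / (2 * a) + a / (2 * M) * φ' z ^ 2) := by
          refine intervalIntegral.integral_mono_on ha.le (intervalIntegrable_of_Icc ha hd'.abs)
            (intervalIntegrable_of_Icc ha (continuousOn_const.add ((hd'.pow 2).const_mul _)))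
            fun z _ => ?_
          have h1 : M / (2 * a) + a / (2 * M) * φ' z ^ 2 - |φ' z| =
              (M - a * |φ' z|) ^ 2 / (2 * a * M) := by
            rw [← sq_abs (φ' z)]; field_simp; ring
          have h2 : 0 ≤ (M - a * |φ' z|) ^ 2 / (2 * a * M) := by positivity
          linarith
      _ = _ := by
          rw [intervalIntegral.integral_add intervalIntegrable_const
            (intervalIntegrable_of_Icc ha (ContinuousOn.const_mul (hd'.pow 2) _) :
              IntervalIntegrable (fun z => a / (2 * M) * φ' z ^ 2) volume 0 a),
            intervalIntegral.integral_const_mul]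
          simp only [intervalIntegral.integral_const, sub_zero, smul_eq_mul]
          congr 1; field_simp
  have hJ : a / (2 * M) * ∫ z in (0 : ℝ)..a, φ' z ^ 2 ≤
      a / 2 * (|E| + a * K ^ 2) + M / 4 := by
    have h1 : ∫ z in (0 : ℝ)..a, φ' z ^ 2 ≤ |E| + a * K ^ 2 + M ^ 2 / L * |D| := by
      have : M ^ 2 / L * D ≤ M ^ 2 / L * |D| := by gcongr; exact le_abs_self D
      linarith [le_abs_self E]
    have h2 : a * |D| / L ≤ 1 / 2 := by rw [div_le_iff₀ hL0, hL]; linarith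
    have h3 : 0 ≤ |E| + a * K ^ 2 := by positivity
    calc _ ≤ a / (2 * M) * (|E| + a * K ^ 2 + M ^ 2 / L * |D|) := by gcongr
      _ = a / 2 * (|E| + a * K ^ 2) * (1 / M) + M / 2 * (a * |D| / L) := by field_simp
      _ ≤ a / 2 * (|E| + a * K ^ 2) * 1 + M / 2 * (1 / 2) := by
          gcongr
          rw [div_le_one hM0]; exact hM1.le
      _ = _ := by ring
  linarith
end NonlocalFlow

namespace NonlocalFlow

/-! ### Initial data with negative energy -/

/-- The convexity inequality for the Dirichlet integral with Neumann boundary conditions. -/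
lemma ClassicalOn.integral_ux_sq_le {p a : ℝ} {I : Set ℝ} {u ut ux uxx : ℝ → ℝ → ℝ}
    (hu : ClassicalOn p a I u ut ux uxx) (ha : 0 < a) {t : ℝ} (ht : t ∈ I) {φ : ℝ → ℝ}
    (hφ : ContinuousOn φ (Icc 0 a)) (hH : MemH1 a φ) :
    ∫ x in (0 : ℝ)..a, ux t x ^ 2 ≤ (∫ x in (0 : ℝ)..a, deriv φ x ^ 2)
      - 2 * ∫ x in (0 : ℝ)..a, (u t x - φ x) * uxx t x := by
  have hcx := continuousOn_slice hu.cont_x ht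
  have hcxx := continuousOn_slice hu.cont_xx ht
  have hct := continuousOn_slice hu.cont ht
  have hii : ∀ f : ℝ → ℝ, IntegrableOn f (Ioo 0 a) → IntervalIntegrable f volume 0 a := fun f hf =>
    (intervalIntegrable_iff_integrableOn_Ioo_of_le ha.le).2 hf
  have hsq : IntervalIntegrable (fun x => deriv φ x ^ 2) volume 0 a := hii _ hH.2.integrable_sq
  have hd : IntervalIntegrable (deriv φ) volume 0 a := hii _ (hH.2.integrable one_le_two)
  have hdx : IntervalIntegrable (fun x => deriv φ x * ux t x) volume 0 a :=
    hd.mul_continuousOn (by rwa [uIcc_of_le ha.le])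
  have h1 : ∫ x in (0 : ℝ)..a, φ x * uxx t x = - ∫ x in (0 : ℝ)..a, deriv φ x * ux t x := by
    have h := hH.1.integral_mul_deriv_eq_deriv_mul
      (absolutelyContinuousOnInterval_of_hasDerivWithinAt ha (hu.deriv_xx t ht) hcxx)
    rw [hu.left t ht, hu.right t ht] at h
    have e : ∫ x in (0 : ℝ)..a, φ x * uxx t x = ∫ x in (0 : ℝ)..a, φ x * deriv (ux t) x :=
      integral_congr_Ioo ha fun x hx => by rw [deriv_eq_of_hasDerivWithinAt (hu.deriv_xx t ht) hx]
    rw [e, h]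
    ring
  have h2 : ∫ x in (0 : ℝ)..a, (u t x - φ x) * uxx t x =
      - (∫ x in (0 : ℝ)..a, ux t x ^ 2) + ∫ x in (0 : ℝ)..a, deriv φ x * ux t x := by
    simp only [sub_mul]
    rw [intervalIntegral.integral_sub, h1, hu.integral_mul_uxx ha ht ht]
    · simp only [sq]; ring
    · exact intervalIntegrable_of_Icc ha (hct.mul hcxx)
    · exact intervalIntegrable_of_Icc ha (hφ.mul hcxx)
  have h3 : 0 ≤ (∫ x in (0 : ℝ)..a, deriv φ x ^ 2) - 2 * (∫ x in (0 : ℝ)..a, deriv φ x * ux t x)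
      + ∫ x in (0 : ℝ)..a, ux t x ^ 2 := by
    have hx2 : IntervalIntegrable (fun x => ux t x ^ 2) volume 0 a :=
      intervalIntegrable_of_Icc ha (hcx.pow 2)
    rw [← intervalIntegral.integral_const_mul, ← intervalIntegral.integral_sub hsq
      (hdx.const_mul 2), ← intervalIntegral.integral_add (hsq.sub (hdx.const_mul 2)) hx2]
    refine intervalIntegral.integral_nonneg ha.le fun x _ => ?_
    have : deriv φ x ^ 2 - 2 * (deriv φ x * ux t x) + ux t x ^ 2 = (deriv φ x - ux t x) ^ 2 := by
      ring
    rw [this]; positivity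
  linarith

/-- Expansion of the quadratic energy about a comparison function `φ` that is only in `H¹`. The
Dirichlet part is convex, and `u_xx` is expressed through `u^(-p) u_t` by the equation; the
discarded term is `-a (ū - φ̄)²`. -/
lemma ClassicalOn.energyAt_le {p a : ℝ} {I : Set ℝ} {u ut ux uxx : ℝ → ℝ → ℝ}
    (hu : ClassicalOn p a I u ut ux uxx) (ha : 0 < a)
    (hpos : ∀ t ∈ I, ∀ x ∈ Icc 0 a, 0 < u t x) {t : ℝ} (ht : t ∈ I) {φ : ℝ → ℝ}
    (hφ : ContinuousOn φ (Icc 0 a)) (hH : MemH1 a φ) :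
    energyAt a u ux t ≤ (∫ x in (0 : ℝ)..a, (deriv φ x ^ 2 - (φ x - mean a φ) ^ 2))
      - 2 * (∫ x in (0 : ℝ)..a, u t x ^ (-p) * (u t x - φ x) * ut t x)
      + ∫ x in (0 : ℝ)..a, (u t x - φ x) ^ 2 := by
  have hct := continuousOn_slice hu.cont ht
  have hcxx := continuousOn_slice hu.cont_xx ht
  have hutc := continuousOn_slice hu.cont_t ht
  have hrp : ContinuousOn (fun x => u t x ^ (-p)) (Icc 0 a) :=
    (continuousOn_rpow_const _).comp hct (hpos t ht)
  have hsq : IntervalIntegrable (fun x => deriv φ x ^ 2) volume 0 a :=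
    (intervalIntegrable_iff_integrableOn_Ioo_of_le ha.le).2 hH.2.integrable_sq
  have h1 := hu.integral_ux_sq_le ha ht hφ hH
  have h2 : ∫ x in (0 : ℝ)..a, (u t x - φ x) * uxx t x =
      (∫ x in (0 : ℝ)..a, u t x ^ (-p) * (u t x - φ x) * ut t x)
        - ∫ x in (0 : ℝ)..a, (u t x - φ x) * (u t x - mean a (u t)) := by
    rw [← intervalIntegral.integral_sub]
    · refine integral_congr_Icc ha fun x hx => ?_
      have e := hu.rpow_mul_ut hpos ht hx (-p)
      rw [neg_add_cancel, Real.rpow_zero, one_mul, force] at e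
      linear_combination -(u t x - φ x) * e
    · exact intervalIntegrable_of_Icc ha ((hrp.mul (hct.sub hφ)).mul hutc)
    · exact intervalIntegrable_of_Icc ha ((hct.sub hφ).mul (hct.sub continuousOn_const))
  have h3 : (∫ x in (0 : ℝ)..a, (deriv φ x ^ 2 - (φ x - mean a φ) ^ 2)) =
      (∫ x in (0 : ℝ)..a, deriv φ x ^ 2) - ∫ x in (0 : ℝ)..a, (φ x - mean a φ) ^ 2 :=
    intervalIntegral.integral_sub hsq
      (intervalIntegrable_of_Icc ha ((hφ.sub continuousOn_const).pow 2))
  have h4 : ∫ x in (0 : ℝ)..a, (u t x - φ x) * (u t x - mean a (u t)) =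
      (∫ x in (0 : ℝ)..a, u t x ^ 2) - (∫ x in (0 : ℝ)..a, φ x * u t x)
        - mean a (u t) * (a * mean a (u t) - a * mean a φ) := by
    have e : ∀ x, (u t x - φ x) * (u t x - mean a (u t)) =
        (u t x ^ 2 - φ x * u t x) - mean a (u t) * (u t x - φ x) := fun x => by ring
    simp only [e]
    rw [intervalIntegral.integral_sub, intervalIntegral.integral_sub,
      intervalIntegral.integral_const_mul, intervalIntegral.integral_sub,
      integral_eq_mul_mean ha (u t), integral_eq_mul_mean ha φ]
    all_goals apply intervalIntegrable_of_Icc ha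
    exacts [hct, hφ, hct.pow 2, hφ.mul hct, (hct.pow 2).sub (hφ.mul hct), (hct.sub hφ).const_mul _]
  have h5 : ∫ x in (0 : ℝ)..a, (u t x - φ x) ^ 2 = (∫ x in (0 : ℝ)..a, u t x ^ 2)
      - 2 * (∫ x in (0 : ℝ)..a, φ x * u t x) + ∫ x in (0 : ℝ)..a, φ x ^ 2 := by
    have e : ∀ x, (u t x - φ x) ^ 2 = (u t x ^ 2 - 2 * (φ x * u t x)) + φ x ^ 2 := fun x => by ring
    simp only [e]
    rw [intervalIntegral.integral_add, intervalIntegral.integral_sub,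
      intervalIntegral.integral_const_mul]
    all_goals apply intervalIntegrable_of_Icc ha
    exacts [hct.pow 2, (hφ.mul hct).const_mul _, (hct.pow 2).sub ((hφ.mul hct).const_mul _),
      hφ.pow 2]
  rw [hu.energyAt_split ha ht, integral_sub_mean_sq ha hct, h5, h3, integral_sub_mean_sq ha hφ]
  rw [h2, h4] at h1
  nlinarith [mul_nonneg ha.le (sq_nonneg (mean a (u t) - mean a φ))]

/-- Continuity of the energy at time 0 is not available. In `energyAt_le` with `φ = u 0`, the term
with `u_t` is the derivative of ∫ bregman(u(t), u(0)), a functional that vanishes at 0 and is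
nonnegative afterwards. So that derivative is nonnegative at arbitrarily small times, and there E(t)
≤ E(0) + ∫ (u(t) - u(0))², which is negative. -/
lemma IsSolution.exists_energyAt_neg {p a : ℝ} {u₀ : ℝ → ℝ} {T : EReal} {u ut ux uxx : ℝ → ℝ → ℝ}
    (hp : 1 < p) (ha : 0 < a) (hu₀ : ∀ x ∈ Icc 0 a, 0 < u₀ x) (hu : IsSolution p a u₀ T u)
    (hcl : ClassicalOn p a (posTimes T) u ut ux uxx) (hneg : energy a (u 0) < 0) :
    ∃ t ∈ posTimes T, energyAt a u ux t < 0 := by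
  have hH : MemH1 a (u 0) := by
    by_contra h
    rw [energy, if_neg h] at hneg
    exact absurd hneg (by simp)
  rw [energy, if_pos hH] at hneg
  set E₀ := ∫ x in (0 : ℝ)..a, ((deriv (u 0) x) ^ 2 - (u 0 x - mean a (u 0)) ^ 2) with hE₀
  have hneg' : E₀ < 0 := by exact_mod_cast hneg
  obtain ⟨T₁, hT₁, -⟩ := exists_mem_posTimes_lt hu.time_pos one_pos
  have hslab : Icc 0 T₁ ×ˢ Icc 0 a ⊆ slab a T := fun z hz =>
    ⟨hz.1.1, lt_of_le_of_lt (EReal.coe_le_coe_iff.2 hz.1.2) hT₁.2, hz.2⟩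
  have hc : ContinuousOn (fun z : ℝ × ℝ => u z.1 z.2) (Icc 0 T₁ ×ˢ Icc 0 a) :=
    hu.continuousOn.mono hslab
  have h0T : (0 : ℝ) ∈ Icc 0 T₁ := ⟨le_rfl, hT₁.1.le⟩
  have hφ : ContinuousOn (u 0) (Icc 0 a) := continuousOn_slice hc h0T
  have hφ' : ContinuousOn (fun z : ℝ × ℝ => u 0 z.2) (Icc 0 T₁ ×ˢ Icc 0 a) :=
    hφ.comp continuousOn_snd fun _ hz => hz.2
  have hφpos : ∀ x ∈ Icc 0 a, 0 < u 0 x := fun x hx => by rw [hu.initial x hx]; exact hu₀ x hx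
  have hpos : ∀ t ∈ posTimes T, ∀ x ∈ Icc 0 a, 0 < u t x := fun t ht x hx => hu.pos hp ha hu₀ ht hx
  have hpos' : ∀ t ∈ Icc 0 T₁, ∀ x ∈ Icc 0 a, 0 < u t x := fun t ht x hx => by
    rcases ht.1.eq_or_lt with h | h
    · rw [← h]; exact hφpos x hx
    · exact hpos t (posTimes_of_le h ht.2 hT₁) x hx
  have hR : ContinuousOn (fun t => ∫ x in (0 : ℝ)..a, (u t x - u 0 x) ^ 2) (Icc 0 T₁) :=
    continuousOn_integral_of_Icc ha (F := fun t x => (u t x - u 0 x) ^ 2) ((hc.sub hφ').pow 2)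
  have hprim : ContinuousOn (primitive p) (Ioi 0) := fun s hs =>
    (hasDerivAt_primitive p hs).continuousAt.continuousWithinAt
  have hG : ContinuousOn (fun t => ∫ x in (0 : ℝ)..a, bregman p (u t x) (u 0 x)) (Icc 0 T₁) := by
    refine continuousOn_integral_of_Icc ha (F := fun t x => bregman p (u t x) (u 0 x)) ?_
    have hm : MapsTo (fun z : ℝ × ℝ => u z.1 z.2) (Icc 0 T₁ ×ˢ Icc 0 a) (Ioi 0) := fun z hz =>
      hpos' z.1 hz.1 z.2 hz.2
    have hm' : MapsTo (fun z : ℝ × ℝ => u 0 z.2) (Icc 0 T₁ ×ˢ Icc 0 a) (Ioi 0) := fun z hz =>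
      hφpos z.2 hz.2
    exact ((hprim.comp hc hm).sub (hprim.comp hφ' hm')).add ((hφ'.mul
      (((ClassicalOn.continuousOn_rpow_const (1 - p)).comp hc hm).sub
        ((ClassicalOn.continuousOn_rpow_const (1 - p)).comp hφ' hm'))).div_const _)
  have hR0 : (fun t => ∫ x in (0 : ℝ)..a, (u t x - u 0 x) ^ 2) 0 < -E₀ := by simpa using hneg'
  have hnear := (hR 0 h0T).eventually_lt continuousWithinAt_const hR0
  obtain ⟨r, hr0, hr⟩ : ∃ r ∈ Ioc 0 T₁, ∀ t ∈ Ioo 0 r,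
      ∫ x in (0 : ℝ)..a, (u t x - u 0 x) ^ 2 < -E₀ := by
    obtain ⟨δ, hδ, h⟩ := Metric.mem_nhdsWithin_iff.1 hnear
    refine ⟨min δ T₁, ⟨lt_min hδ hT₁.1, min_le_right _ _⟩, fun t ht => h ⟨?_, ht.1.le, ?_⟩⟩
    · rw [Metric.mem_ball, Real.dist_eq, sub_zero, abs_of_pos ht.1]
      exact ht.2.trans_le (min_le_left _ _)
    · exact ht.2.le.trans (min_le_right _ _)
  have hI : ∀ t ∈ Ioo 0 r, t ∈ posTimes T := fun t ht =>
    posTimes_of_le ht.1 (ht.2.le.trans hr0.2) hT₁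
  have hφI : ContinuousOn (fun z : ℝ × ℝ => u 0 z.2) (posTimes T ×ˢ Icc 0 a) :=
    hφ.comp continuousOn_snd fun _ hz => hz.2
  have hGd : ∀ t ∈ Ioo 0 r, HasDerivAt (fun t => ∫ x in (0 : ℝ)..a, bregman p (u t x) (u 0 x))
      (∫ x in (0 : ℝ)..a, u t x ^ (-p) * (u t x - u 0 x) * ut t x) t := by
    intro t ht
    have hm : MapsTo (fun z : ℝ × ℝ => u z.1 z.2) (posTimes T ×ˢ Icc 0 a) (Ioi 0) := fun z hz =>
      hpos z.1 hz.1 z.2 hz.2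
    have hm' : MapsTo (fun z : ℝ × ℝ => u 0 z.2) (posTimes T ×ˢ Icc 0 a) (Ioi 0) := fun z hz =>
      hφpos z.2 hz.2
    refine hasDerivAt_integral ha (isOpen_posTimes T) (F := fun t x => bregman p (u t x) (u 0 x))
      (F' := fun t x => u t x ^ (-p) * (u t x - u 0 x) * ut t x) ?_ ?_ ?_ (hI t ht)
    · exact ((hprim.comp hcl.cont hm).sub (hprim.comp hφI hm')).add ((hφI.mul
        (((ClassicalOn.continuousOn_rpow_const (1 - p)).comp hcl.cont hm).sub
          ((ClassicalOn.continuousOn_rpow_const (1 - p)).comp hφI hm'))).div_const _)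
    · exact (((ClassicalOn.continuousOn_rpow_const (-p)).comp hcl.cont hm).mul
        (hcl.cont.sub hφI)).mul hcl.cont_t
    · intro s hs x hx
      exact (hasDerivAt_bregman hp _ (hpos s hs x hx)).comp s (hcl.deriv_t s hs x hx)
  -- The mean value theorem needs only continuity of the functional at time 0.
  obtain ⟨t, ht, htG⟩ := exists_hasDerivAt_eq_slope _ _ hr0.1 (hG.mono (Icc_subset_Icc_right hr0.2))
    hGd
  refine ⟨t, hI t ht, ?_⟩
  have h1 := hcl.energyAt_le ha hpos (hI t ht) hφ hH
  have h2 : 0 ≤ ∫ x in (0 : ℝ)..a, u t x ^ (-p) * (u t x - u 0 x) * ut t x := by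
    rw [htG]
    refine div_nonneg ?_ (by linarith [hr0.1])
    simp only [bregman_self, intervalIntegral.integral_zero, sub_zero]
    refine intervalIntegral.integral_nonneg ha.le fun x hx => ?_
    exact bregman_nonneg hp (hpos' r ⟨hr0.1.le, hr0.2⟩ x hx) (hφpos x hx)
  linarith [hr t ht]

/-! ### Boundedness for nonnegative energy -/

/-- After a fixed positive time `t₁`, the three hypotheses of `exists_bound_of_energy_le` are the
conservation of ∫ u^(1-p), the decrease of ∫ primitive(u), where E ≥ 0 enters, and the decrease of
E. On `[0, t₁]` compactness suffices. -/
lemma IsSolution.isBoundedOn_of_energyAt_nonneg {p a : ℝ} {u₀ : ℝ → ℝ} {T : EReal}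
    {u ut ux uxx : ℝ → ℝ → ℝ} (hp1 : 1 < p) (hp2 : p ≤ 2) (ha : 0 < a)
    (hu₀ : ∀ x ∈ Icc 0 a, 0 < u₀ x) (hu : IsSolution p a u₀ T u)
    (hcl : ClassicalOn p a (posTimes T) u ut ux uxx)
    (hE : ∀ t ∈ posTimes T, 0 ≤ energyAt a u ux t) : IsBoundedOn a T u := by
  have hI := isOpen_posTimes T
  have hpos : ∀ t ∈ posTimes T, ∀ x ∈ Icc 0 a, 0 < u t x := fun t ht x hx => hu.pos hp1 ha hu₀ ht hx
  obtain ⟨t₁, ht₁, -⟩ := exists_mem_posTimes_lt hu.time_pos one_pos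
  have hslab : Icc 0 t₁ ×ˢ Icc 0 a ⊆ slab a T := fun z hz =>
    ⟨hz.1.1, lt_of_le_of_lt (EReal.coe_le_coe_iff.2 hz.1.2) ht₁.2, hz.2⟩
  obtain ⟨C₀, hC₀⟩ := (isCompact_Icc.prod isCompact_Icc).exists_bound_of_continuousOn
    (hu.continuousOn.mono hslab)
  obtain ⟨B, hB⟩ := exists_bound_of_energy_le hp1 hp2 ha
    (C := ∫ x in (0 : ℝ)..a, primitive p (u t₁ x)) (E := energyAt a u ux t₁)
    (hcl.integral_rpow_pos ha hpos ht₁ (1 - p))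
  refine ⟨max C₀ B, fun t x htx => ?_⟩
  rcases le_total t t₁ with h | h
  · exact le_max_of_le_left (hC₀ (t, x) ⟨⟨htx.1, h⟩, htx.2.2⟩)
  have ht : t ∈ posTimes T := ⟨ht₁.1.trans_le h, htx.2.1⟩
  have hsub : Icc t₁ t ⊆ posTimes T := fun s hs => posTimes_of_le (ht₁.1.trans_le hs.1) hs.2 ht
  rw [abs_of_pos (hpos t ht x htx.2.2)]
  refine le_max_of_le_right (hB (u t) (ux t) (hpos t ht) (hcl.deriv_x t ht)
    (continuousOn_slice hcl.cont_x ht) ?_ ?_ ?_ x htx.2.2)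
  · have hd := fun s (hs : s ∈ Icc t₁ t) => hcl.hasDerivAt_integral_rpow_one_sub ha hI hpos (hsub hs)
    refine le_antisymm ?_ ?_
    · exact le_of_hasDeriv_nonpos (α := t₁) (β := t) (fun s hs => (hd s hs).hasDerivWithinAt)
        (fun s _ => le_rfl) le_rfl h le_rfl
    · have := le_of_hasDeriv_nonpos (α := t₁) (β := t)
        (fun s hs => (hd s hs).neg.hasDerivWithinAt)
        (fun s _ => by simp) le_rfl h le_rfl
      simpa using this
  · refine le_of_hasDeriv_nonpos (α := t₁) (β := t)
      (F := fun s => ∫ x in (0 : ℝ)..a, primitive p (u s x)) (fun s hs =>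
        (hcl.hasDerivAt_integral_comp_energyAt ha hI hpos (c := 1) (fun r hr => by
          rw [one_mul]; exact hasDerivAt_primitive p hr) (hsub hs)).hasDerivWithinAt)
      (fun s hs => by linarith [hE s (hsub hs)]) le_rfl h le_rfl
  · have h1 := hcl.energyAt_antitone ha hI h hsub
    rw [hcl.energyAt_split ha ht, integral_sub_mean_sq ha (continuousOn_slice hcl.cont ht)] at h1
    have : 0 ≤ a * mean a (u t) ^ 2 := by positivity
    linarith

end NonlocalFlow

end

/-! ### The dichotomy. -/

theorem theorem1p2 (p a : ℝ) (hp1 : 1 < p) (hp2 : p ≤ 2) (ha : 0 < a)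
    (u₀ : ℝ → ℝ) (hu₀ : ContinuousOn u₀ (Set.Icc 0 a)) (hu₀pos : ∀ x ∈ Set.Icc 0 a, 0 < u₀ x)
    (T : EReal) (u : ℝ → ℝ → ℝ) (hu : NonlocalFlow.IsMaximalSolution p a u₀ T u) :
    ((∃ t₀ : ℝ, 0 ≤ t₀ ∧ (t₀ : EReal) < T ∧ NonlocalFlow.energy a (u t₀) < 0) →
      T < ⊤ ∧ ¬ NonlocalFlow.IsBoundedOn a T u) ∧
    ((∀ t : ℝ, 0 ≤ t → (t : EReal) < T → 0 ≤ NonlocalFlow.energy a (u t)) →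
      T = ⊤ ∧ NonlocalFlow.IsBoundedOn a T u) := by
  have hsol := hu.isSolution
  obtain ⟨ut, ux, uxx, hcl⟩ := hsol.exists_classicalOn (by linarith) ha
  -- Continuation: a bounded solution with finite `T` would extend. This gives unboundedness in the
  -- first case and `T = ⊤` in the second.
  have hcont : T < ⊤ → ¬ NonlocalFlow.IsBoundedOn a T u := by
    intro hT hb
    lift T to ℝ using ⟨hT.ne, (bot_lt_of_lt hsol.time_pos).ne'⟩
    obtain ⟨T', v, hTT', hv, huv⟩ := hsol.exists_extension hp1 ha hu₀pos hb
    exact absurd (hu.maximal T' v hv huv) (not_le.2 (EReal.coe_lt_coe_iff.2 hTT'))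
  refine ⟨?_, fun hE => ?_⟩
  · rintro ⟨t₀, ht₀, ht₀T, hneg⟩
    suffices T < ⊤ from ⟨this, hcont this⟩
    by_contra hT
    obtain rfl : T = ⊤ := not_lt_top_iff.1 hT
    obtain ⟨t, ht, htneg⟩ : ∃ t ∈ NonlocalFlow.posTimes ⊤, NonlocalFlow.energyAt a u ux t < 0 := by
      rcases ht₀.eq_or_lt with rfl | ht₀
      · exact hsol.exists_energyAt_neg hp1 ha hu₀pos hcl hneg
      · refine ⟨t₀, ⟨ht₀, ht₀T⟩, ?_⟩
        rw [hcl.energy_eq ha ⟨ht₀, ht₀T⟩] at hneg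
        exact_mod_cast hneg
    have hsub : Set.Ioi 0 ⊆ NonlocalFlow.posTimes ⊤ := fun s hs => ⟨hs, EReal.coe_lt_top s⟩
    exact absurd ((hcl.mono hsub).energyAt_nonneg_of_global (by linarith) ha
      (fun s hs x hx => hsol.pos hp1 ha hu₀pos (hsub hs) hx) ht.1) (not_le.2 htneg)
  · have hb : NonlocalFlow.IsBoundedOn a T u :=
      hsol.isBoundedOn_of_energyAt_nonneg hp1 hp2 ha hu₀pos hcl fun t ht => by
        have := hE t ht.1.le ht.2
        rw [hcl.energy_eq ha ht] at this
        exact_mod_cast this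
    exact ⟨by_contra fun hT => hcont (lt_top_iff_ne_top.2 hT) hb, hb⟩
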